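/- Let $\overline M$ be a compact oriented 3-manifold whose boundary is a union of tori $T_1,\dots,T_c$ (the cusps), decomposed into finitely many truncated tetrahedra glued in pairs along all their hexagonal faces; the truncation triangles then triangulate $\partial\overline M$. Assign a real angle to each pair of opposite edges of each tetrahedron (hence to each corner of each boundary triangle). This is a *generalized angle structure* if the three angles of each tetrahedron sum to $\pi$ and the angles around each interior edge sum to $2\pi$; it is *nonnegative* if all angles are $\ge 0$, and *taut* if all angles lie in $\{0,\pi\}$. Fix a taut angle structure. It is *veering* if at every vertex $v$ of $\partial\overline M$, either all boundary triangles with angle $0$ at $v$ have their $\pi$-angle immediately before $v$ in the counterclockwise cyclic order ($v$ is left-veering), or all of them have it immediately after $v$ ($v$ is right-veering). It is *transverse-taut* if the faces carry a coherent transverse orientation that, in each tetrahedron, points inward along the two faces sharing one of the $\pi$-edges and outward along the two faces sharing the other. Assume both properties and fix such a transverse orientation. The edges of $\partial\overline M$ joining two vertices that veer in the same direction form disjoint closed curves, the *ladderpoles*, which cut $\partial\overline M$ into annuli, the *ladders*; the other edges, the *rungs*, cross the ladders. Ladderpoles are oriented *upward*, i.e. in the direction in which the transverse orientation crosses the rungs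 of the adjacent ladders. Let $2k_i$ be the number of ladders in $T_i$. For a simple closed oriented normal curve $\gamma\subset\partial\overline M$ (transverse to the edges, entering and leaving each triangle it crosses through different sides) that is homologically nontrivial, and $n\in\mathbb Z$, the *angular holonomy* of $n[\gamma]$ for a generalized angle structure $\theta$ is $h_\theta(n[\gamma])=n(\mathcal A_\gamma-\mathcal B_\gamma)$, where $\mathcal A_\gamma$ and $\mathcal B_\gamma$ are the sums of the angles of the corners cut off by $\gamma$ to its left and to its right; this depends only on the class $n[\gamma]$. **Proposition.** Let $\varepsilon\in\{-1,1\}$, and for each $i$ let $\delta_i\in H_1(T_i;\mathbb Z)\subset H_1(\partial\overline M;\mathbb Z)$ be a class having intersection number $\varepsilon$ with the upward-oriented ladderpoles of $T_i$ (a crossing of a ladderpole from its left to its right counts $+1$). Then for every subset $J\subset\{1,\dots,c\}$ there is a nonnegative angle structure $\theta$ such that $$h_\theta(\delta_i)=\begin{cases}\varepsilon k_i\pi & \text{if } i\in J,\\ 0 & \text{otherwise.}\end{cases}$$ -/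

import Mathlib

noncomputable section

open scoped Classical

/-! # Combinatorics of one tetrahedron

A tetrahedron has vertices `0, 1, 2, 3 : Fin 4`; the face `f` is the face opposite the vertex `f`.
Truncating the tip `v` creates a boundary triangle, whose three corners are indexed by the vertices
`w ≠ v` (the corner `w` lies on the interior edge `vw`), and whose three sides are indexed by the
vertices `f ≠ v` (the side `f` lies in the face `f` of the tetrahedron). Thus in each boundary
triangle the side `f` is the side opposite the corner `f`. -/

/-- `ccw v w` is the corner following the corner `w` in the counterclockwise cyclic order of the
boundary triangle at the tip `v` (for `w ≠ v`; the unused value at `w = v` is `v`).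
By `ccw_even`, `v, w, ccw v w, ccw v (ccw v w)` is an even permutation of `0, 1, 2, 3`. -/
def ccw (v w : Fin 4) : Fin 4 :=
  (![![0, 2, 3, 1], ![3, 1, 0, 2], ![1, 3, 2, 0], ![2, 0, 1, 3]] : Fin 4 → Fin 4 → Fin 4) v w

theorem ccw_ne (v w : Fin 4) (h : w ≠ v) : ccw v w ≠ v := by
  revert v w; decide

theorem ccw_even (v w : Fin 4) (h : w ≠ v) : ∃ σ : Equiv.Perm (Fin 4),
    σ 0 = v ∧ σ 1 = w ∧ σ 2 = ccw v w ∧ σ 3 = ccw v (ccw v w) ∧ Equiv.Perm.sign σ = 1 := by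
  revert v w; decide

/-- The index of the pair of opposite edges of the tetrahedron containing the edge `ab` (`a ≠ b`):
`01|23`, `02|13` and `03|12` have index `0`, `1` and `2`. (Unused value `0` for `a = b`.) -/
def oppPair (a b : Fin 4) : Fin 3 :=
  (![![0, 0, 1, 2], ![0, 0, 2, 1], ![1, 2, 0, 0], ![2, 1, 0, 0]] : Fin 4 → Fin 4 → Fin 3) a b

/-- A corner of a boundary triangle: the corner `idx` of the triangle at the tip `tip` of the
tetrahedron `tet`. -/
@[ext] structure Corner (T : Type*) where
  tet : T
  tip : Fin 4
  idx : Fin 4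
  ne : idx ≠ tip

/-- A side of a boundary triangle, viewed from that triangle. It is named by the
opposite corner: `s : Side T` is the side contained in the face `s.idx` of the tetrahedron. -/
abbrev Side (T : Type*) := Corner T

namespace Corner

variable {T : Type*}

instance [Fintype T] : Fintype (Corner T) :=
  Fintype.ofInjective (fun c : Corner T => (c.tet, c.tip, c.idx)) (by
    rintro ⟨a, b, c, h⟩ ⟨a', b', c', h'⟩ e
    simp only [Prod.mk.injEq] at e
    obtain ⟨rfl, rfl, rfl⟩ := e
    rfl)

/-- The boundary triangle containing a corner (or side). -/
def tri (c : Corner T) : T × Fin 4 := (c.tet, c.tip)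

/-- The next corner (or side) of the same triangle in the counterclockwise order. -/
def next (c : Corner T) : Corner T := ⟨c.tet, c.tip, ccw c.tip c.idx, ccw_ne _ _ c.ne⟩

/-- The previous corner (or side) of the same triangle in the counterclockwise order. -/
def prev (c : Corner T) : Corner T := c.next.next

/-- The position of a corner in its triangle, in barycentric coordinates. -/
def point (c : Corner T) : Fin 4 → ℝ := Pi.single c.idx 1

end Corner

/-- An oriented ideal triangulation with set of tetrahedra `T`. The face `f` of the tetrahedron `t`
is glued to the face `glue t f f` of the tetrahedron `nbr t f`, the vertex `w ≠ f` of this face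
going to `glue t f w`. The gluings are consistent, no face is glued to itself, and the gluing maps
reverse the orientations of the faces, that is, the permutations `glue t f` are odd.
The underlying manifold is obtained from the truncated tetrahedra; that its boundary consists of
tori is automatic as soon as there is a generalized angle structure (by Gauss-Bonnet). -/
structure IdealTriangulation (T : Type*) where
  nbr : T → Fin 4 → T
  glue : T → Fin 4 → Equiv.Perm (Fin 4)
  nbr_nbr : ∀ t f, nbr (nbr t f) (glue t f f) = t
  glue_glue : ∀ t f, glue (nbr t f) (glue t f f) = (glue t f)⁻¹
  not_self : ∀ t f, ¬ (nbr t f = t ∧ glue t f f = f)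
  odd : ∀ t f, Equiv.Perm.sign (glue t f) = -1

namespace IdealTriangulation

variable {T : Type*} (τ : IdealTriangulation T)

/-! ## The triangulated boundary -/

/-- The same side, viewed from the boundary triangle across it. -/
def across (s : Side T) : Side T :=
  ⟨τ.nbr s.tet s.idx, τ.glue s.tet s.idx s.tip, τ.glue s.tet s.idx s.idx,
    fun h => s.ne ((τ.glue s.tet s.idx).injective h)⟩

theorem across_across (s : Side T) : τ.across (τ.across s) = s := by
  have h := τ.glue_glue s.tet s.idx
  ext <;> simp [across, τ.nbr_nbr, h]

/-- At a vertex of the boundary triangulation, the corner following the corner `c` in the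
counterclockwise order around the vertex: it lies across the side `c.next`. -/
def rot (c : Corner T) : Corner T :=
  ⟨τ.nbr c.tet c.next.idx, τ.glue c.tet c.next.idx c.tip, τ.glue c.tet c.next.idx c.idx,
    fun h => c.ne ((τ.glue c.tet c.next.idx).injective h)⟩

/-- The vertices of the boundary triangulation, as classes of corners.
Each interior edge of the manifold has two endpoints, both of which are such vertices. -/
def Vertex : Type _ := Quot (fun c d : Corner T => d = τ.rot c)

/-- The vertex of the boundary triangulation at a corner. -/
def vertex (c : Corner T) : τ.Vertex := Quot.mk _ c

/-- The cusps, that is, the connected components of the boundary, as classes of triangles. -/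
def Cusp : Type _ :=
  Quot (fun A B : T × Fin 4 => ∃ s : Side T, s.tri = A ∧ (τ.across s).tri = B)

/-- The cusp containing a boundary triangle. -/
def cusp (A : T × Fin 4) : τ.Cusp := Quot.mk _ A

/-! ## Angle structures -/

/-- The angle at a corner, when angles are assigned to the pairs of opposite edges. -/
def _root_.Corner.angle (c : Corner T) (θ : T → Fin 3 → ℝ) : ℝ := θ c.tet (oppPair c.tip c.idx)

/-- Generalized angle structures: the angles of each tetrahedron add up to `π`, and the angles
around each interior edge (equivalently, at each vertex of the boundary) add up to `2π`. -/
def IsGeneralizedAngleStructure [Fintype T] (θ : T → Fin 3 → ℝ) : Prop :=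
  (∀ t, ∑ j, θ t j = Real.pi) ∧
  ∀ v : τ.Vertex, ∑ c : Corner T with τ.vertex c = v, c.angle θ = 2 * Real.pi

/-- Nonnegative angle structures. -/
def IsNonnegAngleStructure [Fintype T] (θ : T → Fin 3 → ℝ) : Prop :=
  τ.IsGeneralizedAngleStructure θ ∧ ∀ t j, 0 ≤ θ t j

/-- Taut angle structures. -/
def IsTaut [Fintype T] (α : T → Fin 3 → ℝ) : Prop :=
  τ.IsGeneralizedAngleStructure α ∧ ∀ t j, α t j = 0 ∨ α t j = Real.pi

/-- The boundary vertex at the corner `c` is left-veering: in all triangles of its fans (the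
triangles having angle `0` at this vertex), the angle `π` comes immediately before this vertex in
the counterclockwise order. -/
def LeftVeering (α : T → Fin 3 → ℝ) (c : Corner T) : Prop :=
  ∀ d : Corner T, τ.vertex d = τ.vertex c → d.angle α = 0 → d.prev.angle α = Real.pi

/-- The boundary vertex at the corner `c` is right-veering: in all triangles of its fans, the angle
`π` comes immediately after this vertex in the counterclockwise order. -/
def RightVeering (α : T → Fin 3 → ℝ) (c : Corner T) : Prop :=
  ∀ d : Corner T, τ.vertex d = τ.vertex c → d.angle α = 0 → d.next.angle α = Real.pi

/-- Veering (taut angle) structures. -/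
def IsVeering [Fintype T] (α : T → Fin 3 → ℝ) : Prop :=
  τ.IsTaut α ∧ ∀ c : Corner T, τ.LeftVeering α c ∨ τ.RightVeering α c

/-- `out` is a transverse orientation of the faces making the taut angle structure `α`
transverse-taut; `out t f` says whether it points out of `t` (or into `t`) along the face `f`.
In each tetrahedron the two faces sharing one edge of angle `π` point inward, and the two faces
sharing the other edge of angle `π` point outward. (The faces `f ≠ g` share the edge opposite to
the edge `fg`, which has the same angle as `fg`.) -/
def IsTransverseTaut (α : T → Fin 3 → ℝ) (out : T → Fin 4 → Bool) : Prop :=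
  (∀ t f, out (τ.nbr t f) (τ.glue t f f) = !(out t f)) ∧
  ∀ t f g, f ≠ g → (out t f = out t g ↔ α t (oppPair f g) = Real.pi)

/-! ## Ladders and ladderpoles

The side `s` runs from the corner `s.next` to the corner `s.prev`, in the counterclockwise
direction along the boundary of its triangle, with the triangle on its left. -/

/-- Ladderpole segments: the sides both of whose ends veer in the same direction.
All the other sides are rungs. -/
def IsPoleSegment (α : T → Fin 3 → ℝ) (s : Side T) : Prop :=
  (τ.LeftVeering α s.next ∧ τ.LeftVeering α s.prev) ∨
  (τ.RightVeering α s.next ∧ τ.RightVeering α s.prev)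

/-- The ladders (the components of the complement of the ladderpole segments in the boundary), as
classes of triangles adjacent along rungs. -/
def Ladder (α : T → Fin 3 → ℝ) : Type _ :=
  Quot (fun A B : T × Fin 4 =>
    ∃ s : Side T, ¬ τ.IsPoleSegment α s ∧ s.tri = A ∧ (τ.across s).tri = B)

/-- The ladder containing a boundary triangle. -/
def ladder (α : T → Fin 3 → ℝ) (A : T × Fin 4) : τ.Ladder α := Quot.mk _ A

/-- The number of ladders carried by a cusp. -/
def numLadders (α : T → Fin 3 → ℝ) (c : τ.Cusp) : ℕ :=
  {L : τ.Ladder α | ∃ A, τ.cusp A = c ∧ τ.ladder α A = L}.ncard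

/-- The ladderpoles (the components of the union of the ladderpole segments, which passes
through all vertices), as classes of corners. -/
def Ladderpole (α : T → Fin 3 → ℝ) : Type _ :=
  Quot (fun c d : Corner T =>
    d = τ.rot c ∨ ∃ s : Side T, τ.IsPoleSegment α s ∧ s.next = c ∧ s.prev = d)

/-- The ladderpole through the vertex at a corner. -/
def ladderpole (α : T → Fin 3 → ℝ) (c : Corner T) : τ.Ladderpole α := Quot.mk _ c

/-- The ladderpole segment `s`, directed from `s.next` to `s.prev`, points upward. Upward is the
direction in which the rungs of the two adjacent ladders are crossed according to the transverse
orientation. The base of a triangle is the side opposite its wide corner `w`, and one end of a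
ladderpole segment in the triangle is `w`. If the transverse orientation points into the triangle
along the base, then `w` is above the base and the segment ascends towards `w`; if it points out
of the triangle along the base, then `w` is below the base and the segment ascends from `w`. -/
def IsUpward (α : T → Fin 3 → ℝ) (out : T → Fin 4 → Bool) (s : Side T) : Prop :=
  τ.IsPoleSegment α s ∧
  ((s.prev.angle α = Real.pi ∧ out s.tet s.prev.idx = false) ∨
   (s.next.angle α = Real.pi ∧ out s.tet s.next.idx = true))

/-! ## Homology of the boundary

Integral homology is computed with the cell structure dual to the triangulation of the boundary.
A `1`-chain is an antisymmetric function `x` on sides, `x s` being the number of times that it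
leaves the triangle of `s` through the side `s`. -/

/-- The elementary chain that crosses the side `s` once, leaving the triangle of `s`. -/
def cross (s : Side T) : Side T → ℤ := Pi.single s 1 - Pi.single (τ.across s) 1

/-- The group of `1`-cycles. -/
def cycles [Fintype T] : AddSubgroup (Side T → ℤ) where
  carrier := {x | (∀ s, x (τ.across s) = - x s) ∧
    ∀ A : T × Fin 4, ∑ s : Side T with s.tri = A, x s = 0}
  zero_mem' := by simp
  add_mem' := by
    rintro x y ⟨hx, hx'⟩ ⟨hy, hy'⟩
    refine ⟨fun s => ?_, fun A => ?_⟩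
    · simp only [Pi.add_apply, hx, hy]; ring
    · simp only [Pi.add_apply, Finset.sum_add_distrib, hx', hy', add_zero]
  neg_mem' := by
    rintro x ⟨hx, hx'⟩
    refine ⟨fun s => ?_, fun A => ?_⟩
    · simp only [Pi.neg_apply, hx]
    · simp only [Pi.neg_apply, Finset.sum_neg_distrib, hx', neg_zero]

/-- The boundary of the dual `2`-cell at a vertex: the counterclockwise loop around it. -/
def vertexLoop [Fintype T] (v : τ.Vertex) : Side T → ℤ :=
  ∑ c : Corner T with τ.vertex c = v, τ.cross c.next

/-- The group of `1`-boundaries. -/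
def boundaries [Fintype T] : AddSubgroup (Side T → ℤ) :=
  AddSubgroup.closure (Set.range τ.vertexLoop)

/-- The first integral homology group of the boundary. -/
abbrev H1 [Fintype T] : Type _ := τ.cycles ⧸ (τ.boundaries.addSubgroupOf τ.cycles)

/-- The homology class of a cycle. -/
def homologyClass [Fintype T] (x : τ.cycles) : τ.H1 := QuotientAddGroup.mk x

/-- The intersection number of the cycle `x` with the upward-oriented ladderpole `p`: the number of
times (counted with signs) that `x` crosses `p` from the left to the right of `p`. -/
def intersectionNumber [Fintype T] (α : T → Fin 3 → ℝ) (out : T → Fin 4 → Bool)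
    (x : Side T → ℤ) (p : τ.Ladderpole α) : ℤ :=
  ∑ s : Side T with τ.IsUpward α out s ∧ τ.ladderpole α s.next = p, x s

/-- The homology class `δ` lies in `H₁` of the cusp `c` and has intersection number `m` with
every upward-oriented ladderpole in this cusp. -/
def MeetsLadderpoles [Fintype T] (α : T → Fin 3 → ℝ) (out : T → Fin 4 → Bool)
    (c : τ.Cusp) (δ : τ.H1) (m : ℤ) : Prop :=
  ∃ x : τ.cycles, τ.homologyClass x = δ ∧
    (∀ s, (x : Side T → ℤ) s ≠ 0 → τ.cusp s.tri = c) ∧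
    ∀ d : Corner T, τ.cusp d.tri = c →
      τ.intersectionNumber α out x (τ.ladderpole α d) = m

end IdealTriangulation

/-! ## Normal curves and holonomy -/

/-- An oriented normal arc in a boundary triangle: it cuts off one corner, which is
either to its left or to its right. -/
structure NormalArc (T : Type*) where
  corner : Corner T
  left : Bool

namespace NormalArc

variable {T : Type*}

/-- The side through which the arc enters the triangle. -/
def entry (a : NormalArc T) : Side T := if a.left then a.corner.prev else a.corner.next

/-- The side through which the arc leaves the triangle. -/
def exit (a : NormalArc T) : Side T := if a.left then a.corner.next else a.corner.prev

end NormalArc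

/-- A simple closed oriented normal curve on the boundary, made of the `n + 1` arcs `arc j` in
this cyclic order. Up to normal isotopy, the arcs may be taken to be straight segments in the
boundary triangles, from the point `startPt j` in the interior of the entry side to the point
`endPt j` in the interior of the exit side (in barycentric coordinates). -/
structure SimpleNormalCurve {T : Type*} (τ : IdealTriangulation T) where
  n : ℕ
  arc : Fin (n + 1) → NormalArc T
  closed : ∀ j, τ.across (arc j).exit = (arc (j + 1)).entry
  startPt : Fin (n + 1) → Fin 4 → ℝ
  endPt : Fin (n + 1) → Fin 4 → ℝ
  startPt_mem : ∀ j, startPt j ∈ openSegment ℝ (arc j).entry.next.point (arc j).entry.prev.point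
  endPt_mem : ∀ j, endPt j ∈ openSegment ℝ (arc j).exit.next.point (arc j).exit.prev.point
  startPt_succ : ∀ j w,
    startPt (j + 1) (τ.glue (arc j).exit.tet (arc j).exit.idx w) = endPt j w
  embedded : ∀ i j, i ≠ j → (arc i).corner.tri = (arc j).corner.tri →
    Disjoint (segment ℝ (startPt i) (endPt i)) (segment ℝ (startPt j) (endPt j))

namespace SimpleNormalCurve

variable {T : Type*} {τ : IdealTriangulation T} (γ : SimpleNormalCurve τ)

/-- The turning angle: the sum of the angles cut off on the left of the curve, minus the sum of the
angles cut off on its right. -/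
def turningAngle (θ : T → Fin 3 → ℝ) : ℝ :=
  ∑ j, if (γ.arc j).left then (γ.arc j).corner.angle θ else - (γ.arc j).corner.angle θ

/-- The chain carried by the curve. -/
def chain : Side T → ℤ := ∑ j, τ.cross (γ.arc j).exit

theorem chain_mem [Fintype T] : γ.chain ∈ τ.cycles := by
  refine ⟨fun s => ?_, fun A => ?_⟩
  · have key : ∀ s u : Side T, τ.across s = u ↔ s = τ.across u := fun s u =>
      ⟨fun h => by rw [← h, τ.across_across], fun h => by rw [h, τ.across_across]⟩
    simp only [chain, Finset.sum_apply, ← Finset.sum_neg_distrib]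
    refine Finset.sum_congr rfl fun j _ => ?_
    simp only [IdealTriangulation.cross, Pi.sub_apply, Pi.single_apply, key, τ.across_across]
    ring
  · have hx : ∀ j, (γ.arc j).exit.tri = (γ.arc j).corner.tri := fun j => by
      unfold NormalArc.exit; split_ifs <;> rfl
    have he : ∀ j, (γ.arc j).entry.tri = (γ.arc j).corner.tri := fun j => by
      unfold NormalArc.entry; split_ifs <;> rfl
    have h1 : ∀ u : Side T, ∑ s : Side T with s.tri = A, τ.cross u s =
        (if u.tri = A then 1 else 0) - (if (τ.across u).tri = A then 1 else 0) := fun u => by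
      simp [IdealTriangulation.cross, Finset.sum_sub_distrib, Pi.single_apply]
    simp only [chain, Finset.sum_apply]
    rw [Finset.sum_comm]
    simp only [h1, γ.closed, hx, he, Finset.sum_sub_distrib]
    rw [sub_eq_zero]
    exact (Equiv.sum_comp (Equiv.addRight (1 : Fin (γ.n + 1)))
      (fun j => if (γ.arc j).corner.tri = A then (1 : ℤ) else 0)).symm

/-- The homology class of the curve. -/
def homologyClass [Fintype T] : τ.H1 := τ.homologyClass ⟨γ.chain, γ.chain_mem⟩

end SimpleNormalCurve

/-- The angular holonomy of the homology class `δ` is defined and equal to `h`: the class is an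
integer multiple `m • [γ]` with `γ` a homologically nontrivial simple closed normal curve, and for
every such presentation the product of `m` and the turning angle of `γ` is `h`. -/
def IdealTriangulation.HasHolonomy {T : Type*} [Fintype T] (τ : IdealTriangulation T)
    (θ : T → Fin 3 → ℝ) (δ : τ.H1) (h : ℝ) : Prop :=
  (∃ (γ : SimpleNormalCurve τ) (m : ℤ), γ.homologyClass ≠ 0 ∧ m • γ.homologyClass = δ) ∧
  ∀ (γ : SimpleNormalCurve τ) (m : ℤ), γ.homologyClass ≠ 0 → m • γ.homologyClass = δ →
    m * γ.turningAngle θ = h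

end

noncomputable section
open scoped Classical

/-! ## Corner calculus -/

/-! The holonomy of a curve is its turning, the signed sum of the corners it cuts off. If a function
on corners has the form `g c.next - g c.prev`, its turning along a normal curve telescopes to the
sum of the jumps `g s - g (across s)` over the exit sides (`cornerTurn_coboundary`). In particular,
a `g` that agrees on the two sides of every edge contributes nothing. The proof shows that all the
angle functions that occur differ by such coboundaries, and it keeps track of the jumps.

The given taut structure has no turning along any simple curve whose algebraic number of crossings
with the ladderpoles is nonzero. Up to jump-free coboundaries, its angles are the angles of a flat
structure on the boundary in which ladders are vertical annuli of width 1 and every ladderpole has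
length 1 (`angle_eq_squareAngle`, `flatAngle_eq`). The transition maps of this structure are
integral translations. A simple normal curve therefore develops to a polygonal line in the plane
that is invariant under a translation. This line is embedded (`crossPt_disjoint`, through
`eq_or_adjacent`), and the translation is nontrivial because its horizontal part is the crossing
number. The turning of such a line vanishes by a discrete Umlaufsatz (`sum_turnArg_eq_zero`).

Next, the structure is deformed. Whether the transverse orientation points out of a tetrahedron
through the face opposite the tip of a boundary triangle is constant along each ladder and changes
across each ladderpole (`out_tip_of_rung`, `out_tip_of_pole`). This selects every other ladder. In
the triangles of the selected ladders in the cusps of `J`, an angle `π/2` is moved from the wide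
corner to the other end of the ladderpole segment. Since angles belong to pairs of opposite edges,
the change of an angle is the sum of the changes at its four corners. The contribution of the other
three corners turns out to be a jump-free coboundary (`angle_pairSum`, `faceWeight_across`). The
remaining part is a coboundary whose jumps count crossings of ladderpoles, so the turning of a curve
changes by `π/2` times its crossing number in `J` (`turningAngle_deformation`). For `δ c` with `c ∈
J` this number is `2 * k c * ε`, which gives `ε * k c * π`. The angle sums at vertices are unchanged
because a small loop has crossing number zero. The angles stay nonnegative because only two of the
four corners of a wide pair can lose `π/2`.

Finally, `HasHolonomy` also requires the class to be a multiple of a simple closed normal curve.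
Curves that spiral through the ladders of a cusp one after another cross every ladderpole once, and
extra turns around one ladder realize every such class (`exists_spiral`,
`exists_sub_core_mem_boundaries`, `exists_simpleNormalCurve`). -/

theorem ccw_ccw_ccw (v w : Fin 4) (h : w ≠ v) : ccw v (ccw v (ccw v w)) = w := by
  revert v w; decide

theorem ccw_ne_self (v w : Fin 4) (h : w ≠ v) : ccw v w ≠ w := by
  revert v w; decide

theorem eq_or_ccw (v w u : Fin 4) (h : w ≠ v) (hu : u ≠ v) :
    u = w ∨ u = ccw v w ∨ u = ccw v (ccw v w) := by
  revert v w u; decide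

/-- An odd permutation reverses the cyclic order of the three vertices other than the tip. This is
the only place where the orientability of the gluing enters. -/
theorem ccw_odd (σ : Equiv.Perm (Fin 4)) (hσ : Equiv.Perm.sign σ = -1) (v w : Fin 4) (h : w ≠ v) :
    ccw (σ v) (σ (ccw v w)) = σ w := by
  revert σ v w; decide

namespace Corner

variable {T : Type*}

@[simp] theorem next_tri (c : Corner T) : c.next.tri = c.tri := rfl
@[simp] theorem prev_tri (c : Corner T) : c.prev.tri = c.tri := rfl
@[simp] theorem next_tet (c : Corner T) : c.next.tet = c.tet := rfl
@[simp] theorem prev_tet (c : Corner T) : c.prev.tet = c.tet := rfl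
@[simp] theorem next_tip (c : Corner T) : c.next.tip = c.tip := rfl
@[simp] theorem prev_tip (c : Corner T) : c.prev.tip = c.tip := rfl

theorem next_idx (c : Corner T) : c.next.idx = ccw c.tip c.idx := rfl
theorem prev_idx (c : Corner T) : c.prev.idx = ccw c.tip (ccw c.tip c.idx) := rfl

@[simp] theorem prev_next (c : Corner T) : c.prev.next = c := by
  ext <;> simp [prev, next, ccw_ccw_ccw _ _ c.ne]

@[simp] theorem next_prev (c : Corner T) : c.next.prev = c := c.prev_next

@[simp] theorem next_next (c : Corner T) : c.next.next = c.prev := rfl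

@[simp] theorem prev_prev (c : Corner T) : c.prev.prev = c.next := by
  exact congrArg next (prev_next c)

theorem next_ne (c : Corner T) : c.next ≠ c := fun h =>
  ccw_ne_self _ _ c.ne (congrArg Corner.idx h)

theorem prev_ne (c : Corner T) : c.prev ≠ c := fun h =>
  c.next_ne (by conv_lhs => rw [← h]
                exact prev_next c)

theorem next_ne_prev (c : Corner T) : c.next ≠ c.prev := fun h => c.next.next_ne h.symm

theorem prev_injective : Function.Injective (prev : Corner T → Corner T) := fun a b h => by
  rw [← prev_next a, h, prev_next]

theorem eq_of_tri_eq {c d : Corner T} (h : d.tri = c.tri) : d = c ∨ d = c.next ∨ d = c.prev := by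
  obtain ⟨t, v, w, hw⟩ := c
  obtain ⟨t', v', w', hw'⟩ := d
  simp only [tri, Prod.mk.injEq] at h
  obtain ⟨rfl, rfl⟩ := h
  rcases eq_or_ccw _ w w' hw hw' with h | h | h <;> subst h
  · exact Or.inl rfl
  · exact Or.inr (Or.inl rfl)
  · exact Or.inr (Or.inr rfl)

theorem exists_tri_eq (A : T × Fin 4) : ∃ c : Corner T, c.tri = A := by
  obtain ⟨t, v⟩ := A
  have : ∃ w : Fin 4, w ≠ v := by revert v; decide
  obtain ⟨w, hw⟩ := this
  exact ⟨⟨t, v, w, hw⟩, rfl⟩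

theorem sum_tri [Fintype T] {M : Type*} [AddCommMonoid M] (f : Corner T → M) (c : Corner T) :
    ∑ s : Corner T with s.tri = c.tri, f s = f c + f c.next + f c.prev := by
  have : (Finset.univ.filter fun s : Corner T => s.tri = c.tri) = {c, c.next, c.prev} := by
    ext s
    simp only [Finset.mem_filter, Finset.mem_univ, true_and, Finset.mem_insert,
      Finset.mem_singleton]
    refine ⟨eq_of_tri_eq, ?_⟩
    rintro (rfl | rfl | rfl) <;> rfl
  rw [this, Finset.sum_insert, Finset.sum_pair c.next_ne_prev, add_assoc]
  simp [c.next_ne.symm, c.prev_ne.symm]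

theorem angle_sum [Fintype T] (θ : T → Fin 3 → ℝ) (c : Corner T) :
    c.angle θ + c.next.angle θ + c.prev.angle θ = ∑ j, θ c.tet j := by
  obtain ⟨t, v, w, hw⟩ := c
  rw [Fin.sum_univ_three]
  simp only [angle, prev, next]
  revert v w; intro v w
  fin_cases v <;> fin_cases w <;> simp [oppPair, ccw] <;> ring

end Corner

/-! ### Rotation about the boundary vertices, and boundaries as gradients. -/

namespace IdealTriangulation

variable {T : Type*} (τ : IdealTriangulation T)

/-- Gluings reverse the cyclic order of a triangle. After crossing the side `c.next`, the same
vertex is thus found one step further counterclockwise from that side. From here on, all incidences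
are words in `next`, `prev` and `across`. -/
theorem rot_eq (c : Corner T) : τ.rot c = (τ.across c.next).next := by
  ext
  · rfl
  · rfl
  · exact (congrArg Fin.val (ccw_odd _ (τ.odd _ _) c.tip c.idx c.ne).symm : _) ▸ rfl

theorem across_next (s : Side T) : (τ.across s).next = τ.rot s.prev := by
  rw [rot_eq, Corner.prev_next]

theorem rot_across_prev (s : Side T) : τ.rot (τ.across s).prev = s.next := by
  rw [rot_eq, Corner.prev_next, across_across]

theorem rot_prev (c : Corner T) : (τ.rot c).prev = τ.across c.next := by
  rw [rot_eq, Corner.next_prev]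

theorem across_injective : Function.Injective τ.across := fun a b h => by
  rw [← τ.across_across a, h, τ.across_across]

theorem across_idx (s : Side T) : (τ.across s).idx = τ.glue s.tet s.idx s.idx := rfl

theorem across_next_idx (s : Side T) :
    (τ.across s).next.idx = τ.glue s.tet s.idx s.prev.idx := by
  rw [across_next]
  show τ.glue _ s.prev.next.idx _ = _
  rw [Corner.prev_next]; rfl

theorem across_prev_idx (s : Side T) :
    (τ.across s).prev.idx = τ.glue s.tet s.idx s.next.idx := by
  have h := τ.rot_across_prev s
  have h1 := congrArg Corner.idx h
  have h2 : (τ.rot (τ.across s).prev).idx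
      = τ.glue (τ.across s).tet (τ.across s).prev.next.idx (τ.across s).prev.idx := rfl
  rw [h2, Corner.prev_next] at h1
  have h3 : τ.glue (τ.across s).tet (τ.across s).idx = (τ.glue s.tet s.idx)⁻¹ := τ.glue_glue _ _
  rw [h3] at h1
  rw [← h1]; simp

/-- The rotation about the vertices, as a permutation. -/
def rotEquiv : Equiv.Perm (Corner T) where
  toFun := τ.rot
  invFun c := (τ.across c.prev).prev
  left_inv c := by
    show (τ.across (τ.rot c).prev).prev = c
    rw [rot_prev, across_across, Corner.next_prev]
  right_inv c := by
    show τ.rot (τ.across c.prev).prev = c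
    rw [rot_across_prev, Corner.prev_next]

@[simp] theorem vertex_rot (c : Corner T) : τ.vertex (τ.rot c) = τ.vertex c :=
  (Quot.sound rfl : Quot.mk _ c = Quot.mk _ (τ.rot c)).symm

theorem vertex_across_next (s : Side T) : τ.vertex (τ.across s).next = τ.vertex s.prev := by
  rw [across_next, vertex_rot]

theorem vertex_across_prev (s : Side T) : τ.vertex (τ.across s).prev = τ.vertex s.next := by
  rw [← rot_across_prev, vertex_rot]

theorem vertex_surjective (v : τ.Vertex) : ∃ c, τ.vertex c = v := Quot.exists_rep v

/-- Since `rot` is bijective, the equivalence relation it generates is that of its cycles. One can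
therefore walk from a corner to any other corner of its vertex. -/
theorem sameCycle_of_vertex_eq {c d : Corner T} (h : τ.vertex c = τ.vertex d) :
    τ.rotEquiv.SameCycle c d := by
  have h' := Quot.eqvGen_exact h
  induction h' with
  | rel x y hxy => exact ⟨1, hxy.symm⟩
  | refl x => exact Equiv.Perm.SameCycle.refl _ _
  | symm x y _ ih => exact (ih (Quot.eqvGen_sound ‹_›)).symm
  | trans x y z h1 h2 ih1 ih2 =>
    exact (ih1 (Quot.eqvGen_sound h1)).trans (ih2 (Quot.eqvGen_sound h2))

theorem exists_rot_iterate [Finite T] {c d : Corner T} (h : τ.vertex c = τ.vertex d) :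
    ∃ k : ℕ, τ.rot^[k] c = d := by
  have : Finite (Corner T) := by
    have := Fintype.ofFinite T; infer_instance
  obtain ⟨k, hk⟩ := (τ.sameCycle_of_vertex_eq h).exists_nat_pow_eq
  exact ⟨k, by rw [← hk, ← Equiv.Perm.iterate_eq_pow]; rfl⟩

/-- The source of all telescoping around a vertex: a term `f c - f (rot c)` sums to zero over the
corners of a vertex. -/
theorem sum_vertex_rot [Fintype T] {M : Type*} [AddCommMonoid M] (f : Corner T → M)
    (v : τ.Vertex) :
    ∑ c : Corner T with τ.vertex c = v, f (τ.rot c) = ∑ c : Corner T with τ.vertex c = v, f c := by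
  refine Finset.sum_equiv τ.rotEquiv (fun c => ?_) (fun c _ => rfl)
  simp only [Finset.mem_filter, Finset.mem_univ, true_and]
  show _ ↔ τ.vertex (τ.rot c) = v
  rw [vertex_rot]

/-- A side is crossed by the loop positively if it ends at the vertex and negatively if it starts
there, so the loop is the gradient of the indicator function of the vertex. -/
theorem vertexLoop_apply [Fintype T] (v : τ.Vertex) (s : Side T) :
    τ.vertexLoop v s = (if τ.vertex s.prev = v then 1 else 0)
      - (if τ.vertex s.next = v then 1 else 0) := by
  have h1 : ∀ c : Corner T, s = c.next ↔ c = s.prev := fun c =>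
    ⟨fun h => by rw [h, Corner.next_prev], fun h => by rw [h, Corner.prev_next]⟩
  have h2 : ∀ c : Corner T, s = τ.across c.next ↔ c = (τ.across s).prev := fun c =>
    ⟨fun h => by rw [h, across_across, Corner.next_prev],
      fun h => by rw [h, Corner.prev_next, across_across]⟩
  simp only [vertexLoop, Finset.sum_apply, cross, Pi.sub_apply, Pi.single_apply, h1, h2,
    Finset.sum_sub_distrib, Finset.sum_ite_eq', Finset.mem_filter, Finset.mem_univ, true_and,
    vertex_across_prev]

/-- Boundaries, seen as gradients of functions on the vertices. -/
theorem mem_boundaries_iff [Fintype T] (x : Side T → ℤ) :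
    x ∈ τ.boundaries ↔
      ∃ f : τ.Vertex → ℤ, ∀ s, x s = f (τ.vertex s.prev) - f (τ.vertex s.next) := by
  have : Finite τ.Vertex := Quot.finite _
  let _ := Fintype.ofFinite τ.Vertex
  constructor
  · intro hx
    refine AddSubgroup.closure_induction (p := fun x _ => ∃ f : τ.Vertex → ℤ, ∀ s, x s =
      f (τ.vertex s.prev) - f (τ.vertex s.next)) ?_ ?_ ?_ ?_ hx
    · rintro _ ⟨v, rfl⟩
      exact ⟨fun u => if u = v then 1 else 0, fun s => τ.vertexLoop_apply v s⟩
    · exact ⟨0, fun s => by simp⟩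
    · rintro x y _ _ ⟨f, hf⟩ ⟨g, hg⟩
      exact ⟨f + g, fun s => by simp only [Pi.add_apply, hf, hg]; ring⟩
    · rintro x _ ⟨f, hf⟩
      exact ⟨-f, fun s => by simp only [Pi.neg_apply, hf]; ring⟩
  · rintro ⟨f, hf⟩
    have : x = ∑ v, f v • τ.vertexLoop v := by
      ext s
      simp only [Finset.sum_apply, Pi.smul_apply, vertexLoop_apply, hf, smul_eq_mul, mul_sub,
        Finset.sum_sub_distrib, mul_ite, mul_one, mul_zero, Finset.sum_ite_eq, Finset.mem_univ,
        if_true]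
    rw [this]
    exact sum_mem fun v _ => zsmul_mem (AddSubgroup.subset_closure (Set.mem_range_self v)) _

end IdealTriangulation
end

noncomputable section
open scoped Classical

/-! ## Ladder structures

The combinatorics of the decomposition of the boundary into ladders. A side `s` is a ladderpole
segment (`pole s`) or a rung. For a ladderpole segment, `pos s` says that `s`, directed so that its
triangle is on its left, points upward, so that this triangle is on the left of the ladderpole; for
a rung, it says that `s` is the top side of its triangle with respect to the upward direction. -/

structure LadderStructure {T : Type*} [Fintype T] (τ : IdealTriangulation T) where
  pole : Side T → Prop
  pos : Side T → Prop
  pole_across : ∀ s, pole (τ.across s) ↔ pole s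
  pos_across : ∀ s, pos (τ.across s) ↔ ¬ pos s
  exists_pole : ∀ s, pole s ∨ pole s.next ∨ pole s.prev
  pole_next : ∀ s, pole s → ¬ pole s.next
  pole_prev : ∀ s, pole s → ¬ pole s.prev
  pos_next : ∀ s, pole s → (pos s.next ↔ pos s)
  pos_prev : ∀ s, pole s → (pos s.prev ↔ ¬ pos s)
  card_pole : ∀ v : τ.Vertex,
    (Finset.univ.filter fun c : Corner T => τ.vertex c = v ∧ pole c.next).card = 2

namespace LadderStructure

variable {T : Type*} [Fintype T] {τ : IdealTriangulation T} (L : LadderStructure τ)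

/-- The corner `c` lies on the left boundary of the ladder of its triangle. -/
def leftCorner (c : Corner T) : Prop := if L.pole c.next then ¬ L.pos c.next else L.pos c.next

theorem leftCorner_of_pole {c : Corner T} (h : L.pole c.next) :
    L.leftCorner c ↔ ¬ L.pos c.next := by simp [leftCorner, h]

theorem leftCorner_of_rung {c : Corner T} (h : ¬ L.pole c.next) :
    L.leftCorner c ↔ L.pos c.next := by simp [leftCorner, h]

/-- The answer does not depend on whether `c.next` is a rung or a ladderpole segment, whereas
`leftCorner c` does. Comparing the two, a rotation changes from one side of the ladderpole to the
other exactly when it crosses a ladderpole segment. -/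
theorem leftCorner_rot (c : Corner T) : L.leftCorner (τ.rot c) ↔ L.pos c.next := by
  rw [τ.rot_eq]
  set s := τ.across c.next with hs
  have h1 : L.pos c.next ↔ ¬ L.pos s := by rw [hs, L.pos_across, not_not]
  rw [h1]
  rcases L.exists_pole s with h | h | h
  · have h2 : ¬ L.pole s.next.next := L.pole_prev _ h
    rw [L.leftCorner_of_rung h2, Corner.next_next, L.pos_prev _ h]
  · have h2 : ¬ L.pole s.next.next := L.pole_next _ h
    have h3 := L.pos_prev _ h
    rw [Corner.next_prev] at h3
    rw [L.leftCorner_of_rung h2, L.pos_next _ h, h3, not_not]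
  · have h2 : L.pole s.next.next := h
    have h3 := L.pos_next _ h
    rw [Corner.prev_next] at h3
    rw [L.leftCorner_of_pole h2, Corner.next_next, h3]

/-- Around the vertex, the indicator of `leftCorner` returns to its initial value, so it jumps up as
often as it jumps down. The jumps occur at the ladderpole segments, and their sign is given by
`pos`. -/
theorem card_up_eq_card_down (v : τ.Vertex) :
    (Finset.univ.filter fun c : Corner T => τ.vertex c = v ∧ L.pole c.next ∧ L.pos c.next).card =
    (Finset.univ.filter fun c : Corner T => τ.vertex c = v ∧ L.pole c.next ∧ ¬ L.pos c.next).card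
    := by
  have h := τ.sum_vertex_rot (fun c => if L.leftCorner c then (1 : ℤ) else 0) v
  rw [← sub_eq_zero, ← Finset.sum_sub_distrib] at h
  have h2 : ∀ c : Corner T, ((if L.leftCorner (τ.rot c) then (1 : ℤ) else 0)
      - (if L.leftCorner c then (1 : ℤ) else 0)) =
      (if L.pole c.next ∧ L.pos c.next then 1 else 0)
      - (if L.pole c.next ∧ ¬ L.pos c.next then 1 else 0) := fun c => by
    rw [L.leftCorner_rot]
    by_cases hp : L.pole c.next
    · by_cases hq : L.pos c.next <;> simp [L.leftCorner_of_pole hp, hp, hq]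
    · by_cases hq : L.pos c.next <;> simp [L.leftCorner_of_rung hp, hp, hq]
  simp only [h2, Finset.sum_sub_distrib] at h
  rw [← Finset.sum_filter, ← Finset.sum_filter, Finset.filter_filter, Finset.filter_filter,
    Finset.sum_const, Finset.sum_const, sub_eq_zero] at h
  simpa using h

theorem card_up_add_card_down (v : τ.Vertex) :
    (Finset.univ.filter fun c : Corner T => τ.vertex c = v ∧ L.pole c.next ∧ L.pos c.next).card +
    (Finset.univ.filter fun c : Corner T => τ.vertex c = v ∧ L.pole c.next ∧ ¬ L.pos c.next).card
    = 2 := by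
  rw [← L.card_pole v, ← Finset.card_filter_add_card_filter_not
    (s := Finset.univ.filter fun c : Corner T => τ.vertex c = v ∧ L.pole c.next)
    (fun c : Corner T => L.pos c.next), Finset.filter_filter, Finset.filter_filter]
  simp only [and_assoc]

/-- A unique upward ladderpole segment ends at each vertex. -/
theorem existsUnique_up (v : τ.Vertex) :
    ∃! c : Corner T, τ.vertex c = v ∧ L.pole c.next ∧ L.pos c.next := by
  have h1 := L.card_up_eq_card_down v
  have h2 := L.card_up_add_card_down v
  obtain ⟨c, hc⟩ := Finset.card_eq_one.1
    (show (Finset.univ.filter fun c : Corner T =>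
      τ.vertex c = v ∧ L.pole c.next ∧ L.pos c.next).card = 1 by omega)
  simp only [Finset.ext_iff, Finset.mem_filter, Finset.mem_univ, true_and,
    Finset.mem_singleton] at hc
  exact ⟨c, (hc c).2 rfl, fun d hd => (hc d).1 hd⟩

/-- A unique upward ladderpole segment starts at each vertex. -/
theorem existsUnique_down (v : τ.Vertex) :
    ∃! c : Corner T, τ.vertex c = v ∧ L.pole c.next ∧ ¬ L.pos c.next := by
  have h1 := L.card_up_eq_card_down v
  have h2 := L.card_up_add_card_down v
  obtain ⟨c, hc⟩ := Finset.card_eq_one.1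
    (show (Finset.univ.filter fun c : Corner T =>
      τ.vertex c = v ∧ L.pole c.next ∧ ¬ L.pos c.next).card = 1 by omega)
  simp only [Finset.ext_iff, Finset.mem_filter, Finset.mem_univ, true_and,
    Finset.mem_singleton] at hc
  exact ⟨c, (hc c).2 rfl, fun d hd => (hc d).1 hd⟩

end LadderStructure

/-! ## The ladder structure of a veering triangulation -/

namespace IdealTriangulation

theorem oppPair_ccw (v w : Fin 4) (h : w ≠ v) :
    oppPair w (ccw v w) = oppPair v (ccw v (ccw v w)) := by
  revert v w; decide

theorem oppPair_ccw_ccw (v w : Fin 4) (h : w ≠ v) :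
    oppPair w (ccw v (ccw v w)) = oppPair v (ccw v w) := by
  revert v w; decide

variable {T : Type*} [Fintype T] {τ : IdealTriangulation T} {α : T → Fin 3 → ℝ}

theorem angle_eq (hα : τ.IsTaut α) (c : Corner T) : c.angle α = 0 ∨ c.angle α = Real.pi :=
  hα.2 _ _

theorem angle_ne_pi {c : Corner T} (h : c.angle α = 0) : c.angle α ≠ Real.pi := by
  rw [h]; exact Real.pi_ne_zero.symm

theorem taut_angle_sum (hα : τ.IsTaut α) (c : Corner T) :
    c.angle α + c.next.angle α + c.prev.angle α = Real.pi := by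
  rw [Corner.angle_sum, hα.1.1]

theorem angle_next_of_wide (hα : τ.IsTaut α) {c : Corner T} (h : c.angle α = Real.pi) :
    c.next.angle α = 0 := by
  have h1 := taut_angle_sum hα c
  have := Real.pi_pos
  rcases angle_eq hα c.next with h2 | h2 <;> rcases angle_eq hα c.prev with h3 | h3 <;> linarith

theorem angle_prev_of_wide (hα : τ.IsTaut α) {c : Corner T} (h : c.angle α = Real.pi) :
    c.prev.angle α = 0 := by
  have h1 := taut_angle_sum hα c
  have := Real.pi_pos
  rcases angle_eq hα c.next with h2 | h2 <;> rcases angle_eq hα c.prev with h3 | h3 <;> linarith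

theorem exists_wide (hα : τ.IsTaut α) (c : Corner T) :
    c.angle α = Real.pi ∨ c.next.angle α = Real.pi ∨ c.prev.angle α = Real.pi := by
  have h1 := taut_angle_sum hα c
  have := Real.pi_pos
  rcases angle_eq hα c with h | h <;> rcases angle_eq hα c.next with h2 | h2 <;>
    rcases angle_eq hα c.prev with h3 | h3 <;> first | tauto | linarith

theorem leftVeering_congr {c d : Corner T} (h : τ.vertex c = τ.vertex d) :
    τ.LeftVeering α c ↔ τ.LeftVeering α d := by simp only [LeftVeering, h]

/-- The narrow corner `w.next` has the angle `π` immediately before it; if it were right-veering,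
the corner after it would be wide as well. Symmetrically, `w.prev` is not left-veering, so the base
of a triangle joins vertices that veer in opposite directions. -/
theorem leftVeering_next (hα : τ.IsVeering α) {w : Corner T} (h : w.angle α = Real.pi) :
    τ.LeftVeering α w.next := by
  refine (hα.2 w.next).resolve_right fun hr => ?_
  exact angle_ne_pi (angle_prev_of_wide hα.1 h) (hr _ rfl (angle_next_of_wide hα.1 h))

theorem not_leftVeering_prev (hα : τ.IsVeering α) {w : Corner T} (h : w.angle α = Real.pi) :
    ¬ τ.LeftVeering α w.prev := fun hl => by
  have := hl _ rfl (angle_prev_of_wide hα.1 h)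
  rw [Corner.prev_prev] at this
  exact angle_ne_pi (angle_next_of_wide hα.1 h) this

/-- A vertex that veers both ways has only wide corners. Then two consecutive triangles are both
wide there, and the other end of their common side follows one wide corner and precedes the other,
so it is left-veering and also not left-veering. -/
theorem rightVeering_iff (hα : τ.IsVeering α) (c : Corner T) :
    τ.RightVeering α c ↔ ¬ τ.LeftVeering α c := by
  refine ⟨fun hr hl => ?_, fun h => (hα.2 c).resolve_left h⟩
  have key : ∀ d, τ.vertex d = τ.vertex c → d.angle α = Real.pi := fun d hd => by
    refine (angle_eq hα.1 d).resolve_left fun h0 => ?_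
    have h1 := angle_prev_of_wide hα.1 (hl d hd h0)
    rw [Corner.prev_prev] at h1
    exact angle_ne_pi h1 (hr d hd h0)
  have h1 := key c rfl
  have h2 := key (τ.rot c) (τ.vertex_rot c)
  have h3 := leftVeering_next hα h2
  refine not_leftVeering_prev hα h1 ((leftVeering_congr ?_).1 h3)
  have h4 : (τ.rot c).next = (τ.across c.next).prev := by rw [rot_eq]; rfl
  rw [h4, vertex_across_prev]; rfl

theorem isPoleSegment_iff (hα : τ.IsVeering α) (s : Side T) :
    τ.IsPoleSegment α s ↔ (τ.LeftVeering α s.next ↔ τ.LeftVeering α s.prev) := by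
  rw [IsPoleSegment, rightVeering_iff hα, rightVeering_iff hα]; tauto

theorem not_isPoleSegment_of_wide (hα : τ.IsVeering α) {w : Corner T}
    (h : w.angle α = Real.pi) : ¬ τ.IsPoleSegment α w := by
  rw [isPoleSegment_iff hα]
  have := leftVeering_next hα h
  have := not_leftVeering_prev hα h
  tauto

/-- The side `w.prev` joins `w` to the left-veering vertex `w.next`, so only the veering of `w`
matters. Together with the mirror statement, each triangle has exactly one ladderpole segment, and
it ends at the wide corner. -/
theorem isPoleSegment_prev_iff (hα : τ.IsVeering α) {w : Corner T}
    (h : w.angle α = Real.pi) : τ.IsPoleSegment α w.prev ↔ τ.LeftVeering α w := by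
  rw [isPoleSegment_iff hα, Corner.prev_next, Corner.prev_prev]
  have := leftVeering_next hα h
  tauto

theorem isPoleSegment_next_iff (hα : τ.IsVeering α) {w : Corner T}
    (h : w.angle α = Real.pi) : τ.IsPoleSegment α w.next ↔ ¬ τ.LeftVeering α w := by
  rw [isPoleSegment_iff hα, Corner.next_prev, Corner.next_next]
  have := not_leftVeering_prev hα h
  tauto

theorem isPoleSegment_across (hα : τ.IsVeering α) (s : Side T) :
    τ.IsPoleSegment α (τ.across s) ↔ τ.IsPoleSegment α s := by
  rw [isPoleSegment_iff hα, isPoleSegment_iff hα,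
    leftVeering_congr (τ.vertex_across_next s), leftVeering_congr (τ.vertex_across_prev s)]
  tauto

/-- The wide corner of the triangle of a ladderpole segment. -/
theorem wide_of_isPoleSegment (hα : τ.IsVeering α) {s : Side T} (hs : τ.IsPoleSegment α s) :
    (s.next.angle α = Real.pi ∧ τ.LeftVeering α s.next) ∨
    (s.prev.angle α = Real.pi ∧ ¬ τ.LeftVeering α s.next) := by
  rcases exists_wide hα.1 s with h | h | h
  · exact (not_isPoleSegment_of_wide hα h hs).elim
  · have := isPoleSegment_prev_iff hα h
    rw [Corner.next_prev] at this
    exact Or.inl ⟨h, this.1 hs⟩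
  · have := isPoleSegment_next_iff hα h
    rw [Corner.prev_next] at this
    refine Or.inr ⟨h, ?_⟩
    rw [(isPoleSegment_iff hα s).1 hs]; exact this.1 hs

theorem wide_iff_of_leftVeering (hα : τ.IsVeering α) {d : Corner T} (hd : τ.LeftVeering α d) :
    d.angle α = Real.pi ↔ τ.IsPoleSegment α d.prev := by
  refine ⟨fun h => (isPoleSegment_prev_iff hα h).2 hd, fun h => ?_⟩
  rcases wide_of_isPoleSegment hα h with h' | h'
  · rw [Corner.prev_next] at h'; exact h'.1
  · rw [Corner.prev_next] at h'; exact (h'.2 hd).elim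

theorem wide_iff_of_not_leftVeering (hα : τ.IsVeering α) {d : Corner T}
    (hd : ¬ τ.LeftVeering α d) : d.angle α = Real.pi ↔ τ.IsPoleSegment α d.next := by
  refine ⟨fun h => (isPoleSegment_next_iff hα h).2 hd, fun h => ?_⟩
  rcases wide_of_isPoleSegment hα h with h' | h'
  · have := (isPoleSegment_iff hα _).1 h
    rw [Corner.next_prev] at this
    exact (hd (this.1 h'.2)).elim
  · rw [Corner.next_prev] at h'; exact h'.1

theorem card_wide (hα : τ.IsTaut α) (v : τ.Vertex) :
    (Finset.univ.filter fun c : Corner T => τ.vertex c = v ∧ c.angle α = Real.pi).card = 2 := by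
  have h := hα.1.2 v
  have h2 : ∀ c : Corner T, c.angle α = if c.angle α = Real.pi then Real.pi else 0 := fun c => by
    split_ifs with hc
    · exact hc
    · exact (angle_eq hα c).resolve_right hc
  rw [Finset.sum_congr rfl fun c _ => h2 c, ← Finset.sum_filter, Finset.sum_const,
    Finset.filter_filter, nsmul_eq_mul] at h
  exact_mod_cast mul_right_cancel₀ Real.pi_ne_zero h

/-- The total angle `2π` gives two wide corners at each vertex. Each is next to a ladderpole
segment, always on the side determined by the veering of the vertex; in the left-veering case the
count is shifted by one rotation. -/
theorem card_isPoleSegment (hα : τ.IsVeering α) (v : τ.Vertex) :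
    (Finset.univ.filter fun c : Corner T =>
      τ.vertex c = v ∧ τ.IsPoleSegment α c.next).card = 2 := by
  obtain ⟨c₀, hc₀⟩ := τ.vertex_surjective v
  rw [← card_wide hα.1 v]
  by_cases hl : τ.LeftVeering α c₀
  · have h := τ.sum_vertex_rot (fun c => if c.angle α = Real.pi then 1 else 0) v
    simp only [← Finset.card_filter, Finset.filter_filter] at h
    rw [← h]
    congr 1
    ext c
    simp only [Finset.mem_filter, Finset.mem_univ, true_and, and_congr_right_iff]
    intro hc
    have h1 : τ.LeftVeering α (τ.rot c) := by
      rwa [leftVeering_congr (τ.vertex_rot c), leftVeering_congr (hc.trans hc₀.symm)]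
    rw [wide_iff_of_leftVeering hα h1, rot_prev, isPoleSegment_across hα]
  · congr 1
    ext c
    simp only [Finset.mem_filter, Finset.mem_univ, true_and, and_congr_right_iff]
    intro hc
    have h1 : ¬ τ.LeftVeering α c := by
      rwa [leftVeering_congr (hc.trans hc₀.symm)]
    rw [wide_iff_of_not_leftVeering hα h1]

variable {out : T → Fin 4 → Bool}

/-- The edge associated with the faces `w.idx` and `w.next.idx` has the angle of the narrow corner
`w.prev`, so the transverse orientation goes in through one of these faces and out through the
other. -/
theorem out_next_of_wide (hα : τ.IsTaut α) (hout : τ.IsTransverseTaut α out) {w : Corner T}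
    (h : w.angle α = Real.pi) : out w.tet w.next.idx = !out w.tet w.idx := by
  have h1 := hout.2 w.tet w.idx w.next.idx (ccw_ne_self _ _ w.ne).symm
  rw [Corner.next_idx, oppPair_ccw _ _ w.ne] at h1
  have h2 := angle_ne_pi (angle_prev_of_wide hα h)
  have h3 : out w.tet w.idx ≠ out w.tet (ccw w.tip w.idx) := fun h4 => h2 (h1.1 h4)
  rw [Corner.next_idx]
  revert h3
  cases out w.tet w.idx <;> cases out w.tet (ccw w.tip w.idx) <;> simp

theorem out_prev_of_wide (hα : τ.IsTaut α) (hout : τ.IsTransverseTaut α out) {w : Corner T}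
    (h : w.angle α = Real.pi) : out w.tet w.prev.idx = !out w.tet w.idx := by
  have h1 := hout.2 w.tet w.idx w.prev.idx
    (fun h => w.prev_ne (Corner.ext rfl rfl h.symm))
  rw [Corner.prev_idx, oppPair_ccw_ccw _ _ w.ne] at h1
  have h2 := angle_ne_pi (angle_next_of_wide hα h)
  have h3 : out w.tet w.idx ≠ out w.tet (ccw w.tip (ccw w.tip w.idx)) := fun h4 => h2 (h1.1 h4)
  rw [Corner.prev_idx]
  revert h3
  cases out w.tet w.idx <;> cases out w.tet (ccw w.tip (ccw w.tip w.idx)) <;> simp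

theorem out_across (hout : τ.IsTransverseTaut α out) (s : Side T) :
    out (τ.across s).tet (τ.across s).idx = !out s.tet s.idx := hout.1 _ _

theorem isUpward_iff_of_left (hα : τ.IsVeering α) {s : Side T} (hs : τ.IsPoleSegment α s)
    (hw : s.next.angle α = Real.pi) :
    τ.IsUpward α out s ↔ out s.tet s.next.idx = true := by
  have h0 : s.prev.angle α ≠ Real.pi := angle_ne_pi (angle_next_of_wide hα.1 hw)
  simp [IsUpward, hs, hw, h0]

theorem isUpward_iff_of_right (hα : τ.IsVeering α) {s : Side T} (hs : τ.IsPoleSegment α s)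
    (hw : s.prev.angle α = Real.pi) :
    τ.IsUpward α out s ↔ out s.tet s.prev.idx = false := by
  have h0 : s.next.angle α ≠ Real.pi := by
    rw [← Corner.prev_prev]; exact angle_ne_pi (angle_prev_of_wide hα.1 hw)
  simp [IsUpward, hs, hw, h0]

/-- A description that does not mention the wide corner and involves only data shared by both
triangles at the segment. It makes the effect of `across` visible: the veering is the same and `out`
is negated. -/
theorem isUpward_iff (hα : τ.IsVeering α) (hout : τ.IsTransverseTaut α out) {s : Side T}
    (hs : τ.IsPoleSegment α s) :
    τ.IsUpward α out s ↔ (τ.LeftVeering α s.next ↔ out s.tet s.idx = false) := by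
  rcases wide_of_isPoleSegment hα hs with ⟨hw, hl⟩ | ⟨hw, hl⟩
  · have h := out_prev_of_wide hα.1 hout hw
    rw [Corner.next_prev, Corner.next_tet] at h
    rw [isUpward_iff_of_left hα hs hw, h]; simp [hl]
  · have h := out_next_of_wide hα.1 hout hw
    rw [Corner.prev_next, Corner.prev_tet] at h
    rw [isUpward_iff_of_right hα hs hw, h]; simp [hl]

/-- The decomposition into ladders of the boundary of a veering triangulation. -/
def ladderStructure (hα : τ.IsVeering α) (hout : τ.IsTransverseTaut α out) :
    LadderStructure τ where
  pole := τ.IsPoleSegment α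
  pos s := if τ.IsPoleSegment α s then τ.IsUpward α out s else out s.tet s.idx = true
  pole_across := isPoleSegment_across hα
  pos_across s := by
    by_cases hs : τ.IsPoleSegment α s
    · have hs' := (isPoleSegment_across hα s).2 hs
      have h1 := (isPoleSegment_iff hα s).1 hs
      rw [if_pos hs, if_pos hs', isUpward_iff hα hout hs, isUpward_iff hα hout hs',
        out_across hout, leftVeering_congr (τ.vertex_across_next s), ← h1]
      cases out s.tet s.idx <;> simp
    · rw [if_neg hs, if_neg (fun h => hs ((isPoleSegment_across hα s).1 h)), out_across hout]
      simp
  exists_pole s := by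
    obtain ⟨w, hw, hws⟩ : ∃ w : Corner T, w.angle α = Real.pi ∧ (w = s ∨ w = s.next ∨ w = s.prev) := by
      rcases exists_wide hα.1 s with h | h | h
      exacts [⟨_, h, Or.inl rfl⟩, ⟨_, h, Or.inr (Or.inl rfl)⟩, ⟨_, h, Or.inr (Or.inr rfl)⟩]
    have h : τ.IsPoleSegment α w.prev ∨ τ.IsPoleSegment α w.next := by
      rw [isPoleSegment_prev_iff hα hw, isPoleSegment_next_iff hα hw]; exact em _
    rcases hws with rfl | rfl | rfl
    · tauto
    · rw [Corner.next_prev, Corner.next_next] at h; tauto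
    · rw [Corner.prev_next, Corner.prev_prev] at h; tauto
  pole_next s hs hn := by
    rcases wide_of_isPoleSegment hα hs with ⟨hw, hl⟩ | ⟨hw, hl⟩
    · exact not_isPoleSegment_of_wide hα hw hn
    · rcases wide_of_isPoleSegment hα hn with ⟨hw', hl'⟩ | ⟨hw', hl'⟩
      · exact hl (((isPoleSegment_iff hα s).1 hs).2 hl')
      · rw [Corner.next_prev] at hw'
        exact angle_ne_pi (by have := angle_next_of_wide hα.1 hw; rwa [Corner.prev_next] at this) hw'
  pole_prev s hs hn := by
    rcases wide_of_isPoleSegment hα hs with ⟨hw, hl⟩ | ⟨hw, hl⟩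
    · rcases wide_of_isPoleSegment hα hn with ⟨hw', hl'⟩ | ⟨hw', hl'⟩
      · rw [Corner.prev_next] at hw'
        exact angle_ne_pi (by have := angle_prev_of_wide hα.1 hw; rwa [Corner.next_prev] at this) hw'
      · have h := (isPoleSegment_iff hα _).1 hn
        rw [Corner.prev_prev] at h
        exact hl' (h.2 hl)
    · exact not_isPoleSegment_of_wide hα hw hn
  pos_next s hs := by
    rw [if_pos hs]
    rcases wide_of_isPoleSegment hα hs with ⟨hw, hl⟩ | ⟨hw, hl⟩
    · rw [if_neg (not_isPoleSegment_of_wide hα hw), isUpward_iff_of_left hα hs hw]; rfl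
    · have h1 : ¬ τ.IsPoleSegment α s.next := by
        rw [← Corner.prev_prev, isPoleSegment_prev_iff hα hw]
        rwa [← (isPoleSegment_iff hα s).1 hs]
      have h := out_prev_of_wide hα.1 hout hw
      rw [Corner.prev_prev] at h
      rw [if_neg h1, isUpward_iff_of_right hα hs hw]
      show out s.prev.tet s.next.idx = true ↔ _
      rw [h]; simp
  pos_prev s hs := by
    rw [if_pos hs]
    rcases wide_of_isPoleSegment hα hs with ⟨hw, hl⟩ | ⟨hw, hl⟩
    · have h1 : ¬ τ.IsPoleSegment α s.prev := by
        rw [← Corner.next_next, isPoleSegment_next_iff hα hw]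
        simpa using hl
      have h := out_next_of_wide hα.1 hout hw
      rw [if_neg h1, isUpward_iff_of_left hα hs hw]
      show out s.next.tet s.next.next.idx = true ↔ _
      rw [h]; simp
    · rw [if_neg (not_isPoleSegment_of_wide hα hw), isUpward_iff_of_right hα hs hw]
      simp
  card_pole := card_isPoleSegment hα

end IdealTriangulation
end

noncomputable section
open scoped Classical

/-! ## Ladders, ladderpoles and their successors -/

namespace LadderStructure

variable {T : Type*} [Fintype T] {τ : IdealTriangulation T} (L : LadderStructure τ)

theorem exists_poleSide (A : T × Fin 4) : ∃ s : Side T, s.tri = A ∧ L.pole s := by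
  obtain ⟨c, rfl⟩ := Corner.exists_tri_eq A
  rcases L.exists_pole c with h | h | h
  exacts [⟨c, rfl, h⟩, ⟨c.next, rfl, h⟩, ⟨c.prev, rfl, h⟩]

/-- The side of a triangle that is a ladderpole segment. -/
def poleSide (A : T × Fin 4) : Side T := (L.exists_poleSide A).choose

@[simp] theorem poleSide_tri (A : T × Fin 4) : (L.poleSide A).tri = A :=
  (L.exists_poleSide A).choose_spec.1

theorem pole_poleSide (A : T × Fin 4) : L.pole (L.poleSide A) :=
  (L.exists_poleSide A).choose_spec.2

theorem eq_poleSide {s : Side T} (hs : L.pole s) : L.poleSide s.tri = s := by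
  rcases Corner.eq_of_tri_eq (L.poleSide_tri s.tri) with h | h | h
  · exact h
  · exact (L.pole_next s hs (h ▸ L.pole_poleSide s.tri)).elim
  · exact (L.pole_prev s hs (h ▸ L.pole_poleSide s.tri)).elim

/-- The triangle has its ladderpole segment on its right. -/
def isRight (A : T × Fin 4) : Prop := L.pos (L.poleSide A)

def topRung (A : T × Fin 4) : Side T :=
  if L.isRight A then (L.poleSide A).next else (L.poleSide A).prev

def botRung (A : T × Fin 4) : Side T :=
  if L.isRight A then (L.poleSide A).prev else (L.poleSide A).next

theorem topRung_right {A : T × Fin 4} (h : L.isRight A) : L.topRung A = (L.poleSide A).next :=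
  if_pos h
theorem topRung_left {A : T × Fin 4} (h : ¬ L.isRight A) : L.topRung A = (L.poleSide A).prev :=
  if_neg h
theorem botRung_right {A : T × Fin 4} (h : L.isRight A) : L.botRung A = (L.poleSide A).prev :=
  if_pos h
theorem botRung_left {A : T × Fin 4} (h : ¬ L.isRight A) : L.botRung A = (L.poleSide A).next :=
  if_neg h

@[simp] theorem topRung_tri (A : T × Fin 4) : (L.topRung A).tri = A := by
  rw [topRung]; split_ifs <;> simp

@[simp] theorem botRung_tri (A : T × Fin 4) : (L.botRung A).tri = A := by
  rw [botRung]; split_ifs <;> simp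

theorem not_pole_topRung (A : T × Fin 4) : ¬ L.pole (L.topRung A) := by
  rw [topRung]; split_ifs
  · exact L.pole_next _ (L.pole_poleSide A)
  · exact L.pole_prev _ (L.pole_poleSide A)

theorem not_pole_botRung (A : T × Fin 4) : ¬ L.pole (L.botRung A) := by
  rw [botRung]; split_ifs
  · exact L.pole_prev _ (L.pole_poleSide A)
  · exact L.pole_next _ (L.pole_poleSide A)

theorem pos_topRung (A : T × Fin 4) : L.pos (L.topRung A) := by
  rw [topRung]; split_ifs with h
  · rw [L.pos_next _ (L.pole_poleSide A)]; exact h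
  · rw [L.pos_prev _ (L.pole_poleSide A)]; exact h

theorem not_pos_botRung (A : T × Fin 4) : ¬ L.pos (L.botRung A) := by
  rw [botRung]; split_ifs with h
  · rw [L.pos_prev _ (L.pole_poleSide A), not_not]; exact h
  · rw [L.pos_next _ (L.pole_poleSide A)]; exact h

theorem eq_topRung_or_botRung {s : Side T} (hs : ¬ L.pole s) :
    s = L.topRung s.tri ∨ s = L.botRung s.tri := by
  rcases Corner.eq_of_tri_eq (L.poleSide_tri s.tri).symm with h | h | h
  · exact (hs (h ▸ L.pole_poleSide s.tri)).elim
  · by_cases hr : L.isRight s.tri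
    · exact Or.inl (h.trans (L.topRung_right hr).symm)
    · exact Or.inr (h.trans (L.botRung_left hr).symm)
  · by_cases hr : L.isRight s.tri
    · exact Or.inr (h.trans (L.botRung_right hr).symm)
    · exact Or.inl (h.trans (L.topRung_left hr).symm)

theorem eq_topRung {s : Side T} (hs : ¬ L.pole s) (hp : L.pos s) : L.topRung s.tri = s :=
  ((L.eq_topRung_or_botRung hs).resolve_right fun h => L.not_pos_botRung _ (h ▸ hp)).symm

theorem eq_botRung {s : Side T} (hs : ¬ L.pole s) (hp : ¬ L.pos s) : L.botRung s.tri = s :=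
  ((L.eq_topRung_or_botRung hs).resolve_left fun h => hp (h ▸ L.pos_topRung _)).symm

/-- The corners of a triangle at the ends of its bottom and top rungs. When its ladderpole segment
is on the right, the left corners coincide, and conversely. -/
def leftBot (A : T × Fin 4) : Corner T := (L.botRung A).next
def rightBot (A : T × Fin 4) : Corner T := (L.botRung A).prev
def rightTop (A : T × Fin 4) : Corner T := (L.topRung A).next
def leftTop (A : T × Fin 4) : Corner T := (L.topRung A).prev

theorem leftBot_right {A : T × Fin 4} (h : L.isRight A) : L.leftBot A = L.poleSide A := by
  rw [leftBot, L.botRung_right h, Corner.prev_next]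
theorem leftTop_right {A : T × Fin 4} (h : L.isRight A) : L.leftTop A = L.poleSide A := by
  rw [leftTop, L.topRung_right h, Corner.next_prev]
theorem rightBot_right {A : T × Fin 4} (h : L.isRight A) :
    L.rightBot A = (L.poleSide A).next := by
  rw [rightBot, L.botRung_right h, Corner.prev_prev]
theorem rightTop_right {A : T × Fin 4} (h : L.isRight A) :
    L.rightTop A = (L.poleSide A).prev := by
  rw [rightTop, L.topRung_right h, Corner.next_next]
theorem leftBot_left {A : T × Fin 4} (h : ¬ L.isRight A) :
    L.leftBot A = (L.poleSide A).prev := by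
  rw [leftBot, L.botRung_left h, Corner.next_next]
theorem leftTop_left {A : T × Fin 4} (h : ¬ L.isRight A) :
    L.leftTop A = (L.poleSide A).next := by
  rw [leftTop, L.topRung_left h, Corner.prev_prev]
theorem rightBot_left {A : T × Fin 4} (h : ¬ L.isRight A) : L.rightBot A = L.poleSide A := by
  rw [rightBot, L.botRung_left h, Corner.next_prev]
theorem rightTop_left {A : T × Fin 4} (h : ¬ L.isRight A) : L.rightTop A = L.poleSide A := by
  rw [rightTop, L.topRung_left h, Corner.prev_next]

@[simp] theorem leftBot_tri (A : T × Fin 4) : (L.leftBot A).tri = A := L.botRung_tri A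
@[simp] theorem rightBot_tri (A : T × Fin 4) : (L.rightBot A).tri = A := L.botRung_tri A
@[simp] theorem leftTop_tri (A : T × Fin 4) : (L.leftTop A).tri = A := L.topRung_tri A
@[simp] theorem rightTop_tri (A : T × Fin 4) : (L.rightTop A).tri = A := L.topRung_tri A

theorem across_topRung (A : T × Fin 4) :
    τ.across (L.topRung A) = L.botRung (τ.across (L.topRung A)).tri :=
  (L.eq_botRung (by rw [L.pole_across]; exact L.not_pole_topRung A)
    (by rw [L.pos_across, not_not]; exact L.pos_topRung A)).symm

theorem across_botRung (A : T × Fin 4) :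
    τ.across (L.botRung A) = L.topRung (τ.across (L.botRung A)).tri :=
  (L.eq_topRung (by rw [L.pole_across]; exact L.not_pole_botRung A)
    (by rw [L.pos_across]; exact L.not_pos_botRung A)).symm

/-- The next triangle upward in the same ladder. -/
def up : Equiv.Perm (T × Fin 4) where
  toFun A := (τ.across (L.topRung A)).tri
  invFun A := (τ.across (L.botRung A)).tri
  left_inv A := by
    show (τ.across (L.botRung (τ.across (L.topRung A)).tri)).tri = A
    rw [← across_topRung, τ.across_across, topRung_tri]
  right_inv A := by
    show (τ.across (L.topRung (τ.across (L.botRung A)).tri)).tri = A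
    rw [← across_botRung, τ.across_across, botRung_tri]

theorem across_topRung_eq (A : T × Fin 4) : τ.across (L.topRung A) = L.botRung (L.up A) :=
  L.across_topRung A

theorem across_botRung_eq (A : T × Fin 4) :
    τ.across (L.botRung A) = L.topRung (L.up.symm A) := L.across_botRung A

theorem vertex_leftBot_up (A : T × Fin 4) :
    τ.vertex (L.leftBot (L.up A)) = τ.vertex (L.leftTop A) := by
  rw [leftBot, ← across_topRung_eq, τ.vertex_across_next]; rfl

theorem vertex_rightBot_up (A : T × Fin 4) :
    τ.vertex (L.rightBot (L.up A)) = τ.vertex (L.rightTop A) := by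
  rw [rightBot, ← across_topRung_eq, τ.vertex_across_prev]; rfl

/-! ### Successors along the ladderpoles -/

theorem exists_startSeg (v : τ.Vertex) :
    ∃ s : Side T, L.pole s ∧ L.pos s ∧ τ.vertex s.next = v := by
  obtain ⟨c, ⟨h1, h2, h3⟩, _⟩ := L.existsUnique_down v
  exact ⟨τ.across c.next, (L.pole_across _).2 h2, (L.pos_across _).2 h3, by
    rw [τ.vertex_across_next, Corner.next_prev, h1]⟩

theorem exists_endSeg (v : τ.Vertex) :
    ∃ s : Side T, L.pole s ∧ L.pos s ∧ τ.vertex s.prev = v := by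
  obtain ⟨c, ⟨h1, h2, h3⟩, _⟩ := L.existsUnique_up v
  exact ⟨c.next, h2, h3, by rw [Corner.next_prev, h1]⟩

/-- The upward ladderpole segment starting at a vertex. -/
def startSeg (v : τ.Vertex) : Side T := (L.exists_startSeg v).choose

/-- The upward ladderpole segment ending at a vertex. -/
def endSeg (v : τ.Vertex) : Side T := (L.exists_endSeg v).choose

theorem pole_startSeg (v : τ.Vertex) : L.pole (L.startSeg v) :=
  (L.exists_startSeg v).choose_spec.1
theorem pos_startSeg (v : τ.Vertex) : L.pos (L.startSeg v) :=
  (L.exists_startSeg v).choose_spec.2.1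
@[simp] theorem vertex_startSeg (v : τ.Vertex) : τ.vertex (L.startSeg v).next = v :=
  (L.exists_startSeg v).choose_spec.2.2
theorem pole_endSeg (v : τ.Vertex) : L.pole (L.endSeg v) :=
  (L.exists_endSeg v).choose_spec.1
theorem pos_endSeg (v : τ.Vertex) : L.pos (L.endSeg v) :=
  (L.exists_endSeg v).choose_spec.2.1
@[simp] theorem vertex_endSeg (v : τ.Vertex) : τ.vertex (L.endSeg v).prev = v :=
  (L.exists_endSeg v).choose_spec.2.2

theorem eq_startSeg {s : Side T} (h1 : L.pole s) (h2 : L.pos s) :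
    L.startSeg (τ.vertex s.next) = s := by
  -- Seen from the triangle on its right, an upward segment starting at the vertex is the side after
  -- the corner `(across u).prev`. Only one corner of the vertex has this property.
  have key : ∀ u : Side T, L.pole u → L.pos u → τ.vertex u.next = τ.vertex s.next →
      (τ.across u).prev = (L.existsUnique_down (τ.vertex s.next)).choose := fun u a b c =>
    (L.existsUnique_down (τ.vertex s.next)).choose_spec.2 _ ⟨by rw [τ.vertex_across_prev, c],
      by rw [Corner.prev_next, L.pole_across]; exact a,
      by rw [Corner.prev_next, L.pos_across, not_not]; exact b⟩
  exact τ.across_injective (Corner.prev_injective ((key _ (L.pole_startSeg _) (L.pos_startSeg _)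
    (L.vertex_startSeg _)).trans (key s h1 h2 rfl).symm))

theorem eq_endSeg {s : Side T} (h1 : L.pole s) (h2 : L.pos s) :
    L.endSeg (τ.vertex s.prev) = s := by
  have key : ∀ u : Side T, L.pole u → L.pos u → τ.vertex u.prev = τ.vertex s.prev →
      u.prev = (L.existsUnique_up (τ.vertex s.prev)).choose := fun u a b c =>
    (L.existsUnique_up (τ.vertex s.prev)).choose_spec.2 _ ⟨c,
      by rw [Corner.prev_next]; exact a, by rw [Corner.prev_next]; exact b⟩
  exact Corner.prev_injective ((key _ (L.pole_endSeg _) (L.pos_endSeg _)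
    (L.vertex_endSeg _)).trans (key s h1 h2 rfl).symm)

/-- The next vertex upward along the same ladderpole. -/
def succ : Equiv.Perm τ.Vertex where
  toFun v := τ.vertex (L.startSeg v).prev
  invFun v := τ.vertex (L.endSeg v).next
  left_inv v := by
    show τ.vertex (L.endSeg (τ.vertex (L.startSeg v).prev)).next = v
    rw [L.eq_endSeg (L.pole_startSeg v) (L.pos_startSeg v), vertex_startSeg]
  right_inv v := by
    show τ.vertex (L.startSeg (τ.vertex (L.endSeg v).next)).prev = v
    rw [L.eq_startSeg (L.pole_endSeg v) (L.pos_endSeg v), vertex_endSeg]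

theorem succ_vertex {s : Side T} (h1 : L.pole s) (h2 : L.pos s) :
    L.succ (τ.vertex s.next) = τ.vertex s.prev := by
  show τ.vertex (L.startSeg (τ.vertex s.next)).prev = _
  rw [L.eq_startSeg h1 h2]

theorem succ_vertex_down {s : Side T} (h1 : L.pole s) (h2 : ¬ L.pos s) :
    L.succ (τ.vertex s.prev) = τ.vertex s.next := by
  rw [← τ.vertex_across_next s, ← τ.vertex_across_prev s]
  exact L.succ_vertex ((L.pole_across s).2 h1) ((L.pos_across s).2 h2)

/-- Passing upward through a triangle moves exactly one end of the rung, the one on the side of the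
ladderpole segment, to the next vertex of its ladderpole. The other end stays fixed. -/
theorem succ_leftBot {A : T × Fin 4} (h : ¬ L.isRight A) :
    L.succ (τ.vertex (L.leftBot A)) = τ.vertex (L.leftTop A) := by
  rw [L.leftBot_left h, L.leftTop_left h, L.succ_vertex_down (L.pole_poleSide A) h]

theorem succ_rightBot {A : T × Fin 4} (h : L.isRight A) :
    L.succ (τ.vertex (L.rightBot A)) = τ.vertex (L.rightTop A) := by
  rw [L.rightBot_right h, L.rightTop_right h, L.succ_vertex (L.pole_poleSide A) h]

/-! ### Ladders and ladderpoles -/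

/-- The ladders, as classes of triangles. -/
def Ladder : Type _ :=
  Quot (fun A B : T × Fin 4 => ∃ s : Side T, ¬ L.pole s ∧ s.tri = A ∧ (τ.across s).tri = B)

def ladder (A : T × Fin 4) : L.Ladder := Quot.mk _ A

/-- The ladderpoles, as classes of corners. -/
def Ladderpole : Type _ :=
  Quot (fun c d : Corner T => d = τ.rot c ∨ ∃ s : Side T, L.pole s ∧ s.next = c ∧ s.prev = d)

def ladderpole (c : Corner T) : L.Ladderpole := Quot.mk _ c

instance : Finite L.Ladder := Quot.finite _
instance : Finite L.Ladderpole := Quot.finite _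
instance : Finite τ.Vertex := Quot.finite _

instance : Fintype L.Ladder := Fintype.ofFinite _
instance : Fintype L.Ladderpole := Fintype.ofFinite _
instance : Fintype τ.Vertex := Fintype.ofFinite _

theorem ladder_across {s : Side T} (hs : ¬ L.pole s) :
    L.ladder (τ.across s).tri = L.ladder s.tri :=
  (Quot.sound ⟨s, hs, rfl, rfl⟩ : L.ladder s.tri = _).symm

theorem ladder_up (A : T × Fin 4) : L.ladder (L.up A) = L.ladder A := by
  have := L.ladder_across (L.not_pole_topRung A)
  rwa [topRung_tri] at this

theorem ladderpole_pole {s : Side T} (hs : L.pole s) :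
    L.ladderpole s.next = L.ladderpole s.prev := Quot.sound (Or.inr ⟨s, hs, rfl, rfl⟩)

theorem ladderpole_rot (c : Corner T) : L.ladderpole (τ.rot c) = L.ladderpole c :=
  (Quot.sound (Or.inl rfl) : L.ladderpole c = _).symm

/-- The ladderpole through a vertex. -/
def vertexPole (v : τ.Vertex) : L.Ladderpole :=
  Quot.lift L.ladderpole (fun c d h => by rw [h, ladderpole_rot]) v

theorem vertexPole_vertex (c : Corner T) : L.vertexPole (τ.vertex c) = L.ladderpole c := rfl

theorem vertexPole_succ (v : τ.Vertex) : L.vertexPole (L.succ v) = L.vertexPole v := by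
  conv_rhs => rw [← L.vertex_startSeg v]
  show L.vertexPole (τ.vertex _) = _
  rw [vertexPole_vertex, vertexPole_vertex, L.ladderpole_pole (L.pole_startSeg v)]

/-- Crossing a rung is one application of `up` or of its inverse. Ladders are therefore the cycles
of a permutation, to which `exists_coboundary` can be applied. -/
theorem sameCycle_up_of_ladder_eq {A B : T × Fin 4} (h : L.ladder A = L.ladder B) :
    L.up.SameCycle A B := by
  have h' := Quot.eqvGen_exact h
  induction h' with
  | rel x y hxy =>
    obtain ⟨s, hs, rfl, rfl⟩ := hxy
    by_cases hp : L.pos s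
    · refine ⟨1, ?_⟩
      rw [zpow_one]
      show (τ.across (L.topRung s.tri)).tri = _
      rw [L.eq_topRung hs hp]
    · refine ⟨-1, ?_⟩
      rw [zpow_neg_one]
      show (τ.across (L.botRung s.tri)).tri = _
      rw [L.eq_botRung hs hp]
  | refl x => exact Equiv.Perm.SameCycle.refl _ _
  | symm x y _ ih => exact (ih (Quot.eqvGen_sound ‹_›)).symm
  | trans x y z h1 h2 ih1 ih2 =>
    exact (ih1 (Quot.eqvGen_sound h1)).trans (ih2 (Quot.eqvGen_sound h2))

theorem eq_of_sameCycle {X Q : Type*} (S : Equiv.Perm X) (f : X → Q) (hf : ∀ x, f (S x) = f x)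
    {x y : X} (h : S.SameCycle x y) : f x = f y := by
  obtain ⟨k, rfl⟩ := h
  have : ∀ k : ℤ, f ((S ^ k) x) = f x := fun k => by
    induction k with
    | zero => simp
    | succ i ih => rw [add_comm, zpow_add, Equiv.Perm.mul_apply, zpow_one, hf, ih]
    | pred i ih =>
      rw [← ih, ← hf ((S ^ (-(i : ℤ) - 1)) x), ← Equiv.Perm.mul_apply, ← zpow_one_add]
      congr 3; ring
  exact (this k).symm

theorem ladder_eq_iff {A B : T × Fin 4} : L.ladder A = L.ladder B ↔ L.up.SameCycle A B :=
  ⟨L.sameCycle_up_of_ladder_eq, eq_of_sameCycle _ _ L.ladder_up⟩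

theorem sameCycle_succ_of_ladderpole_eq {c d : Corner T} (h : L.ladderpole c = L.ladderpole d) :
    L.succ.SameCycle (τ.vertex c) (τ.vertex d) := by
  have h' := Quot.eqvGen_exact h
  induction h' with
  | rel x y hxy =>
    rcases hxy with rfl | ⟨s, hs, rfl, rfl⟩
    · rw [τ.vertex_rot]
    · by_cases hp : L.pos s
      · exact ⟨1, L.succ_vertex hs hp⟩
      · exact Equiv.Perm.SameCycle.symm ⟨1, L.succ_vertex_down hs hp⟩
  | refl x => exact Equiv.Perm.SameCycle.refl _ _
  | symm x y _ ih => exact (ih (Quot.eqvGen_sound ‹_›)).symm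
  | trans x y z h1 h2 ih1 ih2 =>
    exact (ih1 (Quot.eqvGen_sound h1)).trans (ih2 (Quot.eqvGen_sound h2))

theorem vertexPole_eq_iff {v w : τ.Vertex} :
    L.vertexPole v = L.vertexPole w ↔ L.succ.SameCycle v w := by
  refine ⟨fun h => ?_, eq_of_sameCycle _ _ L.vertexPole_succ⟩
  obtain ⟨c, rfl⟩ := τ.vertex_surjective v
  obtain ⟨d, rfl⟩ := τ.vertex_surjective w
  exact L.sameCycle_succ_of_ladderpole_eq h

/-- The ladder on the right of a vertex. -/
def rightLadder (v : τ.Vertex) : L.Ladder := L.ladder (τ.across (L.startSeg v)).tri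

/-- The ladder on the left of a vertex. -/
def leftLadder (v : τ.Vertex) : L.Ladder := L.ladder (L.endSeg v).tri

/-- Rotate counterclockwise from `c`. As long as the corners stay on the right of the ladderpole,
only rungs are crossed and the ladder does not change. The side of the ladderpole must change
eventually, because the vertex has corners on the left too. The first change happens through the
upward segment starting at the vertex. -/
theorem ladder_of_leftCorner {c : Corner T} (h : L.leftCorner c) :
    L.ladder c.tri = L.rightLadder (τ.vertex c) := by
  obtain ⟨d, hd, hd'⟩ : ∃ d, τ.vertex c = τ.vertex d ∧ ¬ L.leftCorner d := by
    obtain ⟨d, ⟨h1, h2, h3⟩, _⟩ := L.existsUnique_up (τ.vertex c)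
    exact ⟨d, h1.symm, by rw [L.leftCorner_of_pole h2]; simpa using h3⟩
  obtain ⟨k, rfl⟩ := τ.exists_rot_iterate hd
  clear hd
  induction k generalizing c with
  | zero => exact (hd' h).elim
  | succ k ih =>
    by_cases hr : L.leftCorner (τ.rot c)
    · have h1 := ih hr hd'
      rw [τ.vertex_rot] at h1
      rw [← h1]
      have h2 : ¬ L.pole c.next := fun hp =>
        (L.leftCorner_of_pole hp).1 h ((L.leftCorner_rot c).1 hr)
      exact (L.ladder_across h2).symm
    · rw [L.leftCorner_rot] at hr
      have hp : L.pole c.next := by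
        by_contra hp; exact hr ((L.leftCorner_of_rung hp).1 h)
      have h1 := L.eq_startSeg ((L.pole_across c.next).2 hp) ((L.pos_across c.next).2 hr)
      rw [τ.vertex_across_next, Corner.next_prev] at h1
      rw [rightLadder, h1, τ.across_across]; rfl

theorem ladder_of_not_leftCorner {c : Corner T} (h : ¬ L.leftCorner c) :
    L.ladder c.tri = L.leftLadder (τ.vertex c) := by
  obtain ⟨d, hd, hd'⟩ : ∃ d, τ.vertex c = τ.vertex d ∧ L.leftCorner d := by
    obtain ⟨d, ⟨h1, h2, h3⟩, _⟩ := L.existsUnique_down (τ.vertex c)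
    exact ⟨d, h1.symm, by rw [L.leftCorner_of_pole h2]; exact h3⟩
  obtain ⟨k, rfl⟩ := τ.exists_rot_iterate hd
  clear hd
  induction k generalizing c with
  | zero => exact (h hd').elim
  | succ k ih =>
    by_cases hr : L.leftCorner (τ.rot c)
    · rw [L.leftCorner_rot] at hr
      have hp : L.pole c.next := by
        by_contra hp; exact h ((L.leftCorner_of_rung hp).2 hr)
      have h1 := L.eq_endSeg hp hr
      rw [Corner.next_prev] at h1
      rw [leftLadder, h1]; rfl
    · have h1 := ih hr hd'
      rw [τ.vertex_rot] at h1
      rw [← h1]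
      have h2 : ¬ L.pole c.next := fun hp => by
        rw [L.leftCorner_of_pole hp] at h
        rw [L.leftCorner_rot] at hr
        exact h hr
      exact (L.ladder_across h2).symm

theorem leftCorner_leftBot (A : T × Fin 4) : L.leftCorner (L.leftBot A) := by
  by_cases h : L.isRight A
  · have h1 := L.topRung_right h
    rw [L.leftBot_right h, L.leftCorner_of_rung (by rw [← h1]; exact L.not_pole_topRung A), ← h1]
    exact L.pos_topRung A
  · rw [L.leftBot_left h, L.leftCorner_of_pole (by rw [Corner.prev_next]; exact L.pole_poleSide A),
      Corner.prev_next]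
    exact h

theorem leftCorner_leftTop (A : T × Fin 4) : L.leftCorner (L.leftTop A) := by
  have h : (L.leftTop A).next = L.topRung A := by rw [leftTop, Corner.prev_next]
  rw [L.leftCorner_of_rung (by rw [h]; exact L.not_pole_topRung A), h]
  exact L.pos_topRung A

theorem not_leftCorner_rightBot (A : T × Fin 4) : ¬ L.leftCorner (L.rightBot A) := by
  have h : (L.rightBot A).next = L.botRung A := by rw [rightBot, Corner.prev_next]
  rw [L.leftCorner_of_rung (by rw [h]; exact L.not_pole_botRung A), h]
  exact L.not_pos_botRung A

theorem not_leftCorner_rightTop (A : T × Fin 4) : ¬ L.leftCorner (L.rightTop A) := by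
  by_cases h : L.isRight A
  · rw [L.rightTop_right h, L.leftCorner_of_pole (by rw [Corner.prev_next]; exact L.pole_poleSide A),
      Corner.prev_next, not_not]
    exact h
  · have h1 := L.botRung_left h
    rw [L.rightTop_left h, L.leftCorner_of_rung (by rw [← h1]; exact L.not_pole_botRung A), ← h1]
    exact L.not_pos_botRung A

theorem rightLadder_leftBot (A : T × Fin 4) :
    L.rightLadder (τ.vertex (L.leftBot A)) = L.ladder A := by
  rw [← L.ladder_of_leftCorner (L.leftCorner_leftBot A), leftBot_tri]

theorem rightLadder_leftTop (A : T × Fin 4) :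
    L.rightLadder (τ.vertex (L.leftTop A)) = L.ladder A := by
  rw [← L.ladder_of_leftCorner (L.leftCorner_leftTop A), leftTop_tri]

theorem leftLadder_rightBot (A : T × Fin 4) :
    L.leftLadder (τ.vertex (L.rightBot A)) = L.ladder A := by
  rw [← L.ladder_of_not_leftCorner (L.not_leftCorner_rightBot A), rightBot_tri]

theorem leftLadder_rightTop (A : T × Fin 4) :
    L.leftLadder (τ.vertex (L.rightTop A)) = L.ladder A := by
  rw [← L.ladder_of_not_leftCorner (L.not_leftCorner_rightTop A), rightTop_tri]

theorem not_isRight_of_down {s : Side T} (h1 : L.pole s) (h2 : ¬ L.pos s) :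
    ¬ L.isRight s.tri := by
  rw [isRight, L.eq_poleSide h1]; exact h2

theorem isRight_of_up {s : Side T} (h1 : L.pole s) (h2 : L.pos s) : L.isRight s.tri := by
  rw [isRight, L.eq_poleSide h1]; exact h2

/-- The triangle on the right of the segment from `v` to `succ v` has both of them among its left
corners. -/
theorem rightLadder_succ (v : τ.Vertex) : L.rightLadder (L.succ v) = L.rightLadder v := by
  set s := τ.across (L.startSeg v) with hs
  have h1 : L.pole s := (L.pole_across _).2 (L.pole_startSeg v)
  have h2 : ¬ L.pos s := by rw [hs, L.pos_across, not_not]; exact L.pos_startSeg v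
  have h3 := L.not_isRight_of_down h1 h2
  have h4 : L.succ v = τ.vertex (L.leftTop s.tri) := by
    rw [L.leftTop_left h3, L.eq_poleSide h1, hs, τ.vertex_across_next]; rfl
  rw [h4, rightLadder_leftTop]; rfl

theorem leftLadder_succ (v : τ.Vertex) : L.leftLadder (L.succ v) = L.leftLadder v := by
  set s := L.startSeg v with hs
  have h3 := L.isRight_of_up (L.pole_startSeg v) (L.pos_startSeg v)
  have h4 : L.succ v = τ.vertex (L.rightTop s.tri) := by
    rw [L.rightTop_right h3, L.eq_poleSide (L.pole_startSeg v)]; rfl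
  have h5 : v = τ.vertex (L.rightBot s.tri) := by
    rw [L.rightBot_right h3, L.eq_poleSide (L.pole_startSeg v), L.vertex_startSeg]
  rw [h4, leftLadder_rightTop]
  conv_rhs => rw [h5]
  rw [leftLadder_rightBot]

theorem lift_vertex_pole {Q : Type*} (f : τ.Vertex → Q) (hf : ∀ v, f (L.succ v) = f v)
    (c d : Corner T)
    (h : d = τ.rot c ∨ ∃ s : Side T, L.pole s ∧ s.next = c ∧ s.prev = d) :
    f (τ.vertex c) = f (τ.vertex d) :=
  eq_of_sameCycle L.succ f hf (L.sameCycle_succ_of_ladderpole_eq (Quot.sound h))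

theorem vertexPole_leftTop (A : T × Fin 4) :
    L.vertexPole (τ.vertex (L.leftTop A)) = L.vertexPole (τ.vertex (L.leftBot A)) := by
  by_cases h : L.isRight A
  · rw [L.leftTop_right h, L.leftBot_right h]
  · rw [← L.succ_leftBot h, vertexPole_succ]

theorem vertexPole_rightTop (A : T × Fin 4) :
    L.vertexPole (τ.vertex (L.rightTop A)) = L.vertexPole (τ.vertex (L.rightBot A)) := by
  by_cases h : L.isRight A
  · rw [← L.succ_rightBot h, vertexPole_succ]
  · rw [L.rightTop_left h, L.rightBot_left h]

theorem lift_up_ladder {Q : Type*} (f : T × Fin 4 → Q) (hf : ∀ A, f (L.up A) = f A)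
    (A B : T × Fin 4)
    (h : ∃ s : Side T, ¬ L.pole s ∧ s.tri = A ∧ (τ.across s).tri = B) : f A = f B :=
  eq_of_sameCycle L.up f hf (L.sameCycle_up_of_ladder_eq (Quot.sound h))

/-- A ladder corresponds to the ladderpole on its left. -/
def leftPole : L.Ladder ≃ L.Ladderpole where
  toFun := Quot.lift (fun A => L.vertexPole (τ.vertex (L.leftBot A)))
    (L.lift_up_ladder _ fun A => by rw [vertex_leftBot_up, vertexPole_leftTop])
  invFun := Quot.lift (fun c => L.rightLadder (τ.vertex c))
    (L.lift_vertex_pole _ L.rightLadder_succ)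
  left_inv := by
    rintro ⟨A⟩
    exact L.rightLadder_leftBot A
  right_inv := by
    rintro ⟨c⟩
    show L.vertexPole (τ.vertex (L.leftBot (τ.across (L.startSeg (τ.vertex c))).tri)) =
      L.vertexPole (τ.vertex c)
    set s := τ.across (L.startSeg (τ.vertex c)) with hs
    have h1 : L.pole s := (L.pole_across _).2 (L.pole_startSeg _)
    have h2 : ¬ L.pos s := by rw [hs, L.pos_across, not_not]; exact L.pos_startSeg _
    rw [L.leftBot_left (L.not_isRight_of_down h1 h2), L.eq_poleSide h1, hs, τ.vertex_across_prev,
      vertex_startSeg]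

/-- A ladder corresponds to the ladderpole on its right. -/
def rightPole : L.Ladder ≃ L.Ladderpole where
  toFun := Quot.lift (fun A => L.vertexPole (τ.vertex (L.rightBot A)))
    (L.lift_up_ladder _ fun A => by rw [vertex_rightBot_up, vertexPole_rightTop])
  invFun := Quot.lift (fun c => L.leftLadder (τ.vertex c))
    (L.lift_vertex_pole _ L.leftLadder_succ)
  left_inv := by
    rintro ⟨A⟩
    exact L.leftLadder_rightBot A
  right_inv := by
    rintro ⟨c⟩
    show L.vertexPole (τ.vertex (L.rightBot (L.endSeg (τ.vertex c)).tri)) =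
      L.vertexPole (τ.vertex c)
    have h3 := L.isRight_of_up (L.pole_endSeg (τ.vertex c)) (L.pos_endSeg (τ.vertex c))
    rw [← vertexPole_rightTop, L.rightTop_right h3, L.eq_poleSide (L.pole_endSeg _),
      vertex_endSeg]

theorem leftPole_ladder (A : T × Fin 4) :
    L.leftPole (L.ladder A) = L.vertexPole (τ.vertex (L.leftBot A)) := rfl

theorem rightPole_ladder (A : T × Fin 4) :
    L.rightPole (L.ladder A) = L.vertexPole (τ.vertex (L.rightBot A)) := rfl

/-- The ladder on the right of a ladder. -/
def ladderSucc : Equiv.Perm L.Ladder := L.rightPole.trans L.leftPole.symm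

theorem leftPole_ladderSucc (l : L.Ladder) : L.leftPole (L.ladderSucc l) = L.rightPole l := by
  simp [ladderSucc]

theorem rightPole_ladder_up {s : Side T} (h1 : L.pole s) (h2 : L.pos s) :
    L.rightPole (L.ladder s.tri) = L.vertexPole (τ.vertex s.next) := by
  rw [rightPole_ladder, L.rightBot_right (L.isRight_of_up h1 h2), L.eq_poleSide h1]

theorem leftPole_ladder_down {s : Side T} (h1 : L.pole s) (h2 : ¬ L.pos s) :
    L.leftPole (L.ladder s.tri) = L.vertexPole (τ.vertex s.prev) := by
  rw [leftPole_ladder, L.leftBot_left (L.not_isRight_of_down h1 h2), L.eq_poleSide h1]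

theorem ladder_across_up {s : Side T} (h1 : L.pole s) (h2 : L.pos s) :
    L.ladder (τ.across s).tri = L.ladderSucc (L.ladder s.tri) := by
  apply L.leftPole.injective
  rw [leftPole_ladderSucc, L.rightPole_ladder_up h1 h2,
    L.leftPole_ladder_down ((L.pole_across s).2 h1) (by rw [L.pos_across, not_not]; exact h2),
    τ.vertex_across_prev]

theorem ladder_across_down {s : Side T} (h1 : L.pole s) (h2 : ¬ L.pos s) :
    L.ladderSucc (L.ladder (τ.across s).tri) = L.ladder s.tri := by
  have := L.ladder_across_up ((L.pole_across s).2 h1) ((L.pos_across s).2 h2)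
  rw [τ.across_across] at this
  exact this.symm

theorem cusp_across (s : Side T) : τ.cusp (τ.across s).tri = τ.cusp s.tri :=
  (Quot.sound ⟨s, rfl, rfl⟩ : τ.cusp s.tri = _).symm

/-- Each side either stays in a ladder or leads to one of its two neighbours, so the connectedness
of a cusp says that its ladders form a single cycle. -/
theorem ladderSucc_sameCycle {A B : T × Fin 4} (h : τ.cusp A = τ.cusp B) :
    L.ladderSucc.SameCycle (L.ladder A) (L.ladder B) := by
  have h' := Quot.eqvGen_exact h
  induction h' with
  | rel x y hxy =>
    obtain ⟨s, rfl, rfl⟩ := hxy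
    by_cases hs : L.pole s
    · by_cases hp : L.pos s
      · exact ⟨1, (L.ladder_across_up hs hp).symm⟩
      · exact Equiv.Perm.SameCycle.symm ⟨1, L.ladder_across_down hs hp⟩
    · rw [L.ladder_across hs]
  | refl x => exact Equiv.Perm.SameCycle.refl _ _
  | symm x y _ ih => exact (ih (Quot.eqvGen_sound ‹_›)).symm
  | trans x y z h1 h2 ih1 ih2 =>
    exact (ih1 (Quot.eqvGen_sound h1)).trans (ih2 (Quot.eqvGen_sound h2))

/-- The cusp of a ladder. -/
def ladderCusp : L.Ladder → τ.Cusp := Quot.lift τ.cusp fun A B h => by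
  obtain ⟨s, _, h2, h3⟩ := h
  exact Quot.sound ⟨s, h2, h3⟩

@[simp] theorem ladderCusp_ladder (A : T × Fin 4) : L.ladderCusp (L.ladder A) = τ.cusp A := rfl

/-- The cusp of a ladderpole. -/
def poleCusp : L.Ladderpole → τ.Cusp := Quot.lift (fun c => τ.cusp c.tri) fun c d h => by
  rcases h with rfl | ⟨s, _, rfl, rfl⟩
  · exact (cusp_across c.next).symm
  · rfl

@[simp] theorem poleCusp_ladderpole (c : Corner T) :
    L.poleCusp (L.ladderpole c) = τ.cusp c.tri := rfl

theorem poleCusp_leftPole (l : L.Ladder) : L.poleCusp (L.leftPole l) = L.ladderCusp l := by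
  obtain ⟨A, rfl⟩ : ∃ A, L.ladder A = l := Quot.exists_rep l
  rw [leftPole_ladder, vertexPole_vertex, poleCusp_ladderpole, leftBot_tri, ladderCusp_ladder]

theorem poleCusp_rightPole (l : L.Ladder) : L.poleCusp (L.rightPole l) = L.ladderCusp l := by
  obtain ⟨A, rfl⟩ : ∃ A, L.ladder A = l := Quot.exists_rep l
  rw [rightPole_ladder, vertexPole_vertex, poleCusp_ladderpole, rightBot_tri, ladderCusp_ladder]

theorem ladderCusp_ladderSucc (l : L.Ladder) : L.ladderCusp (L.ladderSucc l) = L.ladderCusp l := by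
  rw [← poleCusp_leftPole, leftPole_ladderSucc, poleCusp_rightPole]

end LadderStructure
end

noncomputable section
open scoped Classical

/-! ## Sums over the cycles of a permutation -/

namespace Equiv.Perm

variable {X : Type*} [Fintype X] (S : Equiv.Perm X)

theorem minimalPeriod_pos_of_fintype (x : X) : 0 < Function.minimalPeriod S x :=
  Function.minimalPeriod_pos_of_mem_periodicPts
    (Function.Injective.mem_periodicPts S.injective x)

theorem sameCycle_iff_iterate {x y : X} :
    S.SameCycle x y ↔ ∃ k < Function.minimalPeriod S x, S^[k] x = y := by
  constructor
  · intro h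
    obtain ⟨k, hk⟩ := h.exists_nat_pow_eq
    refine ⟨k % Function.minimalPeriod S x, Nat.mod_lt _ (S.minimalPeriod_pos_of_fintype x), ?_⟩
    rw [Function.iterate_mod_minimalPeriod_eq, ← hk, Equiv.Perm.iterate_eq_pow]
  · rintro ⟨k, -, rfl⟩
    exact ⟨k, by rw [zpow_natCast, Equiv.Perm.iterate_eq_pow]⟩

/-- This turns a sum over one turn around a ladder or a ladderpole into a sum over its elements. -/
theorem sum_range_minimalPeriod {M : Type*} [AddCommMonoid M] (g : X → M) (x : X)
    [DecidablePred (S.SameCycle x)] :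
    ∑ i ∈ Finset.range (Function.minimalPeriod S x), g (S^[i] x) =
      ∑ y with S.SameCycle x y, g y := by
  refine Finset.sum_bij (fun i _ => S^[i] x) (fun i hi => ?_) (fun i hi j hj h => ?_)
    (fun y hy => ?_) (fun _ _ => rfl)
  · rw [Finset.mem_filter]
    exact ⟨Finset.mem_univ _, (S.sameCycle_iff_iterate).2 ⟨i, Finset.mem_range.1 hi, rfl⟩⟩
  · exact (Function.iterate_eq_iterate_iff_of_lt_minimalPeriod (Finset.mem_range.1 hi)
      (Finset.mem_range.1 hj)).1 h
  · rw [Finset.mem_filter] at hy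
    obtain ⟨k, hk, h⟩ := (S.sameCycle_iff_iterate).1 hy.2
    exact ⟨k, Finset.mem_range.2 hk, h⟩

/-- A function whose sum over each cycle of a permutation vanishes is a coboundary. -/
theorem exists_coboundary {G : Type*} [AddCommGroup G] (g : X → G)
    [∀ x, DecidablePred (S.SameCycle x)]
    (h : ∀ x, ∑ y with S.SameCycle x y, g y = 0) : ∃ f : X → G, ∀ x, f (S x) - f x = g x := by
  -- A base point is chosen in each cycle; the solution at `x` is the sum of `g` along the way from
  -- the base point to `x`.
  let r : X → X := fun x => (Quotient.mk (SameCycle.setoid S) x).out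
  have hr : ∀ x, S.SameCycle (r x) x := fun x => Quotient.mk_out (s := SameCycle.setoid S) x
  have hrS : ∀ x, r (S x) = r x := fun x => by
    have : Quotient.mk (SameCycle.setoid S) (S x) = Quotient.mk (SameCycle.setoid S) x :=
      Quotient.sound (Equiv.Perm.SameCycle.symm ⟨1, rfl⟩)
    simp only [r, this]
  have hk : ∀ x, ∃ k, S^[k] (r x) = x := fun x => by
    obtain ⟨k, _, hk⟩ := (S.sameCycle_iff_iterate).1 (hr x)
    exact ⟨k, hk⟩
  choose k hk using hk
  let F : X → ℕ → G := fun x a => ∑ i ∈ Finset.range a, g (S^[i] x)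
  -- One full turn contributes zero, so the partial sums depend only on the end point and not on the
  -- number of turns.
  have hF : ∀ x, Function.Periodic (F x) (Function.minimalPeriod S x) := fun x a => by
    simp only [F]
    rw [add_comm a, Finset.sum_range_add, S.sum_range_minimalPeriod, h, zero_add]
    refine Finset.sum_congr rfl fun i _ => ?_
    rw [add_comm, Function.iterate_add_minimalPeriod_eq]
  have hF' : ∀ x a b, S^[a] x = S^[b] x → F x a = F x b := fun x a b hab => by
    rw [← (hF x).map_mod_nat a, ← (hF x).map_mod_nat b]
    congr 1
    rw [← Function.iterate_eq_iterate_iff_of_lt_minimalPeriod (f := S) (x := x)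
      (Nat.mod_lt _ (S.minimalPeriod_pos_of_fintype x))
      (Nat.mod_lt _ (S.minimalPeriod_pos_of_fintype x)),
      Function.iterate_mod_minimalPeriod_eq, Function.iterate_mod_minimalPeriod_eq, hab]
  refine ⟨fun x => F (r x) (k x), fun x => ?_⟩
  have h1 : F (r (S x)) (k (S x)) = F (r x) (k x + 1) := by
    rw [hrS]
    refine hF' _ _ _ ?_
    rw [Function.iterate_succ_apply', hk x]
    have := hk (S x)
    rwa [hrS] at this
  simp only [h1]
  simp only [F, Finset.sum_range_succ, hk, add_sub_cancel_left]

/-- A transitive permutation enumerates a finite type cyclically. -/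
theorem exists_cyclic_enumeration (hS : ∀ x y, S.SameCycle x y) (x : X) :
    ∃ (n : ℕ) (e : Fin (n + 1) ≃ X), ∀ j, e (j + 1) = S (e j) := by
  obtain ⟨n, hn⟩ : ∃ n, Function.minimalPeriod S x = n + 1 :=
    ⟨_, (Nat.succ_pred_eq_of_pos (S.minimalPeriod_pos_of_fintype x)).symm⟩
  have hb : Function.Bijective (fun j : Fin (n + 1) => S^[(j : ℕ)] x) := by
    constructor
    · intro i j h
      exact Fin.ext ((Function.iterate_eq_iterate_iff_of_lt_minimalPeriod (by rw [hn]; exact i.2)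
        (by rw [hn]; exact j.2)).1 h)
    · intro y
      obtain ⟨k, hk, h⟩ := (S.sameCycle_iff_iterate).1 (hS x y)
      exact ⟨⟨k, by rwa [← hn]⟩, h⟩
  refine ⟨n, Equiv.ofBijective _ hb, fun j => ?_⟩
  simp only [Equiv.ofBijective_apply]
  have h1 := Function.iterate_mod_minimalPeriod_eq (f := S) (x := x) (n := (j : ℕ) + 1)
  rw [hn] at h1
  rw [← Function.iterate_succ_apply' S, Fin.val_add, Fin.val_one', Nat.add_mod_mod, h1]

end Equiv.Perm
end

noncomputable section
open scoped Classical
open Complex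
open scoped Pointwise

/-! ## The turning number of a periodic embedded polygonal line -/

/-- The signed angle from `a` to `b`. -/
def turnArg (a b : ℂ) : ℝ := arg (b / a)

/-- Within an open half-plane, rotated by `u` to the right half-plane, arguments lie in `(-π/2,
π/2)` and their differences do not wrap around. Signed angles are then additive. -/
theorem turnArg_eq_sub {u a b : ℂ} (ha : 0 < (u * a).re) (hb : 0 < (u * b).re) :
    turnArg a b = arg (u * b) - arg (u * a) := by
  have hu : u ≠ 0 := by rintro rfl; simp at ha
  have ha0 : u * a ≠ 0 := by intro h; rw [h] at ha; simp at ha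
  have hb0 : u * b ≠ 0 := by intro h; rw [h] at hb; simp at hb
  have h1 := abs_arg_lt_pi_div_two_iff.2 (Or.inl ha)
  have h2 := abs_arg_lt_pi_div_two_iff.2 (Or.inl hb)
  rw [abs_lt] at h1 h2
  have h3 : b / a = (u * b) * (u * a)⁻¹ := by
    rw [← div_eq_mul_inv, mul_div_mul_left _ _ hu]
  have h4 : arg ((u * a)⁻¹) = - arg (u * a) := by
    rw [arg_inv, if_neg]; intro h; linarith [Real.pi_pos]
  rw [turnArg, h3, Complex.arg_mul hb0 (inv_ne_zero ha0), h4]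
  · ring
  · rw [h4]; constructor <;> linarith [h1.1, h1.2, h2.1, h2.2]

/-- A compact convex set that does not contain the origin lies in an open half-plane. -/
theorem exists_halfPlane {K : Set ℂ} (hK : Convex ℝ K) (hK' : IsCompact K) (h0 : (0 : ℂ) ∉ K) :
    ∃ u : ℂ, ∀ z ∈ K, 0 < (u * z).re := by
  obtain ⟨f, c, hc, hf⟩ := geometric_hahn_banach_point_closed hK hK'.isClosed h0
  -- With this `u`, the real part of `u * z` is `f z`, so the separating functional becomes
  -- multiplication by a complex number.
  refine ⟨⟨f 1, - f I⟩, fun z hz => ?_⟩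
  have h1 : f z = z.re * f 1 + z.im * f I := by
    conv_lhs => rw [← re_add_im z]
    rw [map_add, mul_comm (z.im : ℂ) I]
    have e1 : (z.re : ℂ) = z.re • (1 : ℂ) := by simp
    have e2 : I * (z.im : ℂ) = z.im • I := by simp [mul_comm]
    rw [e1, e2, map_smul, map_smul]; simp
  have h2 := hf z hz
  rw [map_zero] at hc
  simp only [mul_re]
  rw [h1] at h2
  linarith

/-- The four secants from one segment to the other belong to the convex set of differences, which
avoids the origin because the segments are disjoint. In the resulting half-plane the two routes from
`R - P` to `S - Q` have the same total angle. -/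
theorem turnArg_parallelogram {P Q R S : ℂ} (h : Disjoint (segment ℝ P Q) (segment ℝ R S)) :
    turnArg (R - P) (R - Q) + turnArg (R - Q) (S - Q) =
      turnArg (R - P) (S - P) + turnArg (S - P) (S - Q) := by
  obtain ⟨u, hu⟩ := exists_halfPlane (K := segment ℝ R S - segment ℝ P Q)
    ((convex_segment R S).sub (convex_segment P Q))
    (by
      have h1 : IsCompact (segment ℝ R S) := by
        rw [segment_eq_image]
        exact isCompact_Icc.image (by fun_prop)
      have h2 : IsCompact (segment ℝ P Q) := by
        rw [segment_eq_image]
        exact isCompact_Icc.image (by fun_prop)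
      rw [sub_eq_add_neg]
      exact h1.add h2.neg)
    (by
      rintro ⟨a, ha, b, hb, hab⟩
      simp only at hab
      rw [sub_eq_zero] at hab
      subst hab
      exact Set.disjoint_left.1 h hb ha)
  have m := fun a ha b hb => hu (a - b) (Set.sub_mem_sub (a := a) (b := b) ha hb)
  have h1 := m R (left_mem_segment ℝ R S) P (left_mem_segment ℝ P Q)
  have h2 := m R (left_mem_segment ℝ R S) Q (right_mem_segment ℝ P Q)
  have h3 := m S (right_mem_segment ℝ R S) P (left_mem_segment ℝ P Q)
  have h4 := m S (right_mem_segment ℝ R S) Q (right_mem_segment ℝ P Q)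
  rw [turnArg_eq_sub h1 h2, turnArg_eq_sub h2 h4, turnArg_eq_sub h1 h3, turnArg_eq_sub h3 h4]
  ring

/-- Unless `b` is a nonpositive multiple of `a`, the segment from `a` to `b` avoids the origin. The
half-plane that contains it also contains `a + b`. -/
theorem turnArg_triangle {a b : ℂ} (ha : a ≠ 0) (h : b / a ∈ slitPlane) :
    turnArg a (a + b) + turnArg (a + b) b = turnArg a b := by
  have hK : (0 : ℂ) ∉ segment ℝ a b := by
    rintro ⟨s, t, hs, ht, hst, h0⟩
    have h1 : (s : ℂ) + t * (b / a) = 0 := by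
      have : (s : ℂ) * a + t * b = 0 := by simpa using h0
      field_simp
      linear_combination this
    rcases h with h | h
    · have := congrArg re h1
      simp only [add_re, ofReal_re, mul_re, ofReal_im, zero_mul, sub_zero, zero_re] at this
      have h3 : 0 ≤ t * (b / a).re := mul_nonneg ht h.le
      have h4 : s = 0 := by linarith
      have h5 : t = 1 := by linarith
      subst h4 h5
      linarith
    · have := congrArg im h1
      simp only [add_im, ofReal_im, mul_im, ofReal_re, zero_mul, add_zero, zero_add, zero_im]
        at this
      have h5 : t = 0 := (mul_eq_zero.1 this).resolve_right h
      subst h5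
      have h6 : s = 1 := by linarith
      subst h6
      simp at h1
  have hc : IsCompact (segment ℝ a b) := by
    rw [segment_eq_image]; exact isCompact_Icc.image (by fun_prop)
  obtain ⟨u, hu⟩ := exists_halfPlane (convex_segment a b) hc hK
  have h1 := hu a (left_mem_segment ℝ a b)
  have h2 := hu b (right_mem_segment ℝ a b)
  have h3 : 0 < (u * (a + b)).re := by rw [mul_add, add_re]; linarith
  rw [turnArg_eq_sub h1 h3, turnArg_eq_sub h3 h2, turnArg_eq_sub h1 h2]
  ring

theorem turnArg_symm {a b : ℂ} (h : b / a ∈ slitPlane) : turnArg b a = - turnArg a b := by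
  rw [turnArg, turnArg, ← inv_div, arg_inv, if_neg (slitPlane_arg_ne_pi h)]

theorem div_mem_slitPlane_of_segment {a b : ℂ} (h : (0 : ℂ) ∉ segment ℝ a b) :
    b / a ∈ slitPlane := by
  by_contra hs
  rw [mem_slitPlane_iff, not_or, not_lt, not_not] at hs
  have ha : a ≠ 0 := by rintro rfl; exact h (left_mem_segment ℝ _ _)
  set r := - (b / a).re with hr
  have hr0 : 0 ≤ r := by linarith [hs.1]
  have hb : b = - r * a := by
    have : b / a = -(r : ℂ) := by
      apply Complex.ext <;> simp [hr, hs.2]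
    rw [← this, div_mul_cancel₀ _ ha]
  -- With `b = -r * a`, these are the weights for which the combination of `a` and `b` vanishes.
  refine h ⟨r / (1 + r), 1 / (1 + r), by positivity, by positivity,
    by rw [← add_div, add_comm r, div_self (by positivity)], ?_⟩
  rw [hb]
  simp only [real_smul]
  push_cast
  have : (1 + (r : ℂ)) ≠ 0 := by
    have : (1 + r) ≠ 0 := by positivity
    exact_mod_cast this
  field_simp
  ring_nf

theorem sum_range_shift {M : Type*} [AddCommGroup M] (F : ℕ → M) (N : ℕ) (h : F N = F 0) :
    ∑ i ∈ Finset.range N, F (i + 1) = ∑ i ∈ Finset.range N, F i := by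
  have h1 := Finset.sum_range_succ F N
  have h2 := Finset.sum_range_succ' F N
  rw [h2, h] at h1
  exact add_right_cancel h1

/-- The turning number of an embedded polygonal line that is invariant under a translation
vanishes (Hopf's Umlaufsatz, proved by deforming the tangent to the secants). -/
theorem sum_turnArg_eq_zero (X : ℕ → ℂ) (N : ℕ) (t : ℂ) (ht : t ≠ 0) (hN : 0 < N)
    (hX : ∀ i, X (i + N) = X i + t) (hne : ∀ i, X (i + 1) - X i ≠ 0)
    (hslit : ∀ i, (X (i + 2) - X (i + 1)) / (X (i + 1) - X i) ∈ slitPlane)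
    (hdisj : ∀ i j, i + 2 ≤ j → j + 1 ≤ i + N →
      Disjoint (segment ℝ (X i) (X (i + 1))) (segment ℝ (X j) (X (j + 1)))) :
    ∑ i ∈ Finset.range N, turnArg (X (i + 1) - X i) (X (i + 2) - X (i + 1)) = 0 := by
  let D : ℕ → ℕ → ℂ := fun i j => X j - X i
  have hD : ∀ i j, D (i + N) (j + N) = D i j := fun i j => by simp only [D, hX]; ring
  obtain ⟨M, rfl⟩ : ∃ M, N = M + 1 := ⟨N - 1, by omega⟩
  -- `A k` is the total turning over one period of the secants joining points `k` steps apart,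
  -- passing through the secants that are one step longer.
  let A : ℕ → ℝ := fun k => ∑ i ∈ Finset.range (M + 1),
    (turnArg (D i (i + k)) (D i (i + k + 1)) + turnArg (D i (i + k + 1)) (D (i + 1) (i + k + 1)))
  have hper : ∀ k, turnArg (D (M + 1) (M + 1 + k)) (D (M + 1) (M + 1 + k + 1)) =
      turnArg (D 0 (0 + k)) (D 0 (0 + k + 1)) := fun k => by
    have h1 := hD 0 (0 + k)
    have h2 := hD 0 (0 + k + 1)
    rw [← h1, ← h2]; congr 2 <;> ring
  -- Both sums use the secants between the segments at `i` and `i + k + 1`. These segments are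
  -- disjoint in this range of `k`, so the two routes between them agree, and what remains is a
  -- cyclic shift of the index.
  have hstep : ∀ k, 1 ≤ k → k + 1 ≤ M → A k = A (k + 1) := fun k hk hkM => by
    have e1 : A (k + 1) = ∑ i ∈ Finset.range (M + 1),
        (turnArg (D i (i + k + 1)) (D i (i + k + 2)) +
          turnArg (D i (i + k + 2)) (D (i + 1) (i + k + 2))) := rfl
    have e2 : ∀ i, turnArg (D i (i + k + 1)) (D i (i + k + 2)) +
          turnArg (D i (i + k + 2)) (D (i + 1) (i + k + 2)) =
        turnArg (D i (i + k + 1)) (D (i + 1) (i + k + 1)) +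
          turnArg (D (i + 1) (i + k + 1)) (D (i + 1) (i + k + 2)) := fun i =>
      (turnArg_parallelogram (hdisj i (i + k + 1) (by omega) (by omega))).symm
    rw [e1]
    simp only [e2, A, Finset.sum_add_distrib]
    rw [add_comm]
    congr 1
    have := sum_range_shift (fun i => turnArg (D i (i + k)) (D i (i + k + 1))) (M + 1) (hper k)
    rw [← this]
    refine Finset.sum_congr rfl fun i _ => ?_
    congr 2 <;> ring_nf
  have hD1 : ∀ i, D i (i + (M + 1)) = t := fun i => by simp only [D, hX]; ring
  -- For a period of one step, all the vectors equal `t` and there is no turning.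
  rcases Nat.eq_zero_or_pos M with rfl | hM
  · have : ∀ i, X (i + 1) - X i = t := fun i => hD1 i
    simp only [Finset.range_one, Finset.sum_singleton, zero_add]
    have h1 := this 0
    have h2 := this 1
    simp only [zero_add] at h1
    rw [h1, h2, turnArg, div_self ht, arg_one]
  · have hA1 : ∑ i ∈ Finset.range (M + 1), turnArg (X (i + 1) - X i) (X (i + 2) - X (i + 1)) =
        A 1 := by
      refine Finset.sum_congr rfl fun i _ => ?_
      have h1 := turnArg_triangle (hne i) (hslit i)
      have h2 : X (i + 1) - X i + (X (i + 2) - X (i + 1)) = X (i + 2) - X i := by ring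
      rw [h2] at h1
      exact h1.symm
    have hAM : A 1 = A M := by
      have : ∀ k, k + 1 ≤ M → A 1 = A (k + 1) := fun k hk => by
        induction k with
        | zero => rfl
        | succ k ih => rw [ih (by omega), hstep (k + 1) (by omega) hk]
      obtain ⟨k, rfl⟩ : ∃ k, M = k + 1 := ⟨M - 1, by omega⟩
      exact this k le_rfl
    rw [hA1, hAM]
    have hz : ∀ i, D i (i + M) + (X (i + M + 1) - X (i + M)) = t := fun i => by
      rw [← hD1 i]; simp only [D]; ring_nf
    -- This excludes opposite directions, so that `turnArg_symm` applies below. For `M ≥ 2` it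
    -- follows from the disjointness of the segment at `i + M` from the point `X i`. For `M = 1`
    -- these segments are adjacent, and the hypothesis on the turning at each vertex is used
    -- instead.
    have hslit' : ∀ i, t / D i (i + M) ∈ slitPlane := fun i => by
      rcases (show M = 1 ∨ 2 ≤ M by omega) with rfl | hM2
      · have h1 : t / D i (i + 1) = 1 + (X (i + 2) - X (i + 1)) / (X (i + 1) - X i) := by
          rw [← hz i]; simp only [D]; rw [add_div, div_self (hne i)]
        rw [h1]
        rcases hslit i with h | h
        · left; rw [add_re, one_re]; linarith
        · right; rwa [add_im, one_im, zero_add]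
      · refine div_mem_slitPlane_of_segment fun h0 => ?_
        have h1 := hdisj i (i + M) (by omega) (by omega)
        refine Set.disjoint_left.1 h1 (left_mem_segment ℝ _ _) ?_
        obtain ⟨a, b, ha, hb, hab, h⟩ := h0
        refine ⟨a, b, ha, hb, hab, ?_⟩
        have h2 : X (i + M + 1) = X i + t := hX i
        have h3 : (a : ℂ) + b = 1 := by exact_mod_cast hab
        rw [h2]
        simp only [D, real_smul] at h ⊢
        linear_combination h + X i * h3
    -- The secants spanning a full period are all equal to `t`. The turning is now measured against
    -- the fixed vector `t`, and its sum over a period telescopes.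
    have e3 : ∀ i, turnArg (D i (i + M)) (D i (i + M + 1)) +
        turnArg (D i (i + M + 1)) (D (i + 1) (i + M + 1)) =
        turnArg (D i (i + M)) t - turnArg (D (i + 1) (i + 1 + M)) t := fun i => by
      have h1 : D i (i + M + 1) = t := hD1 i
      have h2 : D (i + 1) (i + M + 1) = D (i + 1) (i + 1 + M) := by
        rw [add_right_comm]
      rw [h1, h2, turnArg_symm (a := D (i + 1) (i + 1 + M)) (hslit' (i + 1))]
      ring
    simp only [A, e3, Finset.sum_sub_distrib]
    rw [sub_eq_zero]
    refine (sum_range_shift (fun i => turnArg (D i (i + M)) t) (M + 1) ?_).symm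
    have := hD 0 (0 + M)
    simp only [zero_add] at this ⊢
    rw [← this, add_comm M (M + 1)]
end

noncomputable section
open scoped Classical

/-! ## A flat structure on the boundary

The vertices of each ladderpole are equally spaced on a vertical circle of length `1`, and the
ladders are vertical annuli of width `1`. -/

namespace LadderStructure

variable {T : Type*} [Fintype T] {τ : IdealTriangulation T} (L : LadderStructure τ)

theorem exists_vertexPole_eq (p : L.Ladderpole) : ∃ v, L.vertexPole v = p := by
  obtain ⟨c, rfl⟩ := Quot.exists_rep p
  exact ⟨τ.vertex c, rfl⟩

/-- A vertex chosen on each ladderpole. -/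
def markedVertex (p : L.Ladderpole) : τ.Vertex := (L.exists_vertexPole_eq p).choose

@[simp] theorem vertexPole_markedVertex (p : L.Ladderpole) : L.vertexPole (L.markedVertex p) = p :=
  (L.exists_vertexPole_eq p).choose_spec

/-- The marked vertex is where the ladderpole is cut open: the height drops by 1 when leaving it
upward, which makes it single-valued. -/
def mark (v : τ.Vertex) : ℤ := if v = L.markedVertex (L.vertexPole v) then 1 else 0

theorem sum_mark (v : τ.Vertex) : ∑ w with L.succ.SameCycle v w, L.mark w = 1 := by
  rw [Finset.sum_eq_single (L.markedVertex (L.vertexPole v))]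
  · simp [mark]
  · intro w hw hne
    rw [Finset.mem_filter, ← L.vertexPole_eq_iff] at hw
    rw [mark, if_neg]
    rwa [← hw.2]
  · intro h
    refine (h ?_).elim
    rw [Finset.mem_filter, ← L.vertexPole_eq_iff]
    simp

/-- The length of the ladderpole segments through a vertex. -/
def segLen (v : τ.Vertex) : ℝ := ((Finset.univ.filter fun w => L.succ.SameCycle v w).card : ℝ)⁻¹

theorem segLen_pos (v : τ.Vertex) : 0 < L.segLen v := by
  rw [segLen, inv_pos, Nat.cast_pos, Finset.card_pos]
  exact ⟨v, by simpa using Equiv.Perm.SameCycle.refl _ _⟩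

theorem sum_segLen (v : τ.Vertex) : ∑ w with L.succ.SameCycle v w, L.segLen w = 1 := by
  have h : ∀ w ∈ Finset.univ.filter (fun w => L.succ.SameCycle v w), L.segLen w = L.segLen v := by
    intro w hw
    rw [Finset.mem_filter] at hw
    unfold segLen
    congr 2
    refine congrArg _ (Finset.filter_congr fun u _ => ?_)
    exact ⟨fun h => hw.2.trans h, fun h => hw.2.symm.trans h⟩
  rw [Finset.sum_congr rfl h, Finset.sum_const, nsmul_eq_mul, segLen]
  refine mul_inv_cancel₀ ?_
  rw [Nat.cast_ne_zero]
  exact Finset.card_ne_zero.2 ⟨v, by simpa using Equiv.Perm.SameCycle.refl _ _⟩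

/-- Around a ladderpole the lengths add up to 1, and the single cut subtracts 1. -/
theorem exists_height : ∃ h : τ.Vertex → ℝ, ∀ v, h (L.succ v) - h v = L.segLen v - L.mark v :=
  L.succ.exists_coboundary _ fun v => by
    rw [Finset.sum_sub_distrib, sum_segLen, ← Int.cast_sum, sum_mark, Int.cast_one, sub_self]

/-- The height of a vertex on its ladderpole. -/
def height : τ.Vertex → ℝ := L.exists_height.choose

theorem height_succ (v : τ.Vertex) : L.height (L.succ v) = L.height v + L.segLen v - L.mark v := by
  have := L.exists_height.choose_spec v
  rw [height]; linarith

/-- The number of cuts passed by the left end of the rung when going from the bottom to the top rung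
of the triangle; zero when this end does not move. -/
def markLeft (A : T × Fin 4) : ℤ := if L.isRight A then 0 else L.mark (τ.vertex (L.leftBot A))
def markRight (A : T × Fin 4) : ℤ := if L.isRight A then L.mark (τ.vertex (L.rightBot A)) else 0

/-- One turn around the ladder passes every vertex of its left ladderpole once, hence the cut once.
The cut is passed in the triangle on the right of the segment that starts at the marked vertex. -/
theorem sum_markLeft (A : T × Fin 4) : ∑ B with L.up.SameCycle A B, L.markLeft B = 1 := by
  set p := L.leftPole (L.ladder A) with hp
  set s := τ.across (L.startSeg (L.markedVertex p)) with hs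
  have h1 : L.pole s := (L.pole_across _).2 (L.pole_startSeg _)
  have h2 : ¬ L.pos s := by rw [hs, L.pos_across, not_not]; exact L.pos_startSeg _
  have h3 := L.not_isRight_of_down h1 h2
  have h4 : τ.vertex (L.leftBot s.tri) = L.markedVertex p := by
    rw [L.leftBot_left h3, L.eq_poleSide h1, hs, τ.vertex_across_prev, vertex_startSeg]
  rw [Finset.sum_eq_single s.tri]
  · rw [markLeft, if_neg h3, mark, h4, vertexPole_markedVertex, if_pos rfl]
  · intro B hB hne
    rw [Finset.mem_filter, ← L.ladder_eq_iff] at hB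
    rw [markLeft]
    split_ifs with hr
    · rfl
    rw [mark, if_neg]
    intro h
    rw [← L.leftPole_ladder, ← hB.2, ← hp] at h
    have h5 := L.eq_startSeg ((L.pole_across _).2 (L.pole_poleSide B)) ((L.pos_across _).2 hr)
    rw [τ.vertex_across_next, ← L.leftBot_left hr, h] at h5
    refine hne ?_
    rw [hs, h5, τ.across_across, poleSide_tri]
  · intro h
    refine (h ?_).elim
    rw [Finset.mem_filter, ← L.ladder_eq_iff]
    refine ⟨Finset.mem_univ _, L.leftPole.injective ?_⟩
    rw [L.leftPole_ladder s.tri, h4, vertexPole_markedVertex]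

theorem sum_markRight (A : T × Fin 4) : ∑ B with L.up.SameCycle A B, L.markRight B = 1 := by
  set p := L.rightPole (L.ladder A) with hp
  set s := L.startSeg (L.markedVertex p) with hs
  have h1 : L.pole s := L.pole_startSeg _
  have h2 : L.pos s := L.pos_startSeg _
  have h3 := L.isRight_of_up h1 h2
  have h4 : τ.vertex (L.rightBot s.tri) = L.markedVertex p := by
    rw [L.rightBot_right h3, L.eq_poleSide h1, hs, vertex_startSeg]
  rw [Finset.sum_eq_single s.tri]
  · rw [markRight, if_pos h3, mark, h4, vertexPole_markedVertex, if_pos rfl]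
  · intro B hB hne
    rw [Finset.mem_filter, ← L.ladder_eq_iff] at hB
    rw [markRight]
    split_ifs with hr
    · rw [mark, if_neg]
      intro h
      rw [← L.rightPole_ladder, ← hB.2, ← hp] at h
      have h5 := L.eq_startSeg (L.pole_poleSide B) hr
      rw [← L.rightBot_right hr, h] at h5
      refine hne ?_
      rw [hs, h5, poleSide_tri]
    · rfl
  · intro h
    refine (h ?_).elim
    rw [Finset.mem_filter, ← L.ladder_eq_iff]
    refine ⟨Finset.mem_univ _, L.rightPole.injective ?_⟩
    rw [L.rightPole_ladder s.tri, h4, vertexPole_markedVertex]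

/-- The relative level of the two boundaries is well defined, because both pass one cut in a turn
around the ladder. -/
theorem exists_shift : ∃ a : T × Fin 4 → ℤ,
    ∀ A, a (L.up A) - a A = L.markRight A - L.markLeft A :=
  L.up.exists_coboundary _ fun A => by
    rw [Finset.sum_sub_distrib, sum_markRight, sum_markLeft, sub_self]

/-- The integral height of the right boundary of a triangle, relative to its left boundary. -/
def shift : T × Fin 4 → ℤ := L.exists_shift.choose

theorem shift_up (A : T × Fin 4) : L.shift (L.up A) = L.shift A + L.markRight A - L.markLeft A := by
  have := L.exists_shift.choose_spec A
  rw [shift]; linarith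

/-! ### Charts -/

def chartX (c : Corner T) : ℤ := if L.leftCorner c then 0 else 1

/-- The integer added to the height so as to undo the cuts inside one triangle. On the left
boundary, a corner followed by the ladderpole segment is the lower end of that segment; on the right
boundary it is the upper end. When the triangle has a single corner on a boundary, the corresponding
mark is zero and the cases agree. -/
def chartShift (c : Corner T) : ℤ :=
  if L.leftCorner c then (if L.pole c.next then 0 else L.markLeft c.tri)
  else L.shift c.tri + if L.pole c.next then L.markRight c.tri else 0

def chartY (c : Corner T) : ℝ := L.height (τ.vertex c) + L.chartShift c

/-- The position of a corner in the chart of its triangle. -/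
def chart (c : Corner T) : ℂ := ⟨L.chartX c, L.chartY c⟩

@[simp] theorem chartX_leftBot (A : T × Fin 4) : L.chartX (L.leftBot A) = 0 :=
  if_pos (L.leftCorner_leftBot A)
@[simp] theorem chartX_leftTop (A : T × Fin 4) : L.chartX (L.leftTop A) = 0 :=
  if_pos (L.leftCorner_leftTop A)
@[simp] theorem chartX_rightBot (A : T × Fin 4) : L.chartX (L.rightBot A) = 1 :=
  if_neg (L.not_leftCorner_rightBot A)
@[simp] theorem chartX_rightTop (A : T × Fin 4) : L.chartX (L.rightTop A) = 1 :=
  if_neg (L.not_leftCorner_rightTop A)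

@[simp] theorem chartShift_leftTop (A : T × Fin 4) : L.chartShift (L.leftTop A) = L.markLeft A := by
  have h : (L.leftTop A).next = L.topRung A := by rw [leftTop, Corner.prev_next]
  rw [chartShift, if_pos (L.leftCorner_leftTop A), h, if_neg (L.not_pole_topRung A), leftTop_tri]

@[simp] theorem chartShift_leftBot (A : T × Fin 4) : L.chartShift (L.leftBot A) = 0 := by
  by_cases h : L.isRight A
  · have h1 := L.chartShift_leftTop A
    rw [L.leftTop_right h] at h1
    rw [L.leftBot_right h, h1, markLeft, if_pos h]
  · rw [chartShift, if_pos (L.leftCorner_leftBot A), if_pos]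
    rw [L.leftBot_left h, Corner.prev_next]; exact L.pole_poleSide A

@[simp] theorem chartShift_rightBot (A : T × Fin 4) : L.chartShift (L.rightBot A) = L.shift A := by
  have h : (L.rightBot A).next = L.botRung A := by rw [rightBot, Corner.prev_next]
  rw [chartShift, if_neg (L.not_leftCorner_rightBot A), h, if_neg (L.not_pole_botRung A),
    rightBot_tri, add_zero]

@[simp] theorem chartShift_rightTop (A : T × Fin 4) :
    L.chartShift (L.rightTop A) = L.shift A + L.markRight A := by
  by_cases h : L.isRight A
  · rw [chartShift, if_neg (L.not_leftCorner_rightTop A), if_pos, rightTop_tri]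
    rw [L.rightTop_right h, Corner.prev_next]; exact L.pole_poleSide A
  · have h1 := L.chartShift_rightBot A
    rw [L.rightBot_left h] at h1
    rw [L.rightTop_left h, h1, markRight, if_neg h, add_zero]

/-- The translation from the chart across a side to the chart of its triangle. -/
def transX (s : Side T) : ℤ := L.chartX s.next - L.chartX (τ.across s).prev
def transY (s : Side T) : ℤ := L.chartShift s.next - L.chartShift (τ.across s).prev

theorem trans_eq_topRung (A : T × Fin 4) :
    L.transX (L.topRung A) = 0 ∧ L.transY (L.topRung A) = L.markLeft A ∧
    L.chartX (L.topRung A).prev - L.chartX (τ.across (L.topRung A)).next = 0 ∧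
    L.chartShift (L.topRung A).prev - L.chartShift (τ.across (L.topRung A)).next
      = L.markLeft A := by
  rw [transX, transY, across_topRung_eq]
  have e1 : (L.topRung A).next = L.rightTop A := rfl
  have e2 : (L.topRung A).prev = L.leftTop A := rfl
  have e3 : (L.botRung (L.up A)).next = L.leftBot (L.up A) := rfl
  have e4 : (L.botRung (L.up A)).prev = L.rightBot (L.up A) := rfl
  rw [e1, e2, e3, e4]
  simp only [chartX_rightTop, chartX_rightBot, chartShift_rightTop, chartShift_rightBot,
    chartX_leftTop, chartX_leftBot, chartShift_leftTop, chartShift_leftBot, shift_up]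
  refine ⟨by ring, by ring, by ring, by ring⟩

theorem trans_eq_up {s : Side T} (h1 : L.pole s) (h2 : L.pos s) :
    L.transX s = 1 ∧ L.chartX s.prev - L.chartX (τ.across s).next = 1 ∧
    L.chartShift s.prev - L.chartShift (τ.across s).next = L.transY s := by
  have hr := L.isRight_of_up h1 h2
  have h1' := (L.pole_across s).2 h1
  have hr' := L.not_isRight_of_down h1' (by rw [L.pos_across, not_not]; exact h2)
  have e1 : s.next = L.rightBot s.tri := by rw [L.rightBot_right hr, L.eq_poleSide h1]
  have e2 : s.prev = L.rightTop s.tri := by rw [L.rightTop_right hr, L.eq_poleSide h1]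
  have e3 : (τ.across s).next = L.leftTop (τ.across s).tri := by
    rw [L.leftTop_left hr', L.eq_poleSide h1']
  have e4 : (τ.across s).prev = L.leftBot (τ.across s).tri := by
    rw [L.leftBot_left hr', L.eq_poleSide h1']
  have e5 : L.markRight s.tri = L.markLeft (τ.across s).tri := by
    rw [markRight, markLeft, if_pos hr, if_neg hr', ← e1, ← e4, τ.vertex_across_prev]
  rw [transX, transY, e3, e4, e1, e2]
  simp [e5]

/-- The translation defined at one end of a side is also correct at the other end. Neighbouring
charts thus match along the whole side up to a lattice translation. By symmetry under `across`, it
suffices to treat top rungs and upward segments. -/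
theorem trans_spec (s : Side T) :
    L.chartX s.prev - L.chartX (τ.across s).next = L.transX s ∧
    L.chartShift s.prev - L.chartShift (τ.across s).next = L.transY s := by
  have key : ∀ s, L.pos s → L.chartX s.prev - L.chartX (τ.across s).next = L.transX s ∧
    L.chartShift s.prev - L.chartShift (τ.across s).next = L.transY s := fun s hs => by
    by_cases hp : L.pole s
    · have := L.trans_eq_up hp hs
      exact ⟨this.2.1.trans this.1.symm, this.2.2⟩
    · have := L.trans_eq_topRung s.tri
      rw [L.eq_topRung hp hs] at this
      exact ⟨this.2.2.1.trans this.1.symm, this.2.2.2.trans this.2.1.symm⟩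
  by_cases hs : L.pos s
  · exact key s hs
  · have := key (τ.across s) ((L.pos_across s).2 hs)
    simp only [transX, transY, τ.across_across] at this ⊢
    constructor <;> linarith [this.1, this.2]

theorem transX_across (s : Side T) : L.transX (τ.across s) = - L.transX s := by
  rw [← (L.trans_spec s).1, transX, τ.across_across]; ring

theorem transY_across (s : Side T) : L.transY (τ.across s) = - L.transY s := by
  rw [← (L.trans_spec s).2, transY, τ.across_across]; ring

theorem transX_rung {s : Side T} (hs : ¬ L.pole s) : L.transX s = 0 := by
  by_cases hp : L.pos s
  · rw [← L.eq_topRung hs hp]; exact (L.trans_eq_topRung _).1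
  · have h1 := (L.trans_eq_topRung (τ.across s).tri).1
    rw [L.eq_topRung (by rwa [L.pole_across]) ((L.pos_across s).2 hp), transX_across] at h1
    linarith

theorem transX_up {s : Side T} (h1 : L.pole s) (h2 : L.pos s) : L.transX s = 1 :=
  (L.trans_eq_up h1 h2).1

theorem transX_down {s : Side T} (h1 : L.pole s) (h2 : ¬ L.pos s) : L.transX s = -1 := by
  have := L.transX_up ((L.pole_across s).2 h1) ((L.pos_across s).2 h2)
  rw [transX_across] at this; linarith

def trans (s : Side T) : ℂ := ⟨L.transX s, L.transY s⟩

theorem chart_next (s : Side T) : L.chart s.next = L.chart (τ.across s).prev + L.trans s := by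
  apply Complex.ext
  · simp [chart, trans, transX]
  · simp [chart, trans, transY, chartY, τ.vertex_across_prev]

theorem chart_prev (s : Side T) : L.chart s.prev = L.chart (τ.across s).next + L.trans s := by
  obtain ⟨h1, h2⟩ := L.trans_spec s
  apply Complex.ext
  · simp [chart, trans, ← h1]
  · simp [chart, trans, chartY, τ.vertex_across_next, ← h2]

theorem chartY_leftTop {A : T × Fin 4} (h : ¬ L.isRight A) :
    L.chartY (L.leftTop A) = L.chartY (L.leftBot A) + L.segLen (τ.vertex (L.leftBot A)) := by
  rw [chartY, chartY, ← L.succ_leftBot h, height_succ, chartShift_leftTop, chartShift_leftBot,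
    markLeft, if_neg h]
  push_cast; ring

theorem chartY_rightTop {A : T × Fin 4} (h : L.isRight A) :
    L.chartY (L.rightTop A) = L.chartY (L.rightBot A) + L.segLen (τ.vertex (L.rightBot A)) := by
  rw [chartY, chartY, ← L.succ_rightBot h, height_succ, chartShift_rightTop, chartShift_rightBot,
    markRight, if_pos h]
  push_cast; ring

theorem chartY_leftTop_right {A : T × Fin 4} (h : L.isRight A) :
    L.chartY (L.leftTop A) = L.chartY (L.leftBot A) := by
  rw [L.leftTop_right h, L.leftBot_right h]

theorem chartY_rightTop_left {A : T × Fin 4} (h : ¬ L.isRight A) :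
    L.chartY (L.rightTop A) = L.chartY (L.rightBot A) := by
  rw [L.rightTop_left h, L.rightBot_left h]

/-! ### Stacking the triangles of a ladder -/

/-- The permutation of the lifts of the triangles to the universal covers of the ladders that goes
to the next triangle upward. -/
def upLift : Equiv.Perm ((T × Fin 4) × ℤ) where
  toFun x := (L.up x.1, x.2 + L.markLeft x.1)
  invFun x := (L.up.symm x.1, x.2 - L.markLeft (L.up.symm x.1))
  left_inv x := by simp
  right_inv x := by simp

theorem upLift_iterate (k : ℕ) (A : T × Fin 4) (n : ℤ) :
    L.upLift^[k] (A, n) = (L.up^[k] A, n + ∑ i ∈ Finset.range k, L.markLeft (L.up^[i] A)) := by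
  induction k with
  | zero => simp
  | succ k ih =>
    rw [Function.iterate_succ_apply', ih, Finset.sum_range_succ, Function.iterate_succ_apply',
      ← add_assoc]
    rfl

/-- A turn around the ladder passes one cut on its left and returns one level higher. Consequently
all the lifts of the triangles of a ladder form one orbit, that is, one infinite stack. -/
theorem upLift_sameCycle_add_one (A : T × Fin 4) (n : ℤ) :
    L.upLift.SameCycle (A, n) (A, n + 1) := by
  refine ⟨(Function.minimalPeriod L.up A : ℕ), ?_⟩
  rw [zpow_natCast, ← Equiv.Perm.iterate_eq_pow, upLift_iterate,
    Equiv.Perm.sum_range_minimalPeriod, sum_markLeft, Function.iterate_minimalPeriod]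

theorem upLift_sameCycle_int (A : T × Fin 4) (n m : ℤ) :
    L.upLift.SameCycle (A, n) (A, m) := by
  have h1 : ∀ k : ℕ, ∀ n : ℤ, L.upLift.SameCycle (A, n) (A, n + k) := fun k => by
    induction k with
    | zero => intro n; simpa using Equiv.Perm.SameCycle.refl _ _
    | succ k ih =>
      intro n
      have := (ih n).trans (L.upLift_sameCycle_add_one A (n + k))
      push_cast
      rwa [← add_assoc]
  rcases le_total n m with h | h
  · have := h1 (m - n).toNat n
    rwa [Int.toNat_of_nonneg (by omega), add_sub_cancel] at this
  · have := h1 (n - m).toNat m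
    rw [Int.toNat_of_nonneg (by omega), add_sub_cancel] at this
    exact this.symm

theorem upLift_sameCycle {A B : T × Fin 4} (h : L.ladder A = L.ladder B) (n m : ℤ) :
    L.upLift.SameCycle (A, n) (B, m) := by
  obtain ⟨k, -, rfl⟩ := (L.up.sameCycle_iff_iterate).1 (L.sameCycle_up_of_ladder_eq h)
  have h1 : L.upLift.SameCycle (A, n) (L.upLift^[k] (A, n)) :=
    ⟨k, by rw [zpow_natCast, Equiv.Perm.iterate_eq_pow]⟩
  rw [upLift_iterate] at h1
  exact h1.trans (L.upLift_sameCycle_int _ _ _)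

/-- The heights of the bottom and of the top of a lifted triangle at the horizontal position `f`. -/
def botHeight (f : ℝ) (x : (T × Fin 4) × ℤ) : ℝ :=
  x.2 + ((1 - f) * L.chartY (L.leftBot x.1) + f * L.chartY (L.rightBot x.1))
def topHeight (f : ℝ) (x : (T × Fin 4) × ℤ) : ℝ :=
  x.2 + ((1 - f) * L.chartY (L.leftTop x.1) + f * L.chartY (L.rightTop x.1))

/-- Consecutive lifted triangles share a rung, so at each horizontal position the stack is a chain
of adjacent vertical intervals. -/
theorem botHeight_upLift (f : ℝ) (x : (T × Fin 4) × ℤ) :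
    L.botHeight f (L.upLift x) = L.topHeight f x := by
  obtain ⟨A, n⟩ := x
  show L.botHeight f (L.up A, n + L.markLeft A) = _
  simp only [botHeight, topHeight, chartY, chartShift_leftBot, chartShift_rightBot,
    chartShift_leftTop, chartShift_rightTop, vertex_leftBot_up, vertex_rightBot_up, shift_up]
  push_cast
  ring

/-- The vertical thickness is proportional to the distance from the corner opposite the ladderpole
segment. It is positive inside the strip but may vanish on its boundary, where the comparison of
points needs strict inequalities. -/
theorem topHeight_sub_botHeight (f : ℝ) (x : (T × Fin 4) × ℤ) :
    L.topHeight f x - L.botHeight f x = if L.isRight x.1 then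
      f * L.segLen (τ.vertex (L.rightBot x.1)) else
      (1 - f) * L.segLen (τ.vertex (L.leftBot x.1)) := by
  rw [topHeight, botHeight]
  split_ifs with h
  · rw [L.chartY_rightTop h, L.chartY_leftTop_right h]; ring
  · rw [L.chartY_leftTop h, L.chartY_rightTop_left h]; ring

theorem botHeight_le_topHeight {f : ℝ} (h0 : 0 ≤ f) (h1 : f ≤ 1) (x : (T × Fin 4) × ℤ) :
    L.botHeight f x ≤ L.topHeight f x := by
  rw [← sub_nonneg, topHeight_sub_botHeight]
  split_ifs
  · exact mul_nonneg h0 (L.segLen_pos _).le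
  · exact mul_nonneg (by linarith) (L.segLen_pos _).le

theorem botHeight_lt_topHeight {f : ℝ} (h0 : 0 < f) (h1 : f < 1) (x : (T × Fin 4) × ℤ) :
    L.botHeight f x < L.topHeight f x := by
  rw [← sub_pos, topHeight_sub_botHeight]
  split_ifs
  · exact mul_pos h0 (L.segLen_pos _)
  · exact mul_pos (by linarith) (L.segLen_pos _)

theorem botHeight_le_iterate {f : ℝ} (h0 : 0 ≤ f) (h1 : f ≤ 1) (k : ℕ) (x : (T × Fin 4) × ℤ) :
    L.botHeight f x ≤ L.botHeight f (L.upLift^[k] x) := by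
  induction k generalizing x with
  | zero => exact le_rfl
  | succ k ih =>
    rw [Function.iterate_succ_apply]
    refine le_trans ?_ (ih _)
    rw [botHeight_upLift]
    exact L.botHeight_le_topHeight h0 h1 x

theorem iterate_trichotomy {X : Type*} (S : Equiv.Perm X) {x y : X} (h : S.SameCycle x y) :
    x = y ∨ (∃ k : ℕ, S^[k] (S x) = y) ∨ (∃ k : ℕ, S^[k] (S y) = x) := by
  obtain ⟨k, hk⟩ := h
  rcases k with k | k
  · rcases k with _ | k
    · left; simpa using hk
    · right; left
      refine ⟨k, ?_⟩
      rw [← Function.iterate_succ_apply, ← hk, Equiv.Perm.iterate_eq_pow]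
      rfl
  · right; right
    refine ⟨k, ?_⟩
    rw [← Function.iterate_succ_apply, ← hk, Equiv.Perm.iterate_eq_pow, zpow_negSucc]
    simp

/-- Intervals at different places of the stack have disjoint interiors, even on the boundary of the
strip where some of them are degenerate. -/
theorem eq_of_strictly_between {f z : ℝ} (h0 : 0 ≤ f) (h1 : f ≤ 1) {x y : (T × Fin 4) × ℤ}
    (h : L.ladder x.1 = L.ladder y.1) (hx : L.botHeight f x < z) (hx' : z < L.topHeight f x)
    (hy : L.botHeight f y < z) (hy' : z < L.topHeight f y) : x = y := by
  rcases iterate_trichotomy L.upLift (L.upLift_sameCycle h x.2 y.2) with h | ⟨k, h⟩ | ⟨k, h⟩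
  · exact h
  · have := L.botHeight_le_iterate h0 h1 k (L.upLift x)
    rw [show L.upLift^[k] (L.upLift x) = y from h, botHeight_upLift] at this
    linarith
  · have := L.botHeight_le_iterate h0 h1 k (L.upLift y)
    rw [show L.upLift^[k] (L.upLift y) = x from h, botHeight_upLift] at this
    linarith

/-- If `y` were two or more steps above `x`, a triangle of positive thickness would separate them.
-/
theorem adjacent_of_between_aux {f z : ℝ} (h0 : 0 < f) (h1 : f < 1) {x y : (T × Fin 4) × ℤ}
    (hx' : z ≤ L.topHeight f x) (hy : L.botHeight f y ≤ z) {k : ℕ}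
    (h : L.upLift^[k] (L.upLift x) = y) : y = L.upLift x ∧ z = L.topHeight f x := by
  have key : ∀ k, L.botHeight f (L.upLift x) ≤ L.botHeight f (L.upLift^[k] (L.upLift x)) :=
    fun k => L.botHeight_le_iterate h0.le h1.le k (L.upLift x)
  rcases k with _ | k
  · refine ⟨h.symm, le_antisymm hx' ?_⟩
    rw [← botHeight_upLift, show L.upLift x = y from h]; exact hy
  · exfalso
    have := L.botHeight_le_iterate h0.le h1.le k (L.upLift (L.upLift x))
    rw [← Function.iterate_succ_apply, h, botHeight_upLift] at this
    have h2 := L.botHeight_lt_topHeight h0 h1 (L.upLift x)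
    rw [botHeight_upLift] at h2
    linarith

theorem adjacent_of_between {f z : ℝ} (h0 : 0 < f) (h1 : f < 1) {x y : (T × Fin 4) × ℤ}
    (h : L.ladder x.1 = L.ladder y.1) (hx : L.botHeight f x ≤ z) (hx' : z ≤ L.topHeight f x)
    (hy : L.botHeight f y ≤ z) (hy' : z ≤ L.topHeight f y) :
    x = y ∨ (y = L.upLift x ∧ z = L.topHeight f x) ∨ (x = L.upLift y ∧ z = L.botHeight f x) := by
  rcases iterate_trichotomy L.upLift (L.upLift_sameCycle h x.2 y.2) with h | ⟨k, h⟩ | ⟨k, h⟩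
  · exact Or.inl h
  · exact Or.inr (Or.inl (L.adjacent_of_between_aux h0 h1 hx' hy h))
  · obtain ⟨h2, h3⟩ := L.adjacent_of_between_aux h0 h1 hy' hx h
    refine Or.inr (Or.inr ⟨h2, ?_⟩)
    rw [h2, botHeight_upLift, h3]

end LadderStructure
end

noncomputable section
open scoped Classical

/-! ## Points of the triangles in the flat structure -/

theorem Corner.sum_fin_four {T M : Type*} [AddCommMonoid M] (c : Corner T) (g : Fin 4 → M) :
    ∑ w, g w = g c.tip + (g c.idx + (g c.next.idx + g c.prev.idx)) := by
  have h1 : c.tip ∉ ({c.idx, c.next.idx, c.prev.idx} : Finset (Fin 4)) := by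
    simp only [Finset.mem_insert, Finset.mem_singleton, not_or]
    exact ⟨c.ne.symm, c.next.ne.symm, c.prev.ne.symm⟩
  have h2 : c.idx ∉ ({c.next.idx, c.prev.idx} : Finset (Fin 4)) := by
    simp only [Finset.mem_insert, Finset.mem_singleton, not_or]
    exact ⟨fun h => c.next_ne (Corner.ext rfl rfl h.symm),
      fun h => c.prev_ne (Corner.ext rfl rfl h.symm)⟩
  have h3 : c.next.idx ≠ c.prev.idx := fun h => c.next_ne_prev (Corner.ext rfl rfl h)
  have h4 : (Finset.univ : Finset (Fin 4)) = {c.tip, c.idx, c.next.idx, c.prev.idx} := by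
    symm
    rw [← Finset.card_eq_iff_eq_univ, Finset.card_insert_of_notMem h1, Finset.card_insert_of_notMem h2,
      Finset.card_pair h3]
    rfl
  rw [h4, Finset.sum_insert h1, Finset.sum_insert h2, Finset.sum_pair h3]

/-- A point of a triangle, in barycentric coordinates, that is not one of its vertices. -/
structure IsTrianglePoint {T : Type*} (A : T × Fin 4) (b : Fin 4 → ℝ) : Prop where
  tip : b A.2 = 0
  nonneg : ∀ w, 0 ≤ b w
  sum : ∑ w, b w = 1
  lt_one : ∀ w, b w < 1

theorem IsTrianglePoint.sum_corner {T : Type*} {b : Fin 4 → ℝ} {c : Corner T}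
    (h : IsTrianglePoint c.tri b) : b c.idx + (b c.next.idx + b c.prev.idx) = 1 := by
  have := h.sum
  rwa [c.sum_fin_four, show b c.tip = 0 from h.tip, zero_add] at this

namespace LadderStructure

variable {T : Type*} [Fintype T] {τ : IdealTriangulation T} (L : LadderStructure τ)

def chartVec (A : T × Fin 4) (w : Fin 4) : ℂ :=
  if h : w ≠ A.2 then L.chart ⟨A.1, A.2, w, h⟩ else 0

/-- The affine chart of a triangle. -/
def chartMap (A : T × Fin 4) : (Fin 4 → ℝ) →ₗ[ℝ] ℂ :=
  ∑ w, (LinearMap.proj w : (Fin 4 → ℝ) →ₗ[ℝ] ℝ).smulRight (L.chartVec A w)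

theorem chartMap_apply (c : Corner T) (b : Fin 4 → ℝ) :
    L.chartMap c.tri b = b c.idx • L.chart c + (b c.next.idx • L.chart c.next +
      b c.prev.idx • L.chart c.prev) := by
  have h0 : L.chartVec c.tri c.tip = 0 := dif_neg (not_not.2 rfl)
  have h1 : ∀ d : Corner T, L.chartVec d.tri d.idx = L.chart d := fun d => dif_pos d.ne
  have h2 : L.chartVec c.tri c.next.idx = L.chart c.next := h1 c.next
  have h3 : L.chartVec c.tri c.prev.idx = L.chart c.prev := h1 c.prev
  simp only [chartMap, LinearMap.coe_sum, Finset.sum_apply, LinearMap.smulRight_apply,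
    LinearMap.proj_apply]
  rw [c.sum_fin_four, h0, h1, h2, h3, smul_zero, zero_add]

theorem chartMap_point (c : Corner T) : L.chartMap c.tri c.point = L.chart c := by
  have h2 : c.next.idx ≠ c.idx := fun h => c.next_ne (Corner.ext rfl rfl h)
  have h3 : c.prev.idx ≠ c.idx := fun h => c.prev_ne (Corner.ext rfl rfl h)
  rw [chartMap_apply]
  simp [Corner.point, h2, h3]

/-- The length of the ladderpole segment of a triangle. -/
def triLen (A : T × Fin 4) : ℝ :=
  if L.isRight A then L.segLen (τ.vertex (L.rightBot A)) else L.segLen (τ.vertex (L.leftBot A))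

theorem triLen_pos (A : T × Fin 4) : 0 < L.triLen A := by
  rw [triLen]; split_ifs <;> exact L.segLen_pos _

/-- The name of the ladderpole segment is the corner opposite it, which lies alone on the other
boundary of the strip. Its weight is therefore the horizontal distance to the segment. -/
theorem chartMap_re {A : T × Fin 4} {b : Fin 4 → ℝ} (hb : IsTrianglePoint A b) :
    (L.chartMap A b).re =
      if L.isRight A then 1 - b (L.poleSide A).idx else b (L.poleSide A).idx := by
  obtain ⟨c, hc⟩ : ∃ c, L.poleSide A = c := ⟨_, rfl⟩
  have hA : A = c.tri := by rw [← hc, poleSide_tri]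
  have hs : b c.idx + (b c.next.idx + b c.prev.idx) = 1 := (hA ▸ hb).sum_corner
  rw [hc]
  conv_lhs => rw [hA, L.chartMap_apply]
  split_ifs with h
  · have e0 := L.leftBot_right h
    have e1 := L.rightBot_right h
    have e2 := L.rightTop_right h
    rw [hc] at e0 e1 e2
    rw [← e1, ← e2, ← e0]
    rw [← e1, ← e2, ← e0] at hs
    simp only [Complex.add_re, Complex.real_smul, Complex.mul_re, Complex.ofReal_re,
      Complex.ofReal_im, zero_mul, sub_zero, chart, chartX_leftBot, chartX_rightBot,
      chartX_rightTop]
    push_cast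
    linarith
  · have e0 := L.rightBot_left h
    have e1 := L.leftTop_left h
    have e2 := L.leftBot_left h
    rw [hc] at e0 e1 e2
    rw [← e1, ← e2, ← e0]
    simp only [Complex.add_re, Complex.real_smul, Complex.mul_re, Complex.ofReal_re,
      Complex.ofReal_im, zero_mul, sub_zero, chart, chartX_leftBot, chartX_rightBot,
      chartX_leftTop]
    push_cast
    ring

/-- The height above the bottom rung is proportional to the weight of the corner opposite that rung.
Together with `chartMap_re`, this recovers the barycentric coordinates from the chart. -/
theorem chartMap_im {A : T × Fin 4} {b : Fin 4 → ℝ} (hb : IsTrianglePoint A b) (n : ℤ) :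
    n + (L.chartMap A b).im = L.botHeight (L.chartMap A b).re (A, n) +
      b (L.botRung A).idx * L.triLen A := by
  obtain ⟨c, hc⟩ : ∃ c, L.poleSide A = c := ⟨_, rfl⟩
  have hA : A = c.tri := by rw [← hc, poleSide_tri]
  have hs : b c.idx + (b c.next.idx + b c.prev.idx) = 1 := (hA ▸ hb).sum_corner
  rw [L.chartMap_re hb, hc]
  conv_lhs => rw [hA, L.chartMap_apply]
  have him : ∀ d : Corner T, (L.chart d).im = L.chartY d := fun d => rfl
  simp only [Complex.add_im, Complex.real_smul, Complex.mul_im, Complex.ofReal_re,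
      Complex.ofReal_im, zero_mul, add_zero, him, botHeight]
  split_ifs with h
  · have e0 := L.leftBot_right h
    have e1 := L.rightBot_right h
    have e2 := L.rightTop_right h
    have e3 := L.chartY_rightTop h
    rw [triLen, if_pos h, L.botRung_right h]
    rw [hc] at *
    rw [e2] at e3
    rw [e3, e0, e1]
    have : b c.idx = 1 - b c.next.idx - b c.prev.idx := by linarith
    rw [this]; ring
  · have e0 := L.rightBot_left h
    have e1 := L.leftTop_left h
    have e2 := L.leftBot_left h
    have e3 := L.chartY_leftTop h
    rw [triLen, if_neg h, L.botRung_left h]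
    rw [hc] at *
    rw [e1] at e3
    rw [e3, e0, e2]
    have : b c.prev.idx = 1 - b c.next.idx - b c.idx := by linarith
    rw [this]; ring

theorem sum_rungs {A : T × Fin 4} {b : Fin 4 → ℝ} (hb : IsTrianglePoint A b) :
    b (L.poleSide A).idx + (b (L.topRung A).idx + b (L.botRung A).idx) = 1 := by
  have hs := IsTrianglePoint.sum_corner (c := L.poleSide A) (by rwa [poleSide_tri])
  rw [topRung, botRung]
  split_ifs
  · exact hs
  · linarith

theorem chartMap_im_top {A : T × Fin 4} {b : Fin 4 → ℝ} (hb : IsTrianglePoint A b) (n : ℤ) :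
    n + (L.chartMap A b).im = L.topHeight (L.chartMap A b).re (A, n) -
      b (L.topRung A).idx * L.triLen A := by
  have h1 := L.chartMap_im hb n
  have h2 := L.topHeight_sub_botHeight (L.chartMap A b).re (A, n)
  have h3 := L.chartMap_re hb
  have h4 := L.sum_rungs hb
  have h5 : (if L.isRight A then (L.chartMap A b).re * L.segLen (τ.vertex (L.rightBot A)) else
      (1 - (L.chartMap A b).re) * L.segLen (τ.vertex (L.leftBot A))) =
      (b (L.topRung A).idx + b (L.botRung A).idx) * L.triLen A := by
    rw [triLen]
    split_ifs at h3 ⊢ with h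
    · rw [h3]; congr 1; linarith
    · rw [h3]; congr 1; linarith
  rw [h5] at h2
  linarith

theorem chartMap_injOn {A : T × Fin 4} {b b' : Fin 4 → ℝ} (hb : IsTrianglePoint A b)
    (hb' : IsTrianglePoint A b') (h : L.chartMap A b = L.chartMap A b') : b = b' := by
  have h1 := L.chartMap_im hb 0
  have h2 := L.chartMap_im hb' 0
  have h3 := L.chartMap_re hb
  have h4 := L.chartMap_re hb'
  rw [h] at h1 h3
  have hbot : b (L.botRung A).idx = b' (L.botRung A).idx :=
    mul_right_cancel₀ (L.triLen_pos A).ne' (by linarith)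
  have hpole : b (L.poleSide A).idx = b' (L.poleSide A).idx := by
    split_ifs at h3 h4 <;> linarith
  have htop : b (L.topRung A).idx = b' (L.topRung A).idx := by
    linarith [L.sum_rungs hb, L.sum_rungs hb']
  have hn : b (L.poleSide A).next.idx = b' (L.poleSide A).next.idx := by
    by_cases hr : L.isRight A
    · rw [← L.topRung_right hr]; exact htop
    · rw [← L.botRung_left hr]; exact hbot
  have hp : b (L.poleSide A).prev.idx = b' (L.poleSide A).prev.idx := by
    by_cases hr : L.isRight A
    · rw [← L.botRung_right hr]; exact hbot
    · rw [← L.topRung_left hr]; exact htop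
  funext w
  by_cases hw : w = A.2
  · rw [hw, hb.tip, hb'.tip]
  · have := Corner.eq_of_tri_eq (c := L.poleSide A) (d := ⟨A.1, A.2, w, hw⟩)
      (by rw [poleSide_tri]; rfl)
    rcases this with h | h | h
    · have := congrArg Corner.idx h; simp only at this; rw [this]; exact hpole
    · have := congrArg Corner.idx h; simp only at this; rw [this]; exact hn
    · have := congrArg Corner.idx h; simp only at this; rw [this]; exact hp

theorem re_mem {A : T × Fin 4} {b : Fin 4 → ℝ} (hb : IsTrianglePoint A b) :
    0 ≤ (L.chartMap A b).re ∧ (L.chartMap A b).re ≤ 1 := by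
  have h1 := hb.nonneg (L.poleSide A).idx
  have h2 := hb.lt_one (L.poleSide A).idx
  rw [L.chartMap_re hb]
  split_ifs <;> constructor <;> linarith

/-- A point on a vertical boundary of the strip lies in the interior of a ladderpole segment. -/
theorem on_pole {A : T × Fin 4} {b : Fin 4 → ℝ} (hb : IsTrianglePoint A b)
    (h : ¬ (0 < (L.chartMap A b).re ∧ (L.chartMap A b).re < 1)) :
    b (L.poleSide A).idx = 0 ∧ (L.chartMap A b).re = (if L.isRight A then 1 else 0) ∧
    ∀ n : ℤ, L.botHeight (L.chartMap A b).re (A, n) < n + (L.chartMap A b).im ∧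
      n + (L.chartMap A b).im < L.topHeight (L.chartMap A b).re (A, n) := by
  have h1 := hb.nonneg (L.poleSide A).idx
  have h2 := hb.lt_one (L.poleSide A).idx
  have h3 := L.chartMap_re hb
  have h0 : b (L.poleSide A).idx = 0 := by
    by_contra h0
    have h0' : 0 < b (L.poleSide A).idx := lt_of_le_of_ne h1 (Ne.symm h0)
    apply h
    rw [h3]
    split_ifs <;> constructor <;> linarith
  refine ⟨h0, ?_, fun n => ?_⟩
  · rw [h3, h0]; split_ifs <;> simp
  · have h4 := L.sum_rungs hb
    have h5 := hb.lt_one (L.topRung A).idx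
    have h6 := hb.lt_one (L.botRung A).idx
    have h7 := L.triLen_pos A
    constructor
    · rw [L.chartMap_im hb n]
      have : 0 < b (L.botRung A).idx * L.triLen A := mul_pos (by linarith) h7
      linarith
    · rw [L.chartMap_im_top hb n]
      have : 0 < b (L.topRung A).idx * L.triLen A := mul_pos (by linarith) h7
      linarith

theorem between {A : T × Fin 4} {b : Fin 4 → ℝ} (hb : IsTrianglePoint A b) (n : ℤ) :
    L.botHeight (L.chartMap A b).re (A, n) ≤ n + (L.chartMap A b).im ∧
      n + (L.chartMap A b).im ≤ L.topHeight (L.chartMap A b).re (A, n) := by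
  have h7 := L.triLen_pos A
  constructor
  · rw [L.chartMap_im hb n]
    have := mul_nonneg (hb.nonneg (L.botRung A).idx) h7.le
    linarith
  · rw [L.chartMap_im_top hb n]
    have := mul_nonneg (hb.nonneg (L.topRung A).idx) h7.le
    linarith

theorem chartY_next (s : Side T) : L.chartY s.next = L.chartY (τ.across s).prev + L.transY s :=
  congrArg Complex.im (L.chart_next s)

theorem chartY_prev (s : Side T) : L.chartY s.prev = L.chartY (τ.across s).next + L.transY s :=
  congrArg Complex.im (L.chart_prev s)

/-- The common ladderpole segment occupies the same interval in the two charts, at the right end of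
one strip and at the left end of the next. -/
theorem heights_across_right {A : T × Fin 4} (h : L.isRight A) (n : ℤ) :
    L.botHeight 0 ((τ.across (L.poleSide A)).tri, n + L.transY (L.poleSide A)) =
      L.botHeight 1 (A, n) ∧
    L.topHeight 0 ((τ.across (L.poleSide A)).tri, n + L.transY (L.poleSide A)) =
      L.topHeight 1 (A, n) := by
  have hp := (L.pole_across _).2 (L.pole_poleSide A)
  have hl := L.not_isRight_of_down hp (by rw [L.pos_across, not_not]; exact h)
  simp only [botHeight, topHeight]
  rw [L.leftBot_left hl, L.leftTop_left hl, L.rightBot_right h, L.rightTop_right h,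
    L.eq_poleSide hp]
  have h1 := L.chartY_next (L.poleSide A)
  have h2 := L.chartY_prev (L.poleSide A)
  push_cast
  constructor <;> linarith

theorem heights_across_left {A : T × Fin 4} (h : ¬ L.isRight A) (n : ℤ) :
    L.botHeight 1 ((τ.across (L.poleSide A)).tri, n + L.transY (L.poleSide A)) =
      L.botHeight 0 (A, n) ∧
    L.topHeight 1 ((τ.across (L.poleSide A)).tri, n + L.transY (L.poleSide A)) =
      L.topHeight 0 (A, n) := by
  have hp := (L.pole_across _).2 (L.pole_poleSide A)
  have hr := L.isRight_of_up hp (by rw [L.pos_across]; exact h)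
  simp only [botHeight, topHeight]
  rw [L.rightBot_right hr, L.rightTop_right hr, L.leftBot_left h, L.leftTop_left h,
    L.eq_poleSide hp]
  have h1 := L.chartY_next (L.poleSide A)
  have h2 := L.chartY_prev (L.poleSide A)
  push_cast
  constructor <;> linarith

/-- Two lifted triangles that share a point other than a vertex coincide or are adjacent along a
side through this point. -/
theorem eq_or_adjacent {A B : T × Fin 4} {O O' : ℤ × ℤ} {b b' : Fin 4 → ℝ}
    (hb : IsTrianglePoint A b) (hb' : IsTrianglePoint B b')
    (hl : (L.ladderSucc ^ (O'.1 - O.1)) (L.ladder A) = L.ladder B)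
    (hx : O.1 + (L.chartMap A b).re = O'.1 + (L.chartMap B b').re)
    (hy : O.2 + (L.chartMap A b).im = O'.2 + (L.chartMap B b').im) :
    (A = B ∧ O = O') ∨ ∃ s : Side T, s.tri = A ∧ b s.idx = 0 ∧ (τ.across s).tri = B ∧
      O' = O + (L.transX s, L.transY s) := by
  have hr := L.re_mem hb
  have hr' := L.re_mem hb'
  by_cases h1 : O.1 = O'.1
  · have hf : (L.chartMap A b).re = (L.chartMap B b').re := by rw [h1] at hx; linarith
    have hl' : L.ladder A = L.ladder B := by rw [← hl, h1]; simp
    -- In the same column, away from the ladderpoles, the lifted triangles are consecutive in the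
    -- stack and meet along a rung.
    by_cases h01 : 0 < (L.chartMap A b).re ∧ (L.chartMap A b).re < 1
    · have hz := L.between hb O.2
      have hz' := L.between hb' O'.2
      rw [← hf, ← hy] at hz'
      rcases L.adjacent_of_between h01.1 h01.2 (x := (A, O.2)) (y := (B, O'.2)) hl' hz.1 hz.2 hz'.1
        hz'.2 with h | ⟨h, h'⟩ | ⟨h, h'⟩
      · left
        rw [Prod.mk.injEq] at h
        exact ⟨h.1, Prod.ext h1 h.2⟩
      · right
        have h2 : B = L.up A := congrArg Prod.fst h
        have h3 : O'.2 = O.2 + L.markLeft A := congrArg Prod.snd h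
        obtain ⟨t1, t2, -, -⟩ := L.trans_eq_topRung A
        refine ⟨L.topRung A, L.topRung_tri A, ?_, ?_, ?_⟩
        · have := L.chartMap_im_top hb O.2
          have h5 : b (L.topRung A).idx * L.triLen A = 0 := by linarith
          exact (mul_eq_zero.1 h5).resolve_right (L.triLen_pos A).ne'
        · rw [h2]; rfl
        · rw [t1, t2]; exact Prod.ext (by simp [h1]) h3
      · right
        have h2 : A = L.up B := congrArg Prod.fst h
        have h3 : O.2 = O'.2 + L.markLeft B := congrArg Prod.snd h
        obtain ⟨t1, t2, -, -⟩ := L.trans_eq_topRung B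
        have e1 : L.botRung A = τ.across (L.topRung B) := by rw [h2, across_topRung_eq]
        refine ⟨L.botRung A, L.botRung_tri A, ?_, ?_, ?_⟩
        · have := L.chartMap_im hb O.2
          have h5 : b (L.botRung A).idx * L.triLen A = 0 := by linarith
          exact (mul_eq_zero.1 h5).resolve_right (L.triLen_pos A).ne'
        · rw [e1, τ.across_across, topRung_tri]
        · rw [e1, transX_across, transY_across, t1, t2]
          exact Prod.ext (by simp [h1]) (by simp [h3])
    -- On a ladderpole, vertices are excluded, so the point is strictly inside the intervals of both
    -- triangles and they coincide.
    · left
      obtain ⟨-, -, hs⟩ := L.on_pole hb h01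
      obtain ⟨-, -, hs'⟩ := L.on_pole hb' (by rwa [← hf])
      have hz := hs O.2
      have hz' := hs' O'.2
      rw [← hf, ← hy] at hz'
      have h := L.eq_of_strictly_between hr.1 hr.2 (x := (A, O.2)) (y := (B, O'.2)) hl' hz.1 hz.2
        hz'.1 hz'.2
      rw [Prod.mk.injEq] at h
      exact ⟨h.1, Prod.ext h1 h.2⟩
  · right
    -- Horizontal coordinates within a chart lie in `[0, 1]`, so different columns that share a
    -- point are adjacent and the point lies on their common ladderpole.
    have hd : O'.1 = O.1 + 1 ∧ (L.chartMap A b).re = 1 ∧ (L.chartMap B b').re = 0 ∨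
        O.1 = O'.1 + 1 ∧ (L.chartMap A b).re = 0 ∧ (L.chartMap B b').re = 1 := by
      rcases lt_or_gt_of_ne h1 with h | h
      · left
        have h' : (O.1 : ℝ) + 1 ≤ O'.1 := by exact_mod_cast h
        have e : (L.chartMap A b).re = 1 := by linarith
        have e' : (L.chartMap B b').re = 0 := by linarith
        refine ⟨?_, e, e'⟩
        rw [e, e'] at hx
        have : (O.1 : ℝ) + 1 = O'.1 := by linarith
        exact_mod_cast this.symm
      · right
        have h' : (O'.1 : ℝ) + 1 ≤ O.1 := by exact_mod_cast h
        have e : (L.chartMap A b).re = 0 := by linarith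
        have e' : (L.chartMap B b').re = 1 := by linarith
        refine ⟨?_, e, e'⟩
        rw [e, e'] at hx
        have : (O.1 : ℝ) = O'.1 + 1 := by linarith
        exact_mod_cast this
    have hp := L.pole_poleSide A
    refine ⟨L.poleSide A, L.poleSide_tri A, ?_⟩
    rcases hd with ⟨h2, hf, hf'⟩ | ⟨h2, hf, hf'⟩
    · obtain ⟨h0, hR, hs⟩ := L.on_pole hb (by rw [hf]; simp)
      obtain ⟨-, -, hs'⟩ := L.on_pole hb' (by rw [hf']; simp)
      have hR' : L.isRight A := by by_contra h; rw [hf, if_neg h] at hR; norm_num at hR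
      obtain ⟨e1, e2⟩ := L.heights_across_right hR' O.2
      have hz := hs O.2
      have hz' := hs' O'.2
      rw [hf] at hz
      rw [hf', ← hy] at hz'
      rw [← e1, ← e2] at hz
      -- The triangle across the ladderpole segment lies in the same column as `B` and contains the
      -- point strictly between its ends, so it is `B`.
      have hlad : L.ladder (τ.across (L.poleSide A)).tri = L.ladder B := by
        rw [L.ladder_across_up hp hR', poleSide_tri, ← hl, h2]; simp
      have h := L.eq_of_strictly_between le_rfl zero_le_one
        (x := ((τ.across (L.poleSide A)).tri, O.2 + L.transY (L.poleSide A))) (y := (B, O'.2))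
        hlad hz.1 hz.2 hz'.1 hz'.2
      rw [Prod.mk.injEq] at h
      exact ⟨h0, h.1, Prod.ext (by rw [h2, L.transX_up hp hR']; rfl) h.2.symm⟩
    · obtain ⟨h0, hR, hs⟩ := L.on_pole hb (by rw [hf]; simp)
      obtain ⟨-, -, hs'⟩ := L.on_pole hb' (by rw [hf']; simp)
      have hR' : ¬ L.isRight A := by intro h; rw [hf, if_pos h] at hR; norm_num at hR
      obtain ⟨e1, e2⟩ := L.heights_across_left hR' O.2
      have hz := hs O.2
      have hz' := hs' O'.2
      rw [hf] at hz
      rw [hf', ← hy] at hz'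
      rw [← e1, ← e2] at hz
      have hlad : L.ladder (τ.across (L.poleSide A)).tri = L.ladder B := by
        apply L.ladderSucc.injective
        rw [L.ladder_across_down hp hR', poleSide_tri, ← hl, h2]
        simp
      have h := L.eq_of_strictly_between zero_le_one le_rfl
        (x := ((τ.across (L.poleSide A)).tri, O.2 + L.transY (L.poleSide A))) (y := (B, O'.2))
        hlad hz.1 hz.2 hz'.1 hz'.2
      rw [Prod.mk.injEq] at h
      exact ⟨h0, h.1, Prod.ext (by
        show O'.1 = O.1 + L.transX (L.poleSide A)
        rw [L.transX_down hp hR', h2]; ring) h.2.symm⟩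

end LadderStructure
end

noncomputable section
open scoped Classical

/-! ## Normal curves -/

namespace NormalArc

variable {T : Type*}

theorem entry_tri (a : NormalArc T) : a.entry.tri = a.corner.tri := by
  unfold entry; split_ifs <;> rfl

theorem exit_tri (a : NormalArc T) : a.exit.tri = a.corner.tri := by
  unfold exit; split_ifs <;> rfl

theorem exit_entry (a : NormalArc T) :
    (a.left = true ∧ a.exit = a.corner.next ∧ a.entry = a.corner.prev) ∨
    (a.left = false ∧ a.exit = a.corner.prev ∧ a.entry = a.corner.next) := by
  rcases h : a.left with _ | _
  · right; simp [exit, entry, h]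
  · left; simp [exit, entry, h]

end NormalArc

namespace SimpleNormalCurve

variable {T : Type*} {τ : IdealTriangulation T} (γ : SimpleNormalCurve τ)

/-- The sum of a function of the corners over the corners cut off on the left of the curve, minus
its sum over the corners cut off on the right. -/
def cornerTurn (f : Corner T → ℝ) : ℝ :=
  ∑ j, if (γ.arc j).left then f (γ.arc j).corner else - f (γ.arc j).corner

theorem turningAngle_eq (θ : T → Fin 3 → ℝ) :
    γ.turningAngle θ = γ.cornerTurn fun c => c.angle θ := rfl

theorem cornerTurn_add (f g : Corner T → ℝ) :
    γ.cornerTurn (fun c => f c + g c) = γ.cornerTurn f + γ.cornerTurn g := by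
  rw [cornerTurn, cornerTurn, cornerTurn, ← Finset.sum_add_distrib]
  refine Finset.sum_congr rfl fun j _ => ?_
  split_ifs <;> ring

theorem cornerTurn_mul (r : ℝ) (f : Corner T → ℝ) :
    γ.cornerTurn (fun c => r * f c) = r * γ.cornerTurn f := by
  rw [cornerTurn, cornerTurn, Finset.mul_sum]
  refine Finset.sum_congr rfl fun j _ => ?_
  split_ifs <;> ring

theorem sum_entry {M : Type*} [AddCommMonoid M] (g : Side T → M) :
    ∑ j, g (γ.arc j).entry = ∑ j, g (τ.across (γ.arc j).exit) := by
  simp only [γ.closed]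
  exact (Equiv.sum_comp (Equiv.addRight (1 : Fin (γ.n + 1))) fun j => g (γ.arc j).entry).symm

/-- With either orientation, the signed contribution of an arc is the value at its exit side minus
the value at its entry side. The entry side of the next arc is the exit side seen from across. -/
theorem cornerTurn_coboundary (g : Side T → ℝ) :
    γ.cornerTurn (fun c => g c.next - g c.prev) =
      ∑ j, (g (γ.arc j).exit - g (τ.across (γ.arc j).exit)) := by
  rw [Finset.sum_sub_distrib, ← γ.sum_entry, ← Finset.sum_sub_distrib, cornerTurn]
  refine Finset.sum_congr rfl fun j _ => ?_
  rcases (γ.arc j).exit_entry with ⟨h, h1, h2⟩ | ⟨h, h1, h2⟩ <;> simp [h, h1, h2]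

theorem cornerTurn_coboundary_eq_zero (g : Side T → ℝ) (hg : ∀ s, g (τ.across s) = g s) :
    γ.cornerTurn (fun c => g c.next - g c.prev) = 0 := by
  rw [cornerTurn_coboundary]
  simp [hg]

end SimpleNormalCurve

/-! ### Chords of triangles -/

/-- The letters `x` and `e` name the exit and entry sides and also the corners opposite them, so a
point of the entry side is a combination of `c` and `x`. A chord cutting off `c` has positive weight
at `c` throughout and meets the other two sides only at its ends. -/
theorem chord_spec {T : Type*} {c x e : Corner T}
    (hxe : (x = c.next ∧ e = c.prev) ∨ (x = c.prev ∧ e = c.next)) {p q t : ℝ}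
    (hp : 0 < p) (hp1 : p < 1) (hq : 0 < q) (hq1 : q < 1) (ht : 0 ≤ t) (ht1 : t ≤ 1)
    {P Q b : Fin 4 → ℝ} (hP : P = p • c.point + (1 - p) • x.point)
    (hQ : Q = q • c.point + (1 - q) • e.point) (hb : b = (1 - t) • P + t • Q) :
    IsTrianglePoint c.tri b ∧
      ∀ s : Side T, s.tri = c.tri → b s.idx = 0 → (s = x ∧ b = Q) ∨ (s = e ∧ b = P) := by
  have hne : ∀ {a b : Corner T}, a.tri = b.tri → a ≠ b → a.idx ≠ b.idx := fun {a b} h hab h' =>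
    hab (Corner.ext (congrArg Prod.fst h) (congrArg Prod.snd h) h')
  have hxc : x.idx ≠ c.idx := by
    rcases hxe with ⟨rfl, rfl⟩ | ⟨rfl, rfl⟩
    exacts [hne rfl c.next_ne, hne rfl c.prev_ne]
  have hec : e.idx ≠ c.idx := by
    rcases hxe with ⟨rfl, rfl⟩ | ⟨rfl, rfl⟩
    exacts [hne rfl c.prev_ne, hne rfl c.next_ne]
  have hxe' : x.idx ≠ e.idx := by
    rcases hxe with ⟨rfl, rfl⟩ | ⟨rfl, rfl⟩
    exacts [hne rfl c.next_ne_prev, hne rfl c.next_ne_prev.symm]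
  have hx : x.tri = c.tri := by rcases hxe with ⟨rfl, rfl⟩ | ⟨rfl, rfl⟩ <;> rfl
  have he : e.tri = c.tri := by rcases hxe with ⟨rfl, rfl⟩ | ⟨rfl, rfl⟩ <;> rfl
  have hxt : x.idx ≠ c.tip := by
    have h : x.tip = c.tip := congrArg Prod.snd hx
    rw [← h]; exact x.ne
  have het : e.idx ≠ c.tip := by
    have h : e.tip = c.tip := congrArg Prod.snd he
    rw [← h]; exact e.ne
  have bt : b c.tip = 0 := by
    simp [hb, hP, hQ, Corner.point, c.ne.symm, hxt.symm, het.symm]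
  have bc : b c.idx = (1 - t) * p + t * q := by
    simp [hb, hP, hQ, Corner.point, hxc.symm, hec.symm]
  have bx : b x.idx = (1 - t) * (1 - p) := by
    simp [hb, hP, hQ, Corner.point, hxc, hxe']
  have be : b e.idx = t * (1 - q) := by
    simp [hb, hP, hQ, Corner.point, hec, hxe'.symm]
  have hall : ∀ s : Corner T, s.tri = c.tri → s = c ∨ s = x ∨ s = e := fun s hs => by
    have := Corner.eq_of_tri_eq hs
    rcases hxe with ⟨rfl, rfl⟩ | ⟨rfl, rfl⟩ <;> tauto
  have hidx : ∀ w, w = c.tip ∨ w = c.idx ∨ w = x.idx ∨ w = e.idx := fun w => by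
    by_cases hw : w = c.tip
    · exact Or.inl hw
    · rcases hall ⟨c.tet, c.tip, w, hw⟩ rfl with h | h | h
      · exact Or.inr (Or.inl (congrArg Corner.idx h))
      · exact Or.inr (Or.inr (Or.inl (congrArg Corner.idx h)))
      · exact Or.inr (Or.inr (Or.inr (congrArg Corner.idx h)))
  have hc0 : 0 < (1 - t) * p + t * q := by
    rcases eq_or_lt_of_le ht with h | h
    · rw [← h]; linarith
    · have := mul_pos h hq
      have := mul_nonneg (sub_nonneg.2 ht1) hp.le
      linarith
  have hx0 : 0 ≤ (1 - t) * (1 - p) := mul_nonneg (by linarith) (by linarith)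
  have he0 : 0 ≤ t * (1 - q) := mul_nonneg ht (by linarith)
  have hsum : (1 - t) * p + t * q + (1 - t) * (1 - p) + t * (1 - q) = 1 := by ring
  have hxe0 : 0 < (1 - t) * (1 - p) + t * (1 - q) := by
    rcases eq_or_lt_of_le ht with h | h
    · rw [← h]; linarith
    · have := mul_pos h (sub_pos.2 hq1); linarith
  refine ⟨⟨bt, fun w => ?_, ?_, fun w => ?_⟩, fun s hs hs0 => ?_⟩
  · rcases hidx w with h | h | h | h <;> rw [h] <;> first | rw [bt] | rw [bc] | rw [bx] | rw [be]
    exacts [hc0.le, hx0, he0]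
  · rw [c.sum_fin_four, bt]
    rcases hxe with ⟨rfl, rfl⟩ | ⟨rfl, rfl⟩ <;> rw [bc, bx, be] <;> ring
  · rcases hidx w with h | h | h | h <;> rw [h] <;> first | rw [bt] | rw [bc] | rw [bx] | rw [be]
    · exact one_pos
    all_goals linarith
  · rcases hall s hs with rfl | rfl | rfl
    · rw [bc] at hs0; linarith
    · left
      rw [bx] at hs0
      have : t = 1 := by
        rcases mul_eq_zero.1 hs0 with h | h <;> linarith
      exact ⟨rfl, by rw [hb, this]; simp⟩
    · right
      rw [be] at hs0
      have : t = 0 := by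
        rcases mul_eq_zero.1 hs0 with h | h <;> linarith
      exact ⟨rfl, by rw [hb, this]; simp⟩

namespace SimpleNormalCurve

variable {T : Type*} {τ : IdealTriangulation T} (γ : SimpleNormalCurve τ)

theorem startPt_eq (j : Fin (γ.n + 1)) : ∃ p : ℝ, 0 < p ∧ p < 1 ∧
    γ.startPt j = p • (γ.arc j).corner.point + (1 - p) • (γ.arc j).exit.point := by
  obtain ⟨a, b, ha, hb, hab, h⟩ := γ.startPt_mem j
  rcases (γ.arc j).exit_entry with ⟨-, h1, h2⟩ | ⟨-, h1, h2⟩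
  · rw [h2, Corner.prev_next, Corner.prev_prev] at h
    refine ⟨a, ha, by linarith, ?_⟩
    rw [← h, h1, ← hab, add_sub_cancel_left]
  · rw [h2, Corner.next_prev, Corner.next_next] at h
    refine ⟨b, hb, by linarith, ?_⟩
    rw [← h, h1, ← hab, add_sub_cancel_right, add_comm]

theorem endPt_eq (j : Fin (γ.n + 1)) : ∃ q : ℝ, 0 < q ∧ q < 1 ∧
    γ.endPt j = q • (γ.arc j).corner.point + (1 - q) • (γ.arc j).entry.point := by
  obtain ⟨a, b, ha, hb, hab, h⟩ := γ.endPt_mem j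
  rcases (γ.arc j).exit_entry with ⟨-, h1, h2⟩ | ⟨-, h1, h2⟩
  · rw [h1, Corner.next_prev, Corner.next_next] at h
    refine ⟨b, hb, by linarith, ?_⟩
    rw [← h, h2, ← hab, add_sub_cancel_right, add_comm]
  · rw [h1, Corner.prev_next, Corner.prev_prev] at h
    refine ⟨a, ha, by linarith, ?_⟩
    rw [← h, h2, ← hab, add_sub_cancel_left]

theorem chord_spec (j : Fin (γ.n + 1)) {b : Fin 4 → ℝ}
    (hb : b ∈ segment ℝ (γ.startPt j) (γ.endPt j)) :
    IsTrianglePoint (γ.arc j).corner.tri b ∧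
      ∀ s : Side T, s.tri = (γ.arc j).corner.tri → b s.idx = 0 →
        (s = (γ.arc j).exit ∧ b = γ.endPt j) ∨ (s = (γ.arc j).entry ∧ b = γ.startPt j) := by
  obtain ⟨p, hp, hp1, hP⟩ := γ.startPt_eq j
  obtain ⟨q, hq, hq1, hQ⟩ := γ.endPt_eq j
  obtain ⟨u, t, hu, ht, hut, h⟩ := hb
  have hu' : u = 1 - t := by linarith
  refine _root_.chord_spec ?_ hp hp1 hq hq1 ht (by linarith) hP hQ (by rw [← h, hu'])
  rcases (γ.arc j).exit_entry with ⟨-, h1, h2⟩ | ⟨-, h1, h2⟩ <;> simp [h1, h2]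

/-- The gluing matches points by their weights at the common vertices, while the ends `next` and
`prev` of the side exchange their names. -/
theorem startPt_succ_eq (j : Fin (γ.n + 1)) : ∃ u v : ℝ, u + v = 1 ∧
    γ.endPt j = u • (γ.arc j).exit.next.point + v • (γ.arc j).exit.prev.point ∧
    γ.startPt (j + 1) = u • (τ.across (γ.arc j).exit).prev.point +
      v • (τ.across (γ.arc j).exit).next.point := by
  obtain ⟨u, v, -, -, huv, h⟩ := γ.endPt_mem j
  refine ⟨u, v, huv, h.symm, ?_⟩
  funext w
  obtain ⟨w, rfl⟩ := (τ.glue (γ.arc j).exit.tet (γ.arc j).exit.idx).surjective w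
  rw [γ.startPt_succ, ← h]
  simp only [Pi.add_apply, Pi.smul_apply, Corner.point, τ.across_prev_idx, τ.across_next_idx,
    Pi.single_apply, EmbeddingLike.apply_eq_iff_eq]

/-- The cyclic numbering of the arcs by the natural numbers. -/
def cyc (i : ℕ) : Fin (γ.n + 1) := Fin.ofNat (γ.n + 1) i

theorem cyc_zero : γ.cyc 0 = 0 := rfl

theorem cyc_val (j : Fin (γ.n + 1)) : γ.cyc j = j := Fin.ext (Nat.mod_eq_of_lt j.2)

theorem cyc_succ (i : ℕ) : γ.cyc (i + 1) = γ.cyc i + 1 := by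
  apply Fin.ext
  simp [cyc, Fin.ofNat, Fin.add_def]

theorem cyc_add_period (i : ℕ) : γ.cyc (i + (γ.n + 1)) = γ.cyc i := by
  apply Fin.ext
  simp [cyc, Fin.ofNat]

theorem cyc_ne {i j : ℕ} (h1 : i < j) (h2 : j < i + (γ.n + 1)) : γ.cyc i ≠ γ.cyc j := fun h => by
  have h3 : i ≡ j [MOD γ.n + 1] := congrArg Fin.val h
  have := (Nat.modEq_iff_dvd' h1.le).1 h3
  have := Nat.le_of_dvd (by omega) this
  omega

theorem sum_cyc {M : Type*} [AddCommMonoid M] (f : Fin (γ.n + 1) → M) :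
    ∑ i ∈ Finset.range (γ.n + 1), f (γ.cyc i) = ∑ j, f j := by
  rw [← Fin.sum_univ_eq_sum_range (fun i => f (γ.cyc i))]
  simp only [cyc_val]

end SimpleNormalCurve

/-! ## Development of a normal curve in the flat structure -/

namespace LadderStructure

variable {T : Type*} [Fintype T] {τ : IdealTriangulation T} (L : LadderStructure τ)
  (γ : SimpleNormalCurve τ)

/-- The lattice translation carried by the first `i` arcs of a curve. -/
def offset (i : ℕ) : ℤ × ℤ :=
  ∑ k ∈ Finset.range i, (L.transX (γ.arc (γ.cyc k)).exit,
    L.transY (γ.arc (γ.cyc k)).exit)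

theorem offset_succ (i : ℕ) : L.offset γ (i + 1) = L.offset γ i +
    (L.transX (γ.arc (γ.cyc i)).exit, L.transY (γ.arc (γ.cyc i)).exit) :=
  Finset.sum_range_succ _ _

theorem offset_add_period (i : ℕ) :
    L.offset γ (i + (γ.n + 1)) = L.offset γ i + L.offset γ (γ.n + 1) := by
  rw [add_comm i, offset, Finset.sum_range_add, add_comm]
  congr 1
  refine Finset.sum_congr rfl fun k _ => ?_
  rw [add_comm, γ.cyc_add_period]

def latticeVec (O : ℤ × ℤ) : ℂ := ⟨O.1, O.2⟩

theorem latticeVec_add (O O' : ℤ × ℤ) : latticeVec (O + O') = latticeVec O + latticeVec O' := by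
  apply Complex.ext <;> simp [latticeVec]

theorem latticeVec_trans (s : Side T) : latticeVec (L.transX s, L.transY s) = L.trans s := rfl

/-- The successive crossing points of the sides, in the developed curve. -/
def crossPt (i : ℕ) : ℂ := latticeVec (L.offset γ i) +
  L.chartMap (γ.arc (γ.cyc i)).corner.tri (γ.startPt (γ.cyc i))

theorem tri_succ (j : Fin (γ.n + 1)) :
    (γ.arc (j + 1)).corner.tri = (τ.across (γ.arc j).exit).tri := by
  rw [γ.closed, NormalArc.entry_tri]

/-- The end of one chord and the start of the next are the same point in two charts that differ by
the translation added to the offset. The coefficients sum to 1, so an affine combination is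
translated as a whole. -/
theorem crossPt_succ (i : ℕ) : L.crossPt γ (i + 1) = latticeVec (L.offset γ i) +
    L.chartMap (γ.arc (γ.cyc i)).corner.tri (γ.endPt (γ.cyc i)) := by
  rw [crossPt, offset_succ, latticeVec_add, latticeVec_trans, γ.cyc_succ, tri_succ]
  obtain ⟨u, v, huv, h1, h2⟩ := γ.startPt_succ_eq (γ.cyc i)
  rw [h1, h2]
  set s := (γ.arc (γ.cyc i)).exit with hs
  rw [← (γ.arc (γ.cyc i)).exit_tri, ← hs]
  have a1 : L.chartMap s.tri s.next.point = L.chart s.next := L.chartMap_point s.next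
  have a2 : L.chartMap s.tri s.prev.point = L.chart s.prev := L.chartMap_point s.prev
  have a3 : L.chartMap (τ.across s).tri (τ.across s).next.point = L.chart (τ.across s).next :=
    L.chartMap_point (τ.across s).next
  have a4 : L.chartMap (τ.across s).tri (τ.across s).prev.point = L.chart (τ.across s).prev :=
    L.chartMap_point (τ.across s).prev
  rw [map_add, map_add, map_smul, map_smul, map_smul, map_smul, a1, a2, a3, a4, L.chart_next s,
    L.chart_prev s]
  have huv' : (u : ℂ) + v = 1 := by exact_mod_cast huv
  simp only [Complex.real_smul]
  linear_combination (- L.trans s) * huv'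

theorem crossPt_add_period (i : ℕ) : L.crossPt γ (i + (γ.n + 1)) =
    L.crossPt γ i + latticeVec (L.offset γ (γ.n + 1)) := by
  rw [crossPt, crossPt, γ.cyc_add_period, offset_add_period, latticeVec_add]
  ring

/-- The horizontal part of the offset determines the ladder. Two lifts in the same column therefore
belong to the same stack, as `eq_or_adjacent` requires. -/
theorem ladder_offset (i : ℕ) : (L.ladderSucc ^ (L.offset γ i).1)
    (L.ladder (γ.arc (0 : Fin (γ.n + 1))).corner.tri) =
      L.ladder (γ.arc (γ.cyc i)).corner.tri := by
  induction i with
  | zero => simp [offset, γ.cyc_zero]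
  | succ i ih =>
    rw [offset_succ, γ.cyc_succ, tri_succ]
    set s := (γ.arc (γ.cyc i)).exit with hs
    rw [← (γ.arc (γ.cyc i)).exit_tri, ← hs] at ih
    show (L.ladderSucc ^ ((L.offset γ i).1 + L.transX s)) _ = _
    rw [add_comm, zpow_add, Equiv.Perm.mul_apply, ih]
    by_cases hp : L.pole s
    · by_cases hu : L.pos s
      · rw [L.transX_up hp hu, L.ladder_across_up hp hu, zpow_one]
      · rw [L.transX_down hp hu, zpow_neg_one, Equiv.Perm.inv_eq_iff_eq, L.ladder_across_down hp hu]
    · rw [L.transX_rung hp, L.ladder_across hp]; simp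

theorem mem_segment_crossPt {i : ℕ} {z : ℂ}
    (hz : z ∈ segment ℝ (L.crossPt γ i) (L.crossPt γ (i + 1))) :
    ∃ b ∈ segment ℝ (γ.startPt (γ.cyc i)) (γ.endPt (γ.cyc i)),
      z = latticeVec (L.offset γ i) + L.chartMap (γ.arc (γ.cyc i)).corner.tri b := by
  obtain ⟨u, v, hu, hv, huv, h⟩ := hz
  refine ⟨_, ⟨u, v, hu, hv, huv, rfl⟩, ?_⟩
  rw [← h, crossPt_succ, crossPt, map_add, map_smul, map_smul]
  have huv' : (u : ℂ) + v = 1 := by exact_mod_cast huv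
  simp only [Complex.real_smul]
  linear_combination latticeVec (L.offset γ i) * huv'

theorem chords_disjoint {i j : ℕ} (h1 : i < j) (h2 : j < i + (γ.n + 1)) {b b' : Fin 4 → ℝ}
    (hb : b ∈ segment ℝ (γ.startPt (γ.cyc i)) (γ.endPt (γ.cyc i)))
    (hb' : b' ∈ segment ℝ (γ.startPt (γ.cyc j)) (γ.endPt (γ.cyc j)))
    (ht : (γ.arc (γ.cyc i)).corner.tri = (γ.arc (γ.cyc j)).corner.tri) :
    L.chartMap (γ.arc (γ.cyc i)).corner.tri b ≠
      L.chartMap (γ.arc (γ.cyc j)).corner.tri b' := fun h => by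
  have h3 := (γ.chord_spec _ hb).1
  have h4 := (γ.chord_spec _ hb').1
  rw [← ht] at h h4
  have := L.chartMap_injOn h3 h4 h
  subst this
  exact Set.disjoint_left.1 (γ.embedded _ _ (γ.cyc_ne h1 h2) ht) hb hb'

/-- A common point of two developed chords lies in one lifted triangle or on a common side of two.
In the second case the point is an end of the first chord, and the neighbouring chord of the curve
lies in the other triangle. Both cases reduce to the embeddedness of the curve inside a triangle. -/
theorem crossPt_disjoint (h0 : (L.offset γ (γ.n + 1)).1 ≠ 0) {i j : ℕ} (h1 : i + 2 ≤ j)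
    (h2 : j + 1 ≤ i + (γ.n + 1)) :
    Disjoint (segment ℝ (L.crossPt γ i) (L.crossPt γ (i + 1)))
      (segment ℝ (L.crossPt γ j) (L.crossPt γ (j + 1))) := by
  rw [Set.disjoint_left]
  intro z hz hz'
  obtain ⟨b, hb, hzb⟩ := L.mem_segment_crossPt γ hz
  obtain ⟨b', hb', hzb'⟩ := L.mem_segment_crossPt γ hz'
  have hc := γ.chord_spec _ hb
  have hc' := γ.chord_spec _ hb'
  have hl : (L.ladderSucc ^ ((L.offset γ j).1 - (L.offset γ i).1))
      (L.ladder (γ.arc (γ.cyc i)).corner.tri) =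
      L.ladder (γ.arc (γ.cyc j)).corner.tri := by
    rw [← L.ladder_offset γ i, ← L.ladder_offset γ j, ← Equiv.Perm.mul_apply, ← zpow_add,
      sub_add_cancel]
  have heq : latticeVec (L.offset γ i) + L.chartMap (γ.arc (γ.cyc i)).corner.tri b =
    latticeVec (L.offset γ j) + L.chartMap (γ.arc (γ.cyc j)).corner.tri b' :=
    hzb.symm.trans hzb'
  rcases L.eq_or_adjacent hc.1 hc'.1 hl (congrArg Complex.re heq) (congrArg Complex.im heq) with
    ⟨h3, h4⟩ | ⟨s, h3, h4, h5, h6⟩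
  · rw [h4] at heq
    exact L.chords_disjoint γ (by omega) (by omega) hb hb' h3 (add_left_cancel heq)
  · rcases hc.2 s h3 h4 with ⟨h7, h8⟩ | ⟨h7, h8⟩
    · rw [h7] at h5 h6
      have ht := h5
      rw [← tri_succ, ← γ.cyc_succ] at ht
      rw [← offset_succ] at h6
      have hz1 : z = L.crossPt γ (i + 1) := by rw [hzb, h8, crossPt_succ]
      rw [hz1, crossPt, ← h6] at hzb'
      exact L.chords_disjoint γ (show i + 1 < j by omega) (by omega) (left_mem_segment ℝ _ _) hb' ht
        (add_left_cancel hzb')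
    -- The point is the start of chord `i`; `k` is the index of the preceding chord, taken one
    -- period later so that it is not below `j`.
    · obtain ⟨k, hk⟩ : ∃ k, i + (γ.n + 1) = k + 1 := ⟨i + γ.n, rfl⟩
      have e1 : γ.cyc (k + 1) = γ.cyc i := by rw [← hk, γ.cyc_add_period]
      have e2 : τ.across (γ.arc (γ.cyc i)).entry = (γ.arc (γ.cyc k)).exit := by
        rw [← e1, γ.cyc_succ, ← γ.closed, τ.across_across]
      have e3 : (γ.arc (γ.cyc i)).entry =
          τ.across (γ.arc (γ.cyc k)).exit := by rw [← e2, τ.across_across]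
      rw [h7, e2, NormalArc.exit_tri] at h5
      have e4 : L.offset γ k = L.offset γ j + L.offset γ (γ.n + 1) := by
        have := L.offset_add_period γ i
        rw [hk, offset_succ] at this
        rw [h6, h7, e3, transX_across, transY_across]
        have e5 : ((-L.transX (γ.arc (γ.cyc k)).exit,
          -L.transY (γ.arc (γ.cyc k)).exit) : ℤ × ℤ) =
          -(L.transX (γ.arc (γ.cyc k)).exit,
          L.transY (γ.arc (γ.cyc k)).exit) := rfl
        rw [e5]
        rw [← eq_sub_iff_add_eq] at this
        rw [this]; abel
      -- If `j` is this preceding chord itself, the two lifts differ by the period, which would then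
      -- vanish.
      rcases eq_or_lt_of_le (show j ≤ k by omega) with rfl | hjk
      · exact h0 (by
          have := left_eq_add.1 e4
          rw [this]; rfl)
      · have hz1 : L.crossPt γ (k + 1) = z + latticeVec (L.offset γ (γ.n + 1)) := by
          rw [← hk, crossPt_add_period, hzb, h8, crossPt]
        rw [crossPt_succ, e4, latticeVec_add, hzb'] at hz1
        refine L.chords_disjoint γ hjk (by omega) hb' (right_mem_segment ℝ _ _) h5.symm ?_
        linear_combination -hz1

end LadderStructure
end

noncomputable section
open scoped Classical

/-! ## The turning angle of a normal curve crossing the ladderpoles -/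

/-! ### Arguments of quotients in a half-plane. -/

namespace Complex

theorem arg_pos_of_im_pos {z : ℂ} (h : 0 < z.im) : 0 < arg z :=
  lt_of_le_of_ne (arg_nonneg_iff.2 h.le) fun h0 =>
    h.ne' (arg_eq_zero_iff.1 h0.symm).2

theorem arg_lt_pi_of_im_pos {z : ℂ} (h : 0 < z.im) : arg z < Real.pi :=
  arg_lt_pi_iff.2 (Or.inr h.ne')

/-- Arguments in the upper half-plane lie in `(0, π)`, so their differences lie in `(-π, π)` and no
multiple of `2π` appears. -/
theorem arg_div_of_im_pos {z w : ℂ} (hz : 0 < z.im) (hw : 0 < w.im) :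
    w / z ∈ slitPlane ∧ arg (w / z) = arg w - arg z := by
  have z0 : z ≠ 0 := fun h => by simp [h] at hz
  have w0 : w ≠ 0 := fun h => by simp [h] at hw
  have h1 := arg_pos_of_im_pos hz
  have h2 := arg_pos_of_im_pos hw
  have h3 := arg_lt_pi_of_im_pos hz
  have h4 := arg_lt_pi_of_im_pos hw
  have hi : arg z⁻¹ = - arg z := by rw [arg_inv, if_neg h3.ne]
  have ha : arg (w / z) = arg w - arg z := by
    rw [div_eq_mul_inv, arg_mul w0 (inv_ne_zero z0), hi, sub_eq_add_neg]
    rw [hi]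
    constructor <;> linarith
  exact ⟨mem_slitPlane_iff_arg.2 ⟨by rw [ha]; linarith, div_ne_zero w0 z0⟩, ha⟩

theorem arg_one_add_mul_I (a : ℝ) : arg (1 + a * I) = Real.arctan a := by
  have h : |arg (1 + a * I)| < Real.pi / 2 := abs_arg_lt_pi_div_two_iff.2 (Or.inl (by simp))
  have h1 := tan_arg (1 + a * I)
  rw [← Real.arctan_tan (neg_lt_of_abs_lt h) (lt_of_abs_lt h), h1]
  simp

theorem one_add_mul_I_ne_zero (a : ℝ) : (1 + a * I : ℂ) ≠ 0 := fun h => by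
  have := congrArg re h
  simp at this

theorem arg_I_mul_one_add (a : ℝ) : arg (I * (1 + a * I)) = Real.pi / 2 + Real.arctan a := by
  have := Real.neg_pi_div_two_lt_arctan a
  have := Real.arctan_lt_pi_div_two a
  have := Real.pi_pos
  rw [arg_mul I_ne_zero (one_add_mul_I_ne_zero a), arg_I, arg_one_add_mul_I]
  rw [arg_I, arg_one_add_mul_I]
  constructor <;> linarith

theorem arg_one_add_div (a b : ℝ) (h : a < b) : 0 < ((1 + b * I) / (1 + a * I) : ℂ).im ∧
    arg ((1 + b * I) / (1 + a * I)) = Real.arctan b - Real.arctan a := by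
  have h1 := arg_div_of_im_pos (z := I * (1 + a * I)) (w := I * (1 + b * I)) (by simp) (by simp)
  have h2 : I * (1 + b * I) / (I * (1 + a * I)) = (1 + b * I) / (1 + a * I) :=
    mul_div_mul_left _ _ I_ne_zero
  rw [h2, arg_I_mul_one_add, arg_I_mul_one_add] at h1
  have h3 : arg ((1 + b * I) / (1 + a * I)) = Real.arctan b - Real.arctan a := by
    rw [h1.2]; ring
  refine ⟨?_, h3⟩
  have h4 := Real.arctan_strictMono h
  have h5 : (0 : ℝ) ≤ ((1 + b * I) / (1 + a * I) : ℂ).im := arg_nonneg_iff.1 (by rw [h3]; linarith)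
  refine lt_of_le_of_ne h5 fun h6 => ?_
  rcases mem_slitPlane_iff.1 h1.1 with h7 | h7
  · have := arg_eq_zero_iff.2 ⟨h7.le, h6.symm⟩
    rw [h3] at this; linarith
  · exact h7 h6.symm

theorem arg_div_mul_I (a d : ℝ) (hd : 0 < d) : 0 < (-(1 + a * I) / (d * I) : ℂ).im ∧
    arg (-(1 + a * I) / (d * I)) = Real.pi / 2 + Real.arctan a := by
  have h : (-(1 + a * I) / (d * I) : ℂ) = (d⁻¹ : ℝ) * (I * (1 + a * I)) := by
    have hd0 : (d : ℂ) ≠ 0 := by exact_mod_cast hd.ne'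
    have := I_ne_zero
    push_cast
    field_simp
    linear_combination (-(1 + a * I)) * I_sq
  rw [h, arg_real_mul _ (inv_pos.2 hd), arg_I_mul_one_add]
  refine ⟨?_, rfl⟩
  rw [im_ofReal_mul]
  simp [hd]

theorem arg_mul_I_div (a d : ℝ) (hd : 0 < d) : 0 < (d * I / (1 + a * I) : ℂ).im ∧
    arg (d * I / (1 + a * I)) = Real.pi / 2 - Real.arctan a := by
  have h : (d * I / (1 + a * I) : ℂ) = -((-(1 + a * I) / (d * I))⁻¹) := by
    rw [inv_div, neg_eq_neg_one_mul, div_neg]; ring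
  have h1 := arg_div_mul_I a d hd
  have h2 : (d * I / (1 + a * I) : ℂ) = d * ((1 : ℝ) * I / (1 + a * I)) := by push_cast; ring
  have h3 : (1 + a * I : ℂ)⁻¹ * (1 + a ^ 2 : ℝ) = 1 + (-a : ℝ) * I := by
    have := one_add_mul_I_ne_zero a
    field_simp
    push_cast
    linear_combination a ^ 2 * I_sq
  have h4 : (0 : ℝ) < 1 + a ^ 2 := by positivity
  have h5 : (d * I / (1 + a * I) : ℂ) = (d * (1 + a ^ 2)⁻¹ : ℝ) * (I * (1 + (-a : ℝ) * I)) := by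
    rw [← h3]
    have : (1 + a ^ 2 : ℂ) ≠ 0 := by exact_mod_cast h4.ne'
    push_cast
    field_simp
  have h6 : 0 < d * (1 + a ^ 2)⁻¹ := by positivity
  rw [h5, arg_real_mul _ h6, arg_I_mul_one_add, Real.arctan_neg]
  refine ⟨?_, by ring⟩
  rw [im_ofReal_mul]
  simpa using h6

end Complex

/-! ### Euclidean angles of the charts and the turning of developed curves. -/

namespace LadderStructure

open Complex

variable {T : Type*} [Fintype T] {τ : IdealTriangulation T} (L : LadderStructure τ)

/-- The vector of a side in the chart of its triangle. -/
def edge (s : Side T) : ℂ := L.chart s.prev - L.chart s.next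

theorem edge_across (s : Side T) : L.edge (τ.across s) = - L.edge s := by
  rw [edge, edge, L.chart_next s, L.chart_prev s]; ring

/-- A normal form for both kinds of triangles: those with the ladderpole segment on the left are
turned by `σ = -1`, which cancels in quotients of edges. Here `a` and `a + d` are the slopes of the
two rungs, and `d` is the length of the segment. -/
theorem edge_poleSide (A : T × Fin 4) : ∃ σ a d : ℝ, σ ≠ 0 ∧ 0 < d ∧
    L.edge (L.poleSide A) = σ * (d * I) ∧ L.edge (L.poleSide A).prev = σ * (1 + a * I) ∧
    L.edge (L.poleSide A).next = - (σ * (1 + (a + d : ℝ) * I)) := by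
  have hbl := L.chartX_leftBot A
  have htl := L.chartX_leftTop A
  have hbr := L.chartX_rightBot A
  have htr := L.chartX_rightTop A
  by_cases h : L.isRight A
  · have h1 := L.chartY_rightTop h
    rw [L.leftBot_right h] at hbl
    rw [L.rightBot_right h] at hbr h1
    rw [L.rightTop_right h] at htr h1
    set P := L.poleSide A
    refine ⟨1, L.chartY P.next - L.chartY P, L.segLen (τ.vertex P.next), one_ne_zero,
      L.segLen_pos _, ?_, ?_, ?_⟩ <;> apply Complex.ext <;>
      simp [edge, chart, hbl, hbr, htr, h1, Corner.next_prev, Corner.prev_next, Corner.next_next,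
        Corner.prev_prev]
    ring
  · have h1 := L.chartY_leftTop h
    rw [L.leftBot_left h] at hbl h1
    rw [L.leftTop_left h] at htl h1
    rw [L.rightBot_left h] at hbr
    set P := L.poleSide A
    refine ⟨-1, L.chartY P - L.chartY P.next, L.segLen (τ.vertex P.prev), by norm_num,
      L.segLen_pos _, ?_, ?_, ?_⟩ <;> apply Complex.ext <;>
      simp [edge, chart, hbl, hbr, htl, h1, Corner.next_prev, Corner.prev_next, Corner.next_next,
        Corner.prev_prev]
    ring

/-- The Euclidean angle at a corner of a triangle in its chart. -/
def flatAngle (c : Corner T) : ℝ := arg (- L.edge c.next / L.edge c.prev)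

/-- The angles of a degenerate flat structure, with vanishing slopes of the rungs and
vanishing lengths of the ladderpole segments. -/
def squareAngle (c : Corner T) : ℝ := if L.pole c then 0 else Real.pi / 2

def slopeAngle (s : Side T) : ℝ :=
  if L.pole s then 0 else Real.arctan ((L.edge s).im / (L.edge s).re)

theorem slopeAngle_across (s : Side T) : L.slopeAngle (τ.across s) = L.slopeAngle s := by
  rw [slopeAngle, slopeAngle, edge_across, L.pole_across, neg_im, neg_re, neg_div_neg_eq]

/-- One side is vertical, so the angle opposite it is the difference of the inclinations of the
rungs, and the other two are `π/2` plus or minus an inclination. A slope is seen equally from both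
sides of a rung, so the correction is a jump-free coboundary. -/
theorem flatAngle_eq (c : Corner T) : 0 < (- L.edge c.next / L.edge c.prev).im ∧
    L.flatAngle c = L.squareAngle c + (L.slopeAngle c.next - L.slopeAngle c.prev) := by
  obtain ⟨σ, a, d, hσ, hd, h1, h2, h3⟩ := L.edge_poleSide c.tri
  have hP := L.pole_poleSide c.tri
  have hc := Corner.eq_of_tri_eq (L.poleSide_tri c.tri).symm
  set P := L.poleSide c.tri
  have hσ' : (σ : ℂ) ≠ 0 := by exact_mod_cast hσ
  have hn := L.pole_next _ hP
  have hp := L.pole_prev _ hP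
  have s1 : L.slopeAngle P = 0 := if_pos hP
  have s2 : L.slopeAngle P.prev = Real.arctan a := by
    rw [slopeAngle, if_neg hp, h2]
    congr 1
    simp
    field_simp
  have s3 : L.slopeAngle P.next = Real.arctan (a + d) := by
    rw [slopeAngle, if_neg hn, h3]
    congr 1
    simp
    field_simp
  have q1 : L.squareAngle P = 0 := if_pos hP
  have q2 : L.squareAngle P.next = Real.pi / 2 := if_neg hn
  have q3 : L.squareAngle P.prev = Real.pi / 2 := if_neg hp
  rw [flatAngle]
  rcases hc with h | h | h
  · rw [h, q1, s2, s3, h2, h3, neg_neg, mul_div_mul_left _ _ hσ']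
    have := arg_one_add_div a (a + d) (by linarith)
    exact ⟨this.1, by rw [this.2]; ring⟩
  · rw [h, q2, Corner.next_prev, Corner.next_next, s1, s2, h1, h2, ← mul_neg,
      mul_div_mul_left _ _ hσ']
    have := arg_div_mul_I a d hd
    exact ⟨this.1, by rw [this.2]; ring⟩
  · rw [h, q3, Corner.prev_next, Corner.prev_prev, s1, s3, h1, h3, neg_div_neg_eq,
      mul_div_mul_left _ _ hσ']
    have := arg_mul_I_div (a + d) d hd
    exact ⟨this.1, by rw [this.2]; ring⟩

variable (γ : SimpleNormalCurve τ)

/-- The vectors of the arcs of a normal curve in the charts of their triangles. -/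
def arcVec (j : Fin (γ.n + 1)) : ℂ :=
  L.chartMap (γ.arc j).corner.tri (γ.endPt j) - L.chartMap (γ.arc j).corner.tri (γ.startPt j)

theorem crossPt_succ_sub (i : ℕ) :
    L.crossPt γ (i + 1) - L.crossPt γ i = L.arcVec γ (γ.cyc i) := by
  rw [crossPt_succ, crossPt, arcVec]; ring

/-- An arc crosses both sides from right to left, so the angles it makes with them lie in `(0, π)`.
Their difference is the angle between the two sides at the corner cut off, with the sign of the
turn. -/
theorem arcVec_spec (j : Fin (γ.n + 1)) :
    0 < (L.arcVec γ j / L.edge (γ.arc j).entry).im ∧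
    0 < (L.arcVec γ j / - L.edge (γ.arc j).exit).im ∧
    arg (L.arcVec γ j / L.edge (γ.arc j).entry) - arg (L.arcVec γ j / - L.edge (γ.arc j).exit) =
      if (γ.arc j).left then L.flatAngle (γ.arc j).corner else - L.flatAngle (γ.arc j).corner := by
  obtain ⟨p, hp, hp1, hP⟩ := γ.startPt_eq j
  obtain ⟨q, hq, hq1, hQ⟩ := γ.endPt_eq j
  have him := (L.flatAngle_eq (γ.arc j).corner).1
  have hv : L.arcVec γ j = (1 - q : ℝ) * (L.chart (γ.arc j).entry - L.chart (γ.arc j).corner) -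
      (1 - p : ℝ) * (L.chart (γ.arc j).exit - L.chart (γ.arc j).corner) := by
    have a1 : L.chartMap (γ.arc j).corner.tri (γ.arc j).entry.point = L.chart (γ.arc j).entry := by
      rw [← NormalArc.entry_tri]; exact L.chartMap_point _
    have a2 : L.chartMap (γ.arc j).corner.tri (γ.arc j).exit.point = L.chart (γ.arc j).exit := by
      rw [← NormalArc.exit_tri]; exact L.chartMap_point _
    rw [arcVec, hP, hQ, map_add, map_add, map_smul, map_smul, map_smul, map_smul, a1, a2,
      L.chartMap_point]
    simp only [Complex.real_smul]
    push_cast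
    ring
  set c := (γ.arc j).corner
  set e := L.edge c.prev with he
  set z := - L.edge c.next / e with hz
  have e0 : e ≠ 0 := fun h => by rw [hz, h, div_zero] at him; simp at him
  have z0 : z ≠ 0 := fun h => by rw [h] at him; simp at him
  have e1 : L.chart c.next - L.chart c = e := by
    rw [he, edge, Corner.prev_next, Corner.prev_prev]
  have e2 : L.chart c.prev - L.chart c = z * e := by
    rw [hz, div_mul_cancel₀ _ e0, edge, Corner.next_prev, Corner.next_next]; ring
  have e3 : L.edge c.next = - (z * e) := by rw [hz, div_mul_cancel₀ _ e0]; ring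
  have zi : (z⁻¹).im < 0 := by
    rw [inv_im]
    exact div_neg_of_neg_of_pos (by linarith) (normSq_pos.2 z0)
  have hf : L.flatAngle c = arg z := rfl
  -- With the corner as origin, the two sides at it have directions `e` and `z * e`. The arc is a
  -- difference of positive multiples of these, and `z` has positive imaginary part.
  rcases (γ.arc j).exit_entry with ⟨hl, h1, h2⟩ | ⟨hl, h1, h2⟩
  · rw [h1, h2, e1, e2] at hv
    rw [h1, h2, ← he, e3, neg_neg, hv, hl, if_pos rfl, hf]
    have f1 : ((1 - q : ℝ) * (z * e) - (1 - p : ℝ) * e) / e =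
        (1 - q : ℝ) * z - (1 - p : ℝ) := by field_simp
    have f2 : ((1 - q : ℝ) * (z * e) - (1 - p : ℝ) * e) / (z * e) =
        (1 - q : ℝ) - (1 - p : ℝ) * z⁻¹ := by field_simp
    have g1 : 0 < ((1 - q : ℝ) * z - (1 - p : ℝ) : ℂ).im := by
      rw [sub_im, im_ofReal_mul, ofReal_im, sub_zero]
      exact mul_pos (by linarith) him
    have g2 : 0 < ((1 - q : ℝ) - (1 - p : ℝ) * z⁻¹ : ℂ).im := by
      rw [sub_im, im_ofReal_mul, ofReal_im, zero_sub, ← mul_neg]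
      exact mul_pos (by linarith) (by linarith)
    rw [f1, f2]
    refine ⟨g1, g2, ?_⟩
    rw [← (arg_div_of_im_pos g2 g1).2]
    congr 1
    rw [div_eq_iff (fun h => by rw [h] at g2; simp at g2)]
    field_simp
  · rw [h1, h2, e1, e2] at hv
    rw [h1, h2, ← he, e3, hv, hl, hf]
    have f1 : ((1 - q : ℝ) * e - (1 - p : ℝ) * (z * e)) / - (z * e) =
        (1 - p : ℝ) - (1 - q : ℝ) * z⁻¹ := by field_simp; ring
    have f2 : ((1 - q : ℝ) * e - (1 - p : ℝ) * (z * e)) / - e =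
        (1 - p : ℝ) * z - (1 - q : ℝ) := by field_simp; ring
    have g1 : 0 < ((1 - p : ℝ) * z - (1 - q : ℝ) : ℂ).im := by
      rw [sub_im, im_ofReal_mul, ofReal_im, sub_zero]
      exact mul_pos (by linarith) him
    have g2 : 0 < ((1 - p : ℝ) - (1 - q : ℝ) * z⁻¹ : ℂ).im := by
      rw [sub_im, im_ofReal_mul, ofReal_im, zero_sub, ← mul_neg]
      exact mul_pos (by linarith) (by linarith)
    rw [f1, f2]
    refine ⟨g2, g1, ?_⟩
    rw [← neg_sub, ← (arg_div_of_im_pos g2 g1).2]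
    simp only [Bool.false_eq_true, if_false]
    congr 2
    rw [div_eq_iff (fun h => by rw [h] at g2; simp at g2)]
    field_simp

/-- The Euclidean turning of the developed curve is the sum of its flat angles with signs, and it
vanishes by the Umlaufsatz. Square angles differ from flat angles by a jump-free coboundary. -/
theorem cornerTurn_squareAngle (h0 : (L.offset γ (γ.n + 1)).1 ≠ 0) :
    γ.cornerTurn L.squareAngle = 0 := by
  have hturn : ∀ i, L.arcVec γ (γ.cyc (i + 1)) / L.arcVec γ (γ.cyc i) ∈ slitPlane ∧
      arg (L.arcVec γ (γ.cyc (i + 1)) / L.arcVec γ (γ.cyc i)) =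
        arg (L.arcVec γ (γ.cyc (i + 1)) / L.edge (γ.arc (γ.cyc (i + 1))).entry) -
        arg (L.arcVec γ (γ.cyc i) / - L.edge (γ.arc (γ.cyc i)).exit) := fun i => by
    have h1 := (L.arcVec_spec γ (γ.cyc (i + 1))).1
    have h2 := (L.arcVec_spec γ (γ.cyc i)).2.1
    have h3 := arg_div_of_im_pos h2 h1
    have h4 : L.edge (γ.arc (γ.cyc (i + 1))).entry = - L.edge (γ.arc (γ.cyc i)).exit := by
      rw [γ.cyc_succ, ← γ.closed, edge_across]
    rw [h4] at h1 h3 ⊢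
    rwa [div_div_div_cancel_right₀ (fun h => by rw [h, div_zero] at h2; simp at h2)] at h3
  have h1 : γ.cornerTurn L.flatAngle = 0 := by
    have key := sum_turnArg_eq_zero (L.crossPt γ) (γ.n + 1)
      (latticeVec (L.offset γ (γ.n + 1)))
      (fun h => h0 (by
        have := congrArg re h
        simpa [latticeVec] using this)) (Nat.succ_pos _) (L.crossPt_add_period γ)
      (fun i h => by
        rw [crossPt_succ_sub] at h
        have := (L.arcVec_spec γ (γ.cyc i)).1
        rw [h, zero_div] at this
        simp at this)
      (fun i => by rw [crossPt_succ_sub, crossPt_succ_sub]; exact (hturn i).1)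
      (fun i j => L.crossPt_disjoint γ h0)
    simp only [turnArg, crossPt_succ_sub] at key
    -- The turn at each crossing point is measured against the common side of two arcs. Shifting the
    -- first terms by one index regroups the sum by arcs.
    rw [Finset.sum_congr rfl fun i _ => (hturn i).2, Finset.sum_sub_distrib,
      sum_range_shift (fun i => arg (L.arcVec γ (γ.cyc i) / L.edge (γ.arc (γ.cyc i)).entry))
        (γ.n + 1) (by have := γ.cyc_add_period 0; rw [zero_add] at this; rw [this]),
      ← Finset.sum_sub_distrib,
      γ.sum_cyc (fun j => arg (L.arcVec γ j / L.edge (γ.arc j).entry) -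
        arg (L.arcVec γ j / - L.edge (γ.arc j).exit))] at key
    rw [← key]
    exact Finset.sum_congr rfl fun j _ => ((L.arcVec_spec γ j).2.2).symm
  have h2 := γ.cornerTurn_add L.squareAngle
    (fun c => L.slopeAngle c.next - L.slopeAngle c.prev)
  rw [γ.cornerTurn_coboundary_eq_zero _ L.slopeAngle_across, add_zero] at h2
  rw [← h2, ← h1]
  congr 1
  funext c
  exact (L.flatAngle_eq c).2.symm

end LadderStructure

/-! ### Comparison of the veering angles with the square angles. -/

namespace IdealTriangulation

variable {T : Type*} [Fintype T] {τ : IdealTriangulation T} {α : T → Fin 3 → ℝ}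
  {out : T → Fin 4 → Bool}

/-- In each triangle, the angles `π, 0` at the ends of the ladderpole segment have to be averaged to
`π/2, π/2`. The direction of this transfer depends only on the common veering of the two ends, so it
is seen equally from both sides of the segment. -/
theorem angle_eq_squareAngle (hα : τ.IsVeering α) (hout : τ.IsTransverseTaut α out) :
    ∃ g : Side T → ℝ, (∀ s, g (τ.across s) = g s) ∧
      ∀ c, c.angle α = (ladderStructure hα hout).squareAngle c + (g c.next - g c.prev) := by
  have hpole : ∀ s, (ladderStructure hα hout).pole s ↔ τ.IsPoleSegment α s := fun s => Iff.rfl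
  refine ⟨fun s => if τ.IsPoleSegment α s then
    (if τ.LeftVeering α s.next then -(Real.pi / 2) else Real.pi / 2) else 0, fun s => ?_,
    fun c => ?_⟩
  · have h1 := isPoleSegment_iff hα s
    have h2 : τ.LeftVeering α (τ.across s).next ↔ τ.LeftVeering α s.prev :=
      leftVeering_congr (τ.vertex_across_next s)
    have h3 := isPoleSegment_across hα s
    simp only [h3, h2]
    by_cases h : τ.IsPoleSegment α s
    · simp only [if_pos h, h1.1 h]
    · simp only [if_neg h]
  · obtain ⟨w, hw, hw'⟩ : ∃ w : Corner T, w.tri = c.tri ∧ w.angle α = Real.pi := by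
      rcases exists_wide hα.1 c with h | h | h
      exacts [⟨c, rfl, h⟩, ⟨c.next, rfl, h⟩, ⟨c.prev, rfl, h⟩]
    have e1 := angle_next_of_wide hα.1 hw'
    have e2 := angle_prev_of_wide hα.1 hw'
    have n0 := not_isPoleSegment_of_wide hα hw'
    have p1 := isPoleSegment_prev_iff hα hw'
    have p2 := isPoleSegment_next_iff hα hw'
    have l1 := leftVeering_next hα hw'
    have l2 := not_leftVeering_prev hα hw'
    have hc := Corner.eq_of_tri_eq hw.symm
    simp only [LadderStructure.squareAngle, hpole]
    by_cases hl : τ.LeftVeering α w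
    · have p1 := p1.2 hl
      have p2 : ¬ τ.IsPoleSegment α w.next := fun h => p2.1 h hl
      rcases hc with h | h | h <;> rw [h] <;>
        simp [Corner.next_prev, Corner.prev_next, Corner.next_next, Corner.prev_prev, *]
    · have p1 : ¬ τ.IsPoleSegment α w.prev := fun h => hl (p1.1 h)
      have p2 := p2.2 hl
      rcases hc with h | h | h <;> rw [h] <;>
        simp [Corner.next_prev, Corner.prev_next, Corner.next_next, Corner.prev_prev, *]

/-- Curves crossing the ladderpoles a nonzero number of times have no turning with respect to a
veering structure. -/
theorem turningAngle_eq_zero (hα : τ.IsVeering α) (hout : τ.IsTransverseTaut α out)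
    (γ : SimpleNormalCurve τ)
    (h0 : ∑ j, (ladderStructure hα hout).transX (γ.arc j).exit ≠ 0) : γ.turningAngle α = 0 := by
  obtain ⟨g, hg, hα'⟩ := angle_eq_squareAngle hα hout
  have h1 : ((ladderStructure hα hout).offset γ (γ.n + 1)).1 ≠ 0 := by
    rw [← γ.sum_cyc] at h0
    rw [LadderStructure.offset, Prod.fst_sum]
    exact h0
  rw [SimpleNormalCurve.turningAngle_eq]
  simp only [hα']
  rw [γ.cornerTurn_add, γ.cornerTurn_coboundary_eq_zero g hg, add_zero]
  exact LadderStructure.cornerTurn_squareAngle _ γ h1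

end IdealTriangulation
end

noncomputable section
open scoped Classical

/-! ## Crossing numbers with the ladderpoles -/

namespace LadderStructure

variable {T : Type*} [Fintype T] {τ : IdealTriangulation T} (L : LadderStructure τ)

/-- The number of times that a chain crosses the ladderpoles in a set of cusps. -/
def crossing (K : Set τ.Cusp) : (Side T → ℤ) →+ ℤ where
  toFun x := ∑ s : Side T with L.pole s ∧ L.pos s ∧ τ.cusp s.tri ∈ K, x s
  map_zero' := by simp
  map_add' x y := Finset.sum_add_distrib

theorem crossing_apply (K : Set τ.Cusp) (x : Side T → ℤ) :
    L.crossing K x = ∑ s : Side T with L.pole s ∧ L.pos s ∧ τ.cusp s.tri ∈ K, x s := rfl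

theorem crossing_cross (K : Set τ.Cusp) (s : Side T) :
    L.crossing K (τ.cross s) = if τ.cusp s.tri ∈ K then L.transX s else 0 := by
  rw [crossing_apply]
  simp only [IdealTriangulation.cross, Pi.sub_apply, Finset.sum_sub_distrib, Pi.single_apply,
    Finset.sum_ite_eq', Finset.mem_filter, Finset.mem_univ, true_and, cusp_across, L.pole_across,
    L.pos_across]
  by_cases hK : τ.cusp s.tri ∈ K <;> by_cases hp : L.pole s <;> by_cases hu : L.pos s <;>
    simp [hK, hp, hu, L.transX_rung, L.transX_up, L.transX_down]

theorem cusp_rot (c : Corner T) : τ.cusp (τ.rot c).tri = τ.cusp c.tri := cusp_across c.next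

/-- The horizontal coordinates of a vertex in two successive charts around it differ by `transX`, so
the sum telescopes: a small loop crosses the ladderpoles zero times. -/
theorem sum_vertex_transX (K : Set τ.Cusp) (v : τ.Vertex) :
    ∑ c : Corner T with τ.vertex c = v, (if τ.cusp c.tri ∈ K then L.transX c.next else 0) = 0 := by
  have h : ∀ c : Corner T, (if τ.cusp c.tri ∈ K then L.transX c.next else 0) =
      (if τ.cusp c.tri ∈ K then L.chartX c else 0) -
        (if τ.cusp (τ.rot c).tri ∈ K then L.chartX (τ.rot c) else 0) := fun c => by
    rw [cusp_rot, ← (L.trans_spec c.next).1, Corner.next_prev, ← τ.rot_eq]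
    split_ifs <;> simp
  simp only [h]
  rw [Finset.sum_sub_distrib,
    τ.sum_vertex_rot (fun c => if τ.cusp c.tri ∈ K then L.chartX c else 0), sub_self]

theorem crossing_boundary (K : Set τ.Cusp) {x : Side T → ℤ} (hx : x ∈ τ.boundaries) :
    L.crossing K x = 0 := by
  have : τ.boundaries ≤ (L.crossing K).ker := by
    rw [IdealTriangulation.boundaries, AddSubgroup.closure_le]
    rintro _ ⟨v, rfl⟩
    show L.crossing K (τ.vertexLoop v) = 0
    rw [IdealTriangulation.vertexLoop, map_sum, ← L.sum_vertex_transX K v]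
    refine Finset.sum_congr rfl fun c _ => ?_
    rw [crossing_cross]; rfl
  exact this hx

theorem crossing_chain (K : Set τ.Cusp) (γ : SimpleNormalCurve τ) :
    L.crossing K γ.chain =
      ∑ j, if τ.cusp (γ.arc j).exit.tri ∈ K then L.transX (γ.arc j).exit else 0 := by
  rw [SimpleNormalCurve.chain, map_sum]
  simp only [crossing_cross]

/-- The number of times that a chain crosses a ladderpole. -/
theorem crossing_eq_sum (K : Set τ.Cusp) (x : Side T → ℤ) :
    L.crossing K x = ∑ p : L.Ladderpole with L.poleCusp p ∈ K,
      ∑ s : Side T with (L.pole s ∧ L.pos s) ∧ L.ladderpole s.next = p, x s := by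
  rw [crossing_apply, ← Finset.sum_fiberwise_of_maps_to
    (t := Finset.univ.filter fun p : L.Ladderpole => L.poleCusp p ∈ K)
    (g := fun s : Side T => L.ladderpole s.next)]
  · refine Finset.sum_congr rfl fun p hp => ?_
    rw [Finset.filter_filter]
    refine Finset.sum_congr (Finset.filter_congr fun s _ => ?_) fun _ _ => rfl
    rw [Finset.mem_filter] at hp
    constructor
    · tauto
    · rintro ⟨⟨h1, h2⟩, rfl⟩
      exact ⟨⟨h1, h2, hp.2⟩, rfl⟩
  · intro s hs
    rw [Finset.mem_filter] at hs ⊢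
    exact ⟨Finset.mem_univ _, hs.2.2.2⟩

theorem crossing_of_support (K : Set τ.Cusp) {x : Side T → ℤ} {c : τ.Cusp}
    (hx : ∀ s, x s ≠ 0 → τ.cusp s.tri = c) (m : ℤ)
    (hm : ∀ p : L.Ladderpole, L.poleCusp p = c →
      ∑ s : Side T with (L.pole s ∧ L.pos s) ∧ L.ladderpole s.next = p, x s = m) :
    L.crossing K x =
      if c ∈ K then m * (Finset.univ.filter fun p : L.Ladderpole => L.poleCusp p = c).card
      else 0 := by
  split_ifs with h
  · have h1 : L.crossing K x = L.crossing {c} x := by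
      rw [crossing_apply, crossing_apply]
      refine (Finset.sum_subset (fun s hs => ?_) fun s hs hs' => ?_).symm
      · rw [Finset.mem_filter] at hs ⊢
        obtain ⟨h0, h1, h2, rfl⟩ := hs
        exact ⟨h0, h1, h2, h⟩
      · by_contra h0
        rw [Finset.mem_filter] at hs hs'
        exact hs' ⟨hs.1, hs.2.1, hs.2.2.1, hx s h0⟩
    rw [h1, crossing_eq_sum]
    simp only [Set.mem_singleton_iff]
    rw [Finset.sum_congr rfl fun p hp => hm p (Finset.mem_filter.1 hp).2]
    simp [mul_comm]
  · rw [crossing_apply]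
    refine Finset.sum_eq_zero fun s hs => ?_
    by_contra h0
    exact h (hx s h0 ▸ (Finset.mem_filter.1 hs).2.2.2)

/-- Each ladder is matched with the ladderpole on its left. -/
theorem card_ladderpoles (c : τ.Cusp) :
    (Finset.univ.filter fun p : L.Ladderpole => L.poleCusp p = c).card =
      {l : L.Ladder | ∃ A, τ.cusp A = c ∧ L.ladder A = l}.ncard := by
  have h : {l : L.Ladder | ∃ A, τ.cusp A = c ∧ L.ladder A = l} =
      (Finset.univ.filter fun l : L.Ladder => L.ladderCusp l = c : Finset L.Ladder) := by
    ext l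
    obtain ⟨A, rfl⟩ : ∃ A, L.ladder A = l := Quot.exists_rep l
    simp only [Set.mem_ofPred_eq, Finset.coe_filter, Finset.mem_univ, true_and, ladderCusp_ladder]
    constructor
    · rintro ⟨B, rfl, h⟩
      have := congrArg L.ladderCusp h
      exact this.symm
    · rintro rfl
      exact ⟨A, rfl, rfl⟩
  rw [h, Set.ncard_coe_finset]
  refine (Finset.card_equiv L.leftPole fun l => ?_).symm
  simp [poleCusp_leftPole]

theorem card_ladderpoles_pos (c : τ.Cusp) :
    0 < (Finset.univ.filter fun p : L.Ladderpole => L.poleCusp p = c).card := by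
  obtain ⟨A, rfl⟩ : ∃ A, τ.cusp A = c := Quot.exists_rep c
  exact Finset.card_pos.2 ⟨L.leftPole (L.ladder A), by simp [poleCusp_leftPole]⟩

end LadderStructure
end

noncomputable section
open scoped Classical

/-! ## Deformation of a veering structure -/

/-- A pair of opposite edges has four ends, hence four corners in the truncation triangles. -/
theorem Corner.angle_pair_sum {T : Type*} [Fintype T] (X : Side T → ℝ) (c : Corner T) :
    c.angle (fun t j => ∑ s : Side T with s.tet = t ∧ oppPair s.tip s.idx = j, X s) =
      X c + X ⟨c.tet, c.idx, c.tip, c.ne.symm⟩ +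
        X ⟨c.tet, c.next.idx, c.prev.idx, fun h => c.next_ne_prev (Corner.ext rfl rfl h.symm)⟩ +
        X ⟨c.tet, c.prev.idx, c.next.idx, fun h => c.next_ne_prev (Corner.ext rfl rfl h)⟩ := by
  obtain ⟨t, a, b, hab⟩ := c
  have key : ∀ a b u v : Fin 4, b ≠ a → v ≠ u → (oppPair u v = oppPair a b ↔
      (u = a ∧ v = b) ∨ (u = b ∧ v = a) ∨ (u = ccw a b ∧ v = ccw a (ccw a b)) ∨
        (u = ccw a (ccw a b) ∧ v = ccw a b)) := by decide
  have hd : ∀ a b : Fin 4, b ≠ a → a ≠ ccw a b ∧ a ≠ ccw a (ccw a b) ∧ b ≠ ccw a b ∧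
      b ≠ ccw a (ccw a b) ∧ ccw a b ≠ ccw a (ccw a b) := by decide
  obtain ⟨d1, d2, d3, d4, d5⟩ := hd a b hab
  have hs : (Finset.univ.filter fun s : Side T => s.tet = t ∧ oppPair s.tip s.idx = oppPair a b) =
      {⟨t, a, b, hab⟩, ⟨t, b, a, hab.symm⟩, ⟨t, ccw a b, ccw a (ccw a b), d5.symm⟩,
        ⟨t, ccw a (ccw a b), ccw a b, d5⟩} := by
    ext ⟨t', u, v, huv⟩
    simp only [Finset.mem_filter, Finset.mem_univ, true_and, Finset.mem_insert,
      Finset.mem_singleton, Corner.mk.injEq]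
    rw [key a b u v hab huv]
    tauto
  show ∑ s : Side T with s.tet = t ∧ oppPair s.tip s.idx = oppPair a b, X s = _
  rw [hs, Finset.sum_insert, Finset.sum_insert, Finset.sum_insert, Finset.sum_singleton,
    add_assoc, add_assoc]
  · rfl
  all_goals
    simp only [Finset.mem_insert, Finset.mem_singleton, Corner.mk.injEq, not_or, not_and, true_and]
    tauto

namespace IdealTriangulation

variable {T : Type*} [Fintype T] {τ : IdealTriangulation T}

/-- The weight of the face of a tetrahedron containing a side in the angles determined by `X`. -/
def faceWeight (X : Side T → ℝ) (s : Side T) : ℝ :=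
  X ⟨s.tet, s.next.idx, s.idx, fun h => s.next_ne (Corner.ext rfl rfl h.symm)⟩ -
    X ⟨s.tet, s.prev.idx, s.idx, fun h => s.prev_ne (Corner.ext rfl rfl h.symm)⟩

/-- Passing to the other tetrahedron at the face negates `X` and exchanges the other two tips of the
face, so the difference is unchanged. -/
theorem faceWeight_across {X : Side T → ℝ} (hX : ∀ s, X (τ.across s) = - X s) (s : Side T) :
    faceWeight X (τ.across s) = faceWeight X s := by
  have h1 := hX ⟨s.tet, s.next.idx, s.idx, fun h => s.next_ne (Corner.ext rfl rfl h.symm)⟩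
  have h2 := hX ⟨s.tet, s.prev.idx, s.idx, fun h => s.prev_ne (Corner.ext rfl rfl h.symm)⟩
  have e1 : τ.across ⟨s.tet, s.next.idx, s.idx, fun h => s.next_ne (Corner.ext rfl rfl h.symm)⟩ =
      ⟨(τ.across s).tet, (τ.across s).prev.idx, (τ.across s).idx,
        fun h => (τ.across s).prev_ne (Corner.ext rfl rfl h.symm)⟩ :=
    Corner.ext rfl (τ.across_prev_idx s).symm rfl
  have e2 : τ.across ⟨s.tet, s.prev.idx, s.idx, fun h => s.prev_ne (Corner.ext rfl rfl h.symm)⟩ =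
      ⟨(τ.across s).tet, (τ.across s).next.idx, (τ.across s).idx,
        fun h => (τ.across s).next_ne (Corner.ext rfl rfl h.symm)⟩ :=
    Corner.ext rfl (τ.across_next_idx s).symm rfl
  rw [e1] at h1
  rw [e2] at h2
  rw [faceWeight, faceWeight, h1, h2]
  ring

/-- The deformation of the angles determined by an antisymmetric function on sides. -/
def pairSum (X : Side T → ℝ) : T → Fin 3 → ℝ :=
  fun t j => ∑ s : Side T with s.tet = t ∧ oppPair s.tip s.idx = j, X s

/-- Two of the other three corners occur directly in the two face weights. The third is minus the
sum of the remaining terms, because `X` sums to zero over the triangle at the tip `c.idx`. -/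
theorem angle_pairSum {X : Side T → ℝ} (hX : ∀ s, X s + X s.next + X s.prev = 0) (c : Corner T) :
    c.angle (pairSum X) = X c + (faceWeight X c.next - faceWeight X c.prev) := by
  have e : c.angle (pairSum X) = _ := Corner.angle_pair_sum X c
  rw [e]
  have h := hX ⟨c.tet, c.idx, c.tip, c.ne.symm⟩
  have key : ∀ a b : Fin 4, b ≠ a → (ccw b a = ccw a (ccw a b) ∧ ccw b (ccw a (ccw a b)) = ccw a b) ∧
      ccw a (ccw a (ccw a b)) = b := by decide
  obtain ⟨t, a, b, hab⟩ := c
  obtain ⟨⟨k1, k2⟩, k3⟩ := key a b hab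
  simp only [faceWeight, Corner.next, Corner.prev, k1, k2, k3] at h ⊢
  linarith

/-! ### Alternation of the ladders, and the weights of the deformation. -/

variable {α : T → Fin 3 → ℝ} {out : T → Fin 4 → Bool}

theorem out_tip_of_wide (hout : τ.IsTransverseTaut α out) {w : Corner T}
    (h : w.angle α = Real.pi) : out w.tet w.tip = out w.tet w.idx :=
  (hout.2 w.tet w.tip w.idx w.ne.symm).2 h

theorem exists_wide_corner (hα : τ.IsTaut α) (c : Corner T) :
    ∃ w : Corner T, w.angle α = Real.pi ∧ (c = w ∨ c = w.next ∨ c = w.prev) := by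
  rcases exists_wide hα c with h | h | h
  · exact ⟨c, h, Or.inl rfl⟩
  · exact ⟨c.next, h, Or.inr (Or.inr c.next_prev.symm)⟩
  · exact ⟨c.prev, h, Or.inr (Or.inl c.prev_next.symm)⟩

theorem out_tip_of_not_wide (hα : τ.IsTaut α) (hout : τ.IsTransverseTaut α out) {c : Corner T}
    (h : c.angle α ≠ Real.pi) : out c.tet c.tip = !out c.tet c.idx := by
  obtain ⟨w, hw, rfl | rfl | rfl⟩ := exists_wide_corner hα c
  · exact (h hw).elim
  · show out w.tet w.tip = !out w.tet w.next.idx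
    rw [out_next_of_wide hα hout hw, Bool.not_not]; exact out_tip_of_wide hout hw
  · show out w.tet w.tip = !out w.tet w.prev.idx
    rw [out_prev_of_wide hα hout hw, Bool.not_not]; exact out_tip_of_wide hout hw

/-- Across a rung, `out` at the side is negated and the veering of the end `next` is exchanged too,
since the ends of a rung veer oppositely. Hence `out` at the tip is constant along a ladder. -/
theorem out_tip_of_rung (hα : τ.IsVeering α) (hout : τ.IsTransverseTaut α out) {s : Side T}
    (hs : ¬ τ.IsPoleSegment α s) :
    out s.tet s.tip = true ↔ (out s.tet s.idx = true ↔ τ.LeftVeering α s.next) := by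
  obtain ⟨w, hw, rfl | rfl | rfl⟩ := exists_wide_corner hα.1 s
  · have := leftVeering_next hα hw
    rw [out_tip_of_wide hout hw]; tauto
  · rw [isPoleSegment_next_iff hα hw, not_not] at hs
    have h1 := not_leftVeering_prev hα hw
    rw [out_tip_of_not_wide hα.1 hout (angle_ne_pi (angle_next_of_wide hα.1 hw)),
      Corner.next_next]
    simp [h1]
  · rw [isPoleSegment_prev_iff hα hw] at hs
    rw [out_tip_of_not_wide hα.1 hout (angle_ne_pi (angle_prev_of_wide hα.1 hw)),
      Corner.prev_next]
    simp [hs]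

/-- Since `out` at the side is negated by `across`, `out` at the tip changes across a ladderpole,
and the ladders alternate. -/
theorem out_tip_of_pole (hα : τ.IsVeering α) (hout : τ.IsTransverseTaut α out) {s : Side T}
    (hs : τ.IsPoleSegment α s) : out s.tet s.tip = !out s.tet s.idx :=
  out_tip_of_not_wide hα.1 hout fun h => not_isPoleSegment_of_wide hα h hs

/-- The deformation opens the angles in the ladders (of the cusps in `J`) along which the
transverse orientation points outward through the bases of the triangles. -/
def ladderWeight (τ : IdealTriangulation T) (α : T → Fin 3 → ℝ) (out : T → Fin 4 → Bool)
    (J : Set τ.Cusp) (s : Side T) : ℝ :=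
  if τ.cusp s.tri ∈ J ∧ ¬ τ.IsPoleSegment α s ∧ out s.tet s.tip = true then
    (if out s.tet s.idx = true then -1 else 1) else 0

def poleWeight (τ : IdealTriangulation T) (α : T → Fin 3 → ℝ) (out : T → Fin 4 → Bool)
    (J : Set τ.Cusp) (s : Side T) : ℝ :=
  if τ.cusp s.tri ∈ J ∧ τ.IsPoleSegment α s ∧ out s.tet s.tip = true then
    (if τ.IsUpward α out s then 1 else -1) else 0

variable (J : Set τ.Cusp)

theorem ladderWeight_across (hα : τ.IsVeering α) (hout : τ.IsTransverseTaut α out) (s : Side T) :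
    τ.ladderWeight α out J (τ.across s) = - τ.ladderWeight α out J s := by
  have h1 := out_across hout s
  have h2 := isPoleSegment_across hα s
  rw [ladderWeight, ladderWeight, LadderStructure.cusp_across, h1, h2]
  by_cases hs : τ.IsPoleSegment α s
  · simp [hs]
  · have h3 := out_tip_of_rung hα hout hs
    have h4 := out_tip_of_rung hα hout (mt h2.1 hs)
    have h5 : τ.LeftVeering α (τ.across s).next ↔ τ.LeftVeering α s.prev :=
      leftVeering_congr (τ.vertex_across_next s)
    rw [isPoleSegment_iff hα] at hs
    have h6 : out (τ.across s).tet (τ.across s).tip = true ↔ out s.tet s.tip = true := by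
      rw [h3, h4, h5, h1]
      cases out s.tet s.idx <;> simp <;> tauto
    simp only [h6]
    cases out s.tet s.idx <;> split_ifs <;> simp_all

/-- Exactly one of the two triangles at a ladderpole segment belongs to a selected ladder. Whichever
it is, the jump is the sign of the crossing. -/
theorem poleWeight_sub_across (hα : τ.IsVeering α) (hout : τ.IsTransverseTaut α out) (s : Side T) :
    τ.poleWeight α out J s - τ.poleWeight α out J (τ.across s) =
      if τ.cusp s.tri ∈ J then ((ladderStructure hα hout).transX s : ℝ) else 0 := by
  have h1 := out_across hout s
  have h2 := isPoleSegment_across hα s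
  rw [poleWeight, poleWeight, LadderStructure.cusp_across, h2]
  by_cases hs : τ.IsPoleSegment α s
  · have h3 := out_tip_of_pole hα hout hs
    have h4 := out_tip_of_pole hα hout (h2.2 hs)
    have h5 : (ladderStructure hα hout).pos s ↔ τ.IsUpward α out s := by
      show (if τ.IsPoleSegment α s then _ else _) ↔ _
      rw [if_pos hs]
    have h6 : (ladderStructure hα hout).pos (τ.across s) ↔ τ.IsUpward α out (τ.across s) := by
      show (if τ.IsPoleSegment α (τ.across s) then _ else _) ↔ _
      rw [if_pos (h2.2 hs)]
    have h7 := (ladderStructure hα hout).pos_across s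
    rw [h6, h5] at h7
    have h8 : (ladderStructure hα hout).transX s = if τ.IsUpward α out s then 1 else -1 := by
      split_ifs with h
      · exact LadderStructure.transX_up _ hs (h5.2 h)
      · exact LadderStructure.transX_down _ hs (mt h5.1 h)
    rw [h3, h4, h1, h7, h8]
    by_cases hu : τ.IsUpward α out s <;> by_cases hJ : τ.cusp s.tri ∈ J <;>
      cases out s.tet s.idx <;> simp [hu, hJ, hs]
  · rw [LadderStructure.transX_rung _ (show ¬ (ladderStructure hα hout).pole s from hs)]
    simp [hs]

/-- In a triangle of a selected ladder, the weights are `-1` at the wide corner, `1` at the other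
end of the ladderpole segment and `0` at the corner opposite it. This is the coboundary of a weight
on that one segment. -/
theorem ladderWeight_eq (hα : τ.IsVeering α) (hout : τ.IsTransverseTaut α out) (c : Corner T) :
    τ.ladderWeight α out J c = τ.poleWeight α out J c.next - τ.poleWeight α out J c.prev := by
  obtain ⟨w, hw, hc⟩ := exists_wide_corner hα.1 c
  have n0 := not_isPoleSegment_of_wide hα hw
  have p1 := isPoleSegment_prev_iff hα hw
  have p2 := isPoleSegment_next_iff hα hw
  have o0 := out_tip_of_wide hout hw
  have o1 := out_next_of_wide hα.1 hout hw
  have o2 := out_prev_of_wide hα.1 hout hw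
  have t1 : w.next.tri = w.tri := rfl
  have t2 : w.prev.tri = w.tri := rfl
  have a1 : w.next.tet = w.tet := rfl
  have a2 : w.prev.tet = w.tet := rfl
  have b1 : w.next.tip = w.tip := rfl
  have b2 : w.prev.tip = w.tip := rfl
  by_cases hl : τ.LeftVeering α w
  · have p1 := p1.2 hl
    have p2 : ¬ τ.IsPoleSegment α w.next := fun h => p2.1 h hl
    have hup := isUpward_iff_of_left (out := out) hα p1 (by rwa [Corner.prev_next])
    rw [Corner.prev_next, a2] at hup
    rcases hc with h | h | h <;> rw [h] <;>
      simp only [ladderWeight, poleWeight, Corner.next_prev, Corner.prev_next, Corner.next_next,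
        Corner.prev_prev, t1, t2, a1, a2, b1, b2, o0, o1, o2, p1, p2, n0, hup] <;>
      by_cases hJ : τ.cusp w.tri ∈ J <;> cases out w.tet w.idx <;> simp [hJ]
  · have p1 : ¬ τ.IsPoleSegment α w.prev := fun h => hl (p1.1 h)
    have p2 := p2.2 hl
    have hup := isUpward_iff_of_right (out := out) hα p2 (by rwa [Corner.next_prev])
    rw [Corner.next_prev, a1] at hup
    rcases hc with h | h | h <;> rw [h] <;>
      simp only [ladderWeight, poleWeight, Corner.next_prev, Corner.prev_next, Corner.next_next,
        Corner.prev_prev, t1, t2, a1, a2, b1, b2, o0, o1, o2, p1, p2, n0, hup] <;>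
      by_cases hJ : τ.cusp w.tri ∈ J <;> cases out w.tet w.idx <;> simp [hJ]

theorem sum_ladderWeight (hα : τ.IsVeering α) (hout : τ.IsTransverseTaut α out) (c : Corner T) :
    τ.ladderWeight α out J c + τ.ladderWeight α out J c.next + τ.ladderWeight α out J c.prev
      = 0 := by
  rw [ladderWeight_eq J hα hout, ladderWeight_eq J hα hout, ladderWeight_eq J hα hout]
  simp only [Corner.next_prev, Corner.prev_next, Corner.next_next, Corner.prev_prev]
  ring

/-- The deformed angles. -/
def deformation (τ : IdealTriangulation T) (α : T → Fin 3 → ℝ) (out : T → Fin 4 → Bool)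
    (J : Set τ.Cusp) : T → Fin 3 → ℝ :=
  fun t j => α t j + Real.pi / 2 * pairSum (τ.ladderWeight α out J) t j

theorem angle_deformation (c : Corner T) : c.angle (τ.deformation α out J) =
    c.angle α + Real.pi / 2 * c.angle (pairSum (τ.ladderWeight α out J)) := rfl

/-- The deformation of the angles is a coboundary. -/
theorem angle_pairSum_ladderWeight (hα : τ.IsVeering α) (hout : τ.IsTransverseTaut α out) :
    ∃ G : Side T → ℝ,
      (∀ s, G s - G (τ.across s) =
        if τ.cusp s.tri ∈ J then ((ladderStructure hα hout).transX s : ℝ) else 0) ∧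
      ∀ c : Corner T, c.angle (pairSum (τ.ladderWeight α out J)) = G c.next - G c.prev := by
  refine ⟨fun s => τ.poleWeight α out J s + faceWeight (τ.ladderWeight α out J) s, fun s => ?_,
    fun c => ?_⟩
  · simp only [faceWeight_across (ladderWeight_across J hα hout)]
    rw [← poleWeight_sub_across J hα hout]
    ring
  · rw [angle_pairSum (sum_ladderWeight J hα hout), ladderWeight_eq J hα hout]
    ring

theorem neg_one_le_ladderWeight (s : Side T) : -1 ≤ τ.ladderWeight α out J s := by
  rw [ladderWeight]; split_ifs <;> norm_num

/-- The weight is `-1` only where `out` agrees at the tip and at the side, that is, at wide corners.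
-/
theorem ladderWeight_nonneg_of_not_wide (hα : τ.IsTaut α) (hout : τ.IsTransverseTaut α out)
    {s : Side T} (h : s.angle α ≠ Real.pi) : 0 ≤ τ.ladderWeight α out J s := by
  have h1 := out_tip_of_not_wide hα hout h
  rw [ladderWeight]
  split_ifs with h2 h3
  · rw [h2.2.2, h3] at h1; simp at h1
  all_goals norm_num

theorem ladderWeight_nonneg_of_out {s : Side T} (h : out s.tet s.tip = false) :
    0 ≤ τ.ladderWeight α out J s := by
  rw [ladderWeight, if_neg (by simp [h])]

/-- Narrow angles never decrease. For a wide pair, `out` holds for exactly two of the four tips, so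
at most two corners contribute `-π/2` and the angle `π` stays nonnegative. -/
theorem angle_deformation_nonneg (hα : τ.IsTaut α) (hout : τ.IsTransverseTaut α out)
    (c : Corner T) : 0 ≤ c.angle (τ.deformation α out J) := by
  have hpi := Real.pi_pos
  have e : c.angle (pairSum (τ.ladderWeight α out J)) = _ := Corner.angle_pair_sum _ c
  rw [angle_deformation, e]
  set c₁ : Corner T := ⟨c.tet, c.idx, c.tip, c.ne.symm⟩ with h1
  set c₂ : Corner T := ⟨c.tet, c.next.idx, c.prev.idx,
    fun h => c.next_ne_prev (Corner.ext rfl rfl h.symm)⟩ with h2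
  set c₃ : Corner T := ⟨c.tet, c.prev.idx, c.next.idx,
    fun h => c.next_ne_prev (Corner.ext rfl rfl h)⟩ with h3
  have hop : ∀ a b : Fin 4, b ≠ a → oppPair b a = oppPair a b ∧
      oppPair (ccw a b) (ccw a (ccw a b)) = oppPair a b ∧
      oppPair (ccw a (ccw a b)) (ccw a b) = oppPair a b := by decide
  have e1 : c₁.angle α = c.angle α := congrArg (α c.tet) (hop _ _ c.ne).1
  have e2 : c₂.angle α = c.angle α := congrArg (α c.tet) (hop _ _ c.ne).2.1
  have e3 : c₃.angle α = c.angle α := congrArg (α c.tet) (hop _ _ c.ne).2.2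
  by_cases hw : c.angle α = Real.pi
  · rw [hw]
    have a0 := neg_one_le_ladderWeight (α := α) (out := out) J c
    have a1 := neg_one_le_ladderWeight (α := α) (out := out) J c₁
    have a2 := neg_one_le_ladderWeight (α := α) (out := out) J c₂
    have a3 := neg_one_le_ladderWeight (α := α) (out := out) J c₃
    have o0 : out c.tet c.tip = out c.tet c.idx := out_tip_of_wide hout hw
    have o1 : out c.tet c.next.idx = !out c.tet c.idx := out_next_of_wide hα hout hw
    have o2 : out c.tet c.prev.idx = !out c.tet c.idx := out_prev_of_wide hα hout hw
    rcases ho : out c.tet c.idx with _ | _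
    · rw [ho] at o0
      have b0 := ladderWeight_nonneg_of_out (τ := τ) (α := α) J o0
      have b1 := ladderWeight_nonneg_of_out (τ := τ) (α := α) (s := c₁) J ho
      nlinarith
    · rw [ho] at o1 o2
      have b0 := ladderWeight_nonneg_of_out (τ := τ) (α := α) (s := c₂) J o1
      have b1 := ladderWeight_nonneg_of_out (τ := τ) (α := α) (s := c₃) J o2
      nlinarith
  · have h0 : c.angle α = 0 := (angle_eq hα c).resolve_right hw
    rw [h0]
    have a0 := ladderWeight_nonneg_of_not_wide J hα hout hw
    have a1 := ladderWeight_nonneg_of_not_wide J hα hout (s := c₁) (by rwa [e1])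
    have a2 := ladderWeight_nonneg_of_not_wide J hα hout (s := c₂) (by rwa [e2])
    have a3 := ladderWeight_nonneg_of_not_wide J hα hout (s := c₃) (by rwa [e3])
    positivity

theorem isNonnegAngleStructure_deformation (hα : τ.IsVeering α)
    (hout : τ.IsTransverseTaut α out) : τ.IsNonnegAngleStructure (τ.deformation α out J) := by
  obtain ⟨G, hG, hG'⟩ := angle_pairSum_ladderWeight J hα hout
  refine ⟨⟨fun t => ?_, fun v => ?_⟩, fun t j => ?_⟩
  · have h := Corner.angle_sum (τ.deformation α out J) ⟨t, 0, 1, by decide⟩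
    have h' := Corner.angle_sum α ⟨t, 0, 1, by decide⟩
    rw [← h]
    rw [hα.1.1.1] at h'
    simp only [angle_deformation, hG', Corner.next_prev, Corner.prev_next, Corner.next_next,
      Corner.prev_prev]
    linarith
  -- Around a vertex, the values of `G` cancel in pairs up to their jumps, which add up to the
  -- crossing number of a small loop.
  · simp only [angle_deformation]
    rw [Finset.sum_add_distrib, hα.1.1.2, ← Finset.mul_sum, Finset.sum_congr rfl fun c _ => hG' c,
      Finset.sum_sub_distrib, ← τ.sum_vertex_rot (fun c => G c.prev), ← Finset.sum_sub_distrib]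
    have h : ∀ c : Corner T, G c.next - G (τ.rot c).prev =
        ((if τ.cusp c.tri ∈ J then (ladderStructure hα hout).transX c.next else 0 : ℤ) : ℝ) :=
      fun c => by
        rw [τ.rot_prev, hG]
        push_cast
        rfl
    rw [Finset.sum_congr rfl fun c _ => h c, ← Int.cast_sum,
      LadderStructure.sum_vertex_transX]
    simp
  · have : ∀ j : Fin 3, ∃ v w : Fin 4, w ≠ v ∧ oppPair v w = j := by decide
    obtain ⟨v, w, hw, rfl⟩ := this j
    exact angle_deformation_nonneg J hα.1 hout ⟨t, v, w, hw⟩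

theorem turningAngle_deformation (hα : τ.IsVeering α) (hout : τ.IsTransverseTaut α out)
    (γ : SimpleNormalCurve τ) : γ.turningAngle (τ.deformation α out J) =
      γ.turningAngle α + Real.pi / 2 * (ladderStructure hα hout).crossing J γ.chain := by
  obtain ⟨G, hG, hG'⟩ := angle_pairSum_ladderWeight J hα hout
  rw [γ.turningAngle_eq, γ.turningAngle_eq]
  simp only [angle_deformation, hG']
  rw [γ.cornerTurn_add, γ.cornerTurn_mul, γ.cornerTurn_coboundary,
    LadderStructure.crossing_chain]
  simp only [hG]
  push_cast
  rfl

end IdealTriangulation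
end

noncomputable section
open scoped Classical

/-! ## Construction of normal curves -/

namespace NormalArc

variable {T : Type*}

/-- The normal arc with given entry and exit sides. -/
def ofSides (e x : Side T) : NormalArc T :=
  if x = e.prev then ⟨e.next, true⟩ else ⟨e.prev, false⟩

theorem ofSides_tri (e x : Side T) : (ofSides e x).corner.tri = e.tri := by
  rw [ofSides]; split_ifs <;> rfl

theorem ofSides_entry (e x : Side T) : (ofSides e x).entry = e := by
  rw [ofSides]; split_ifs
  · exact e.next_prev
  · exact e.prev_next

theorem ofSides_exit {e x : Side T} (h : x.tri = e.tri) (hne : x ≠ e) : (ofSides e x).exit = x := by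
  rw [ofSides]
  split_ifs with hx
  · rw [hx]; exact e.next_next
  · have h1 := ((Corner.eq_of_tri_eq h).resolve_left hne).resolve_right hx
    rw [h1]; exact e.prev_prev

end NormalArc

/-- A point on a side, in barycentric coordinates. -/
def sidePoint {T : Type*} (s : Side T) (u : ℝ) : Fin 4 → ℝ :=
  (1 - u) • s.prev.point + u • s.next.point

theorem sidePoint_mem {T : Type*} (s : Side T) {u : ℝ} (h0 : 0 < u) (h1 : u < 1) :
    sidePoint s u ∈ openSegment ℝ s.next.point s.prev.point :=
  ⟨u, 1 - u, h0, by linarith, by ring, add_comm _ _⟩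

theorem sidePoint_across {T : Type*} (τ : IdealTriangulation T) (s : Side T) (u : ℝ) (w : Fin 4) :
    sidePoint (τ.across s) (1 - u) (τ.glue s.tet s.idx w) = sidePoint s u w := by
  simp only [sidePoint, Pi.add_apply, Pi.smul_apply, Corner.point, τ.across_prev_idx,
    τ.across_next_idx, Pi.single_apply, EmbeddingLike.apply_eq_iff_eq]
  ring

/-- A simple closed normal curve is determined by the entry and exit sides of its arcs, permuted
cyclically by `N`, and the positions of its crossing points. -/
theorem exists_curve_of_arcs {T S : Type*} (τ : IdealTriangulation T) [Fintype S]
    (x₀ : S) (N : Equiv.Perm S) (hN : ∀ x y, N.SameCycle x y) (entry exit : S → Side T)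
    (htri : ∀ s, (exit s).tri = (entry s).tri) (hne : ∀ s, exit s ≠ entry s)
    (hac : ∀ s, τ.across (exit s) = entry (N s)) (u v : S → ℝ)
    (hu : ∀ s, 0 < u s ∧ u s < 1) (hv : ∀ s, v (N s) = 1 - u s)
    (hdisj : ∀ s s', s ≠ s' → (entry s).tri = (entry s').tri →
      Disjoint (segment ℝ (sidePoint (entry s) (v s)) (sidePoint (exit s) (u s)))
        (segment ℝ (sidePoint (entry s') (v s')) (sidePoint (exit s') (u s')))) :
    ∃ γ : SimpleNormalCurve τ, γ.chain = ∑ s, τ.cross (exit s) := by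
  obtain ⟨n, e, he⟩ := Equiv.Perm.exists_cyclic_enumeration N hN x₀
  have hv' : ∀ s, 0 < v s ∧ v s < 1 := fun s => by
    obtain ⟨s, rfl⟩ := N.surjective s
    rw [hv]
    constructor <;> linarith [(hu s).1, (hu s).2]
  -- Exit and entry are distinct sides of one triangle, so the arc that joins them is a normal arc.
  have hex : ∀ s, (NormalArc.ofSides (entry s) (exit s)).exit = exit s := fun s =>
    NormalArc.ofSides_exit (htri s) (hne s)
  refine ⟨{
    n := n
    arc := fun j => NormalArc.ofSides (entry (e j)) (exit (e j))
    closed := fun j => by rw [hex, NormalArc.ofSides_entry, hac, he]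
    startPt := fun j => sidePoint (entry (e j)) (v (e j))
    endPt := fun j => sidePoint (exit (e j)) (u (e j))
    startPt_mem := fun j => by
      rw [NormalArc.ofSides_entry]; exact sidePoint_mem _ (hv' _).1 (hv' _).2
    endPt_mem := fun j => by rw [hex]; exact sidePoint_mem _ (hu _).1 (hu _).2
    startPt_succ := fun j w => by rw [hex, he, ← hac, hv]; exact sidePoint_across τ _ _ _
    embedded := fun i j hij ht => by
      rw [NormalArc.ofSides_tri, NormalArc.ofSides_tri] at ht
      exact hdisj _ _ (e.injective.ne hij) ht }, ?_⟩
  show ∑ j, τ.cross (NormalArc.ofSides (entry (e j)) (exit (e j))).exit = _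
  simp only [hex]
  exact Equiv.sum_comp e fun s => τ.cross (exit s)

/-! ## Homology classes not crossing the ladderpoles -/

namespace LadderStructure

variable {T : Type*} [Fintype T] {τ : IdealTriangulation T} (L : LadderStructure τ)

/-- The core curve of a ladder, directed upward. -/
def core (l : L.Ladder) (s : Side T) : ℤ :=
  if L.ladder s.tri = l ∧ ¬ L.pole s then (if L.pos s then 1 else -1) else 0

theorem core_pole (l : L.Ladder) {s : Side T} (hs : L.pole s) : L.core l s = 0 :=
  if_neg fun h => h.2 hs

theorem core_topRung (l : L.Ladder) (A : T × Fin 4) :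
    L.core l (L.topRung A) = if L.ladder A = l then 1 else 0 := by
  rw [core, L.topRung_tri]
  simp [L.not_pole_topRung, L.pos_topRung]

theorem core_botRung (l : L.Ladder) (A : T × Fin 4) :
    L.core l (L.botRung A) = if L.ladder A = l then -1 else 0 := by
  rw [core, L.botRung_tri]
  simp [L.not_pole_botRung, L.not_pos_botRung]

theorem sum_cross_topRung (l : L.Ladder) :
    ∑ A : T × Fin 4 with L.ladder A = l, τ.cross (L.topRung A) = L.core l := by
  funext s
  have h1 : ∀ A, s = L.topRung A ↔ (¬ L.pole s ∧ L.pos s) ∧ s.tri = A := fun A => by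
    constructor
    · rintro rfl
      exact ⟨⟨L.not_pole_topRung A, L.pos_topRung A⟩, L.topRung_tri A⟩
    · rintro ⟨⟨h1, h2⟩, rfl⟩
      exact (L.eq_topRung h1 h2).symm
  have h2 : ∀ A, s = τ.across (L.topRung A) ↔
      (¬ L.pole s ∧ ¬ L.pos s) ∧ (τ.across s).tri = A := fun A => by
    constructor
    · rintro rfl
      rw [L.pole_across, L.pos_across, not_not, τ.across_across]
      exact ⟨⟨L.not_pole_topRung A, L.pos_topRung A⟩, L.topRung_tri A⟩
    · rintro ⟨⟨h1, h2⟩, rfl⟩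
      rw [L.eq_topRung (by rwa [L.pole_across]) ((L.pos_across s).2 h2), τ.across_across]
  rw [Finset.sum_apply]
  simp only [IdealTriangulation.cross, Pi.sub_apply, Pi.single_apply, h1, h2,
    Finset.sum_sub_distrib]
  by_cases hp : L.pole s
  · simp [core, hp]
  · by_cases hs : L.pos s <;> simp [core, hp, hs, L.ladder_across hp, neg_ite]

theorem sum_vertexPole (x : Side T → ℤ) (p : L.Ladderpole) :
    ∑ v with L.vertexPole v = p, x (L.startSeg v) =
      ∑ s : Side T with (L.pole s ∧ L.pos s) ∧ L.ladderpole s.next = p, x s := by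
  refine Finset.sum_bij' (fun v _ => L.startSeg v) (fun s _ => τ.vertex s.next) ?_ ?_ ?_ ?_ ?_
  · intro v hv
    rw [Finset.mem_filter] at hv ⊢
    refine ⟨Finset.mem_univ _, ⟨L.pole_startSeg v, L.pos_startSeg v⟩, ?_⟩
    rw [← vertexPole_vertex, vertex_startSeg, hv.2]
  · intro s hs
    rw [Finset.mem_filter] at hs ⊢
    exact ⟨Finset.mem_univ _, by rw [vertexPole_vertex]; exact hs.2.2⟩
  · intro v _
    exact L.vertex_startSeg v
  · intro s hs
    rw [Finset.mem_filter] at hs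
    exact L.eq_startSeg hs.2.1.1 hs.2.1.2
  · intro v _
    rfl

/-- Cycles in a cusp not crossing the ladderpoles are homologous to multiples of the core curve
of any ladder in this cusp. -/
theorem exists_sub_core_mem_boundaries (l₀ : L.Ladder) {y : Side T → ℤ} (hy : y ∈ τ.cycles)
    (hc : ∀ s, y s ≠ 0 → τ.cusp s.tri = L.ladderCusp l₀)
    (hp : ∀ p : L.Ladderpole, L.poleCusp p = L.ladderCusp l₀ →
      ∑ s : Side T with (L.pole s ∧ L.pos s) ∧ L.ladderpole s.next = p, y s = 0) :
    ∃ n : ℤ, y - n • L.core l₀ ∈ τ.boundaries := by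
  have hp' : ∀ p : L.Ladderpole,
      ∑ s : Side T with (L.pole s ∧ L.pos s) ∧ L.ladderpole s.next = p, y s = 0 := fun p => by
    by_cases h : L.poleCusp p = L.ladderCusp l₀
    · exact hp p h
    · refine Finset.sum_eq_zero fun s hs => ?_
      by_contra h0
      rw [Finset.mem_filter] at hs
      refine h ?_
      rw [← hs.2.2, poleCusp_ladderpole]
      exact hc s h0
  -- Zero total crossing of each ladderpole allows the values of `y` on its segments to be
  -- integrated along it. Subtracting this gradient leaves a cycle `z` that crosses no ladderpole
  -- segment.
  obtain ⟨f, hf⟩ := Equiv.Perm.exists_coboundary L.succ (fun v => y (L.startSeg v)) fun v => by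
    simp only [← vertexPole_eq_iff, eq_comm (a := L.vertexPole v)]
    rw [sum_vertexPole, hp']
  -- Restricting to the cusp keeps the corrected cycle supported there.
  let f' : τ.Vertex → ℤ := fun v =>
    if L.poleCusp (L.vertexPole v) = L.ladderCusp l₀ then f v else 0
  let z : Side T → ℤ := fun s => y s - (f' (τ.vertex s.prev) - f' (τ.vertex s.next))
  have hcusp : ∀ c : Corner T, L.poleCusp (L.vertexPole (τ.vertex c)) = τ.cusp c.tri := fun c => by
    rw [vertexPole_vertex, poleCusp_ladderpole]
  have hz0 : ∀ s, τ.cusp s.tri ≠ L.ladderCusp l₀ → z s = 0 := fun s hs => by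
    have h1 : y s = 0 := by_contra fun h => hs (hc s h)
    have h2 : f' (τ.vertex s.prev) = 0 := if_neg (by rw [hcusp]; exact hs)
    have h3 : f' (τ.vertex s.next) = 0 := if_neg (by rw [hcusp]; exact hs)
    simp only [z, h1, h2, h3, sub_zero]
  have hza : ∀ s, z (τ.across s) = - z s := fun s => by
    simp only [z, τ.vertex_across_next, τ.vertex_across_prev, hy.1 s]; ring
  have hzs : ∀ c : Corner T, z c + z c.next + z c.prev = 0 := fun c => by
    have := hy.2 c.tri
    rw [Corner.sum_tri] at this
    simp only [z, Corner.next_prev, Corner.prev_next, Corner.next_next, Corner.prev_prev]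
    linarith
  have hzp : ∀ s, L.pole s → z s = 0 := fun s hs => by
    have key : ∀ s, L.pole s → L.pos s → z s = 0 := fun s hs hu => by
      by_cases h : τ.cusp s.tri = L.ladderCusp l₀
      · have h1 := hf (τ.vertex s.next)
        rw [L.succ_vertex hs hu, L.eq_startSeg hs hu] at h1
        have h2 : f' (τ.vertex s.prev) = f (τ.vertex s.prev) := if_pos (by rw [hcusp]; exact h)
        have h3 : f' (τ.vertex s.next) = f (τ.vertex s.next) := if_pos (by rw [hcusp]; exact h)
        simp only [z, h2, h3, h1, sub_self]
      · exact hz0 s h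
    by_cases hu : L.pos s
    · exact key s hs hu
    · have := key (τ.across s) ((L.pole_across s).2 hs) ((L.pos_across s).2 hu)
      rw [hza] at this
      linarith
  have hzb : ∀ A, z (L.botRung A) = - z (L.topRung A) := fun A => by
    have h1 := hzs (L.poleSide A)
    rw [hzp _ (L.pole_poleSide A)] at h1
    by_cases h : L.isRight A
    · rw [L.botRung_right h, L.topRung_right h]; linarith
    · rw [L.botRung_left h, L.topRung_left h]; linarith
  have hzu : ∀ A, z (L.topRung (L.up A)) = z (L.topRung A) := fun A => by
    have h1 := hza (L.topRung A)
    rw [L.across_topRung_eq, hzb] at h1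
    linarith
  -- A cycle that crosses no ladderpole segment crosses all the rungs of a ladder equally often, so
  -- it is a combination of core curves with these coefficients.
  let κ : L.Ladder → ℤ := Quot.lift (fun A => z (L.topRung A)) (L.lift_up_ladder _ hzu)
  have hκ : ∀ A, κ (L.ladder A) = z (L.topRung A) := fun A => rfl
  have hκ0 : ∀ l, L.ladderCusp l ≠ L.ladderCusp l₀ → κ l = 0 := fun l hl => by
    obtain ⟨A, rfl⟩ : ∃ A, L.ladder A = l := Quot.exists_rep l
    rw [hκ]
    exact hz0 _ (by rw [L.topRung_tri]; exact hl)
  have hsame : ∀ l l', L.ladderSucc.SameCycle l l' ↔ L.ladderCusp l = L.ladderCusp l' := by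
    intro l l'
    constructor
    · exact fun h => (eq_of_sameCycle L.ladderSucc L.ladderCusp L.ladderCusp_ladderSucc h)
    · intro h
      obtain ⟨A, rfl⟩ : ∃ A, L.ladder A = l := Quot.exists_rep l
      obtain ⟨B, rfl⟩ : ∃ A, L.ladder A = l' := Quot.exists_rep l'
      exact L.ladderSucc_sameCycle h
  set n := ∑ l with L.ladderCusp l₀ = L.ladderCusp l, κ l with hn
  -- The coefficients `κ` can be replaced by their total `n` on `l₀` alone: the two have the same
  -- sum over the ladders of each cusp, and their difference is a coboundary for `ladderSucc`.
  obtain ⟨H, hH⟩ := Equiv.Perm.exists_coboundary L.ladderSucc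
    (fun l => (if l = l₀ then n else 0) - κ l) fun l => by
      simp only [hsame]
      rw [Finset.sum_sub_distrib]
      by_cases h : L.ladderCusp l = L.ladderCusp l₀
      · rw [h, ← hn, Finset.sum_ite_eq', if_pos (by simp), sub_self]
      · rw [Finset.sum_eq_zero, Finset.sum_eq_zero, sub_self]
        · intro l' hl'
          rw [Finset.mem_filter] at hl'
          exact hκ0 l' (hl'.2 ▸ h)
        · intro l' hl'
          rw [Finset.mem_filter] at hl'
          exact if_neg fun (h' : l' = l₀) => h (hl'.2.trans (congrArg L.ladderCusp h'))
  -- A function constant on ladderpoles has as its gradient a combination of core curves, each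
  -- weighted by the difference between the two boundaries of the ladder.
  let g : τ.Vertex → ℤ := fun v => H (L.leftPole.symm (L.vertexPole v))
  have hgl : ∀ A, g (τ.vertex (L.leftBot A)) = H (L.ladder A) := fun A => by
    show H (L.leftPole.symm _) = _
    rw [← leftPole_ladder, Equiv.symm_apply_apply]
  have hgr : ∀ A, g (τ.vertex (L.rightBot A)) = H (L.ladderSucc (L.ladder A)) := fun A => by
    show H (L.leftPole.symm _) = _
    rw [← rightPole_ladder, ← leftPole_ladderSucc, Equiv.symm_apply_apply]
  have hgl' : ∀ A, g (τ.vertex (L.leftTop A)) = H (L.ladder A) := fun A => by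
    rw [← hgl]; exact congrArg (fun p => H (L.leftPole.symm p)) (L.vertexPole_leftTop A)
  have hgr' : ∀ A, g (τ.vertex (L.rightTop A)) = H (L.ladderSucc (L.ladder A)) := fun A => by
    rw [← hgr]; exact congrArg (fun p => H (L.leftPole.symm p)) (L.vertexPole_rightTop A)
  refine ⟨n, (τ.mem_boundaries_iff _).2 ⟨fun v => f' v + g v, fun s => ?_⟩⟩
  have hzy : y s = z s + (f' (τ.vertex s.prev) - f' (τ.vertex s.next)) := by simp only [z]; ring
  have goal : z s - n * L.core l₀ s = g (τ.vertex s.prev) - g (τ.vertex s.next) := by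
    by_cases hs : L.pole s
    · rw [hzp s hs, core_pole _ _ hs]
      have : L.vertexPole (τ.vertex s.prev) = L.vertexPole (τ.vertex s.next) := by
        rw [vertexPole_vertex, vertexPole_vertex, L.ladderpole_pole hs]
      simp only [g, this]
      ring
    · by_cases hu : L.pos s
      · obtain ⟨A, rfl⟩ : ∃ A, s = L.topRung A := ⟨_, (L.eq_topRung hs hu).symm⟩
        have h1 : g (τ.vertex (L.topRung A).prev) = _ := hgl' A
        have h2 : g (τ.vertex (L.topRung A).next) = _ := hgr' A
        have h3 := hH (L.ladder A)
        rw [hκ] at h3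
        rw [h1, h2, core_topRung]
        split_ifs at h3 ⊢ <;> linarith
      · obtain ⟨A, rfl⟩ : ∃ A, s = L.botRung A := ⟨_, (L.eq_botRung hs hu).symm⟩
        have h1 : g (τ.vertex (L.botRung A).next) = _ := hgl A
        have h2 : g (τ.vertex (L.botRung A).prev) = _ := hgr A
        have h3 := hH (L.ladder A)
        rw [hκ] at h3
        rw [h1, h2, core_botRung, hzb]
        split_ifs at h3 ⊢ <;> linarith
  simp only [Pi.sub_apply, Pi.smul_apply, smul_eq_mul]
  linarith

end LadderStructure
end

noncomputable section
open scoped Classical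

/-! ## Sums over integer intervals -/

/-- The sum of `f` over the integers in `[0, z)`, with the sign convention of oriented intervals. -/
def intervalSum {M : Type*} [AddCommGroup M] (f : ℤ → M) (z : ℤ) : M :=
  ∑ i ∈ Finset.range z.toNat, f i - ∑ i ∈ Finset.range (-z).toNat, f (-(i + 1))

theorem intervalSum_add_one {M : Type*} [AddCommGroup M] (f : ℤ → M) (z : ℤ) :
    intervalSum f (z + 1) = intervalSum f z + f z := by
  rw [intervalSum, intervalSum]
  rcases le_or_gt 0 z with h | h
  · have h1 : (z + 1).toNat = z.toNat + 1 := by omega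
    have h2 : (-(z + 1)).toNat = 0 := by omega
    have h3 : (-z).toNat = 0 := by omega
    have h4 : ((z.toNat : ℕ) : ℤ) = z := by omega
    rw [h1, h2, h3, Finset.sum_range_succ, h4]
    simp
  · have h1 : (z + 1).toNat = 0 := by omega
    have h2 : z.toNat = 0 := by omega
    have h3 : (-z).toNat = (-(z + 1)).toNat + 1 := by omega
    have h4 : -((((-(z + 1)).toNat : ℕ) : ℤ) + 1) = z := by omega
    rw [h1, h2, h3, Finset.sum_range_succ, h4]
    simp

theorem intervalSum_add_period {M : Type*} [AddCommGroup M] {f : ℤ → M} {m : ℕ}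
    (hf : ∀ i, f (i + m) = f i) (z : ℤ) :
    intervalSum f (z + m) = intervalSum f z + ∑ i ∈ Finset.range m, f i := by
  have step : ∀ z : ℤ, intervalSum f (z + 1 + m) - intervalSum f (z + 1) =
      intervalSum f (z + m) - intervalSum f z := fun z => by
    rw [add_right_comm, intervalSum_add_one, intervalSum_add_one, hf]; abel
  have key : ∀ z : ℤ, intervalSum f (z + m) - intervalSum f z = ∑ i ∈ Finset.range m, f i := by
    intro z
    induction z using Int.induction_on with
    | zero => simp [intervalSum]
    | succ i ih => rw [step, ih]
    | pred i ih =>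
      have := step (-(i : ℤ) - 1)
      rw [sub_add_cancel, ih] at this
      exact this.symm
  rw [← key z]; abel

/-- Applied to the rungs of a ladder, this says that `n` extra turns add `n` times the core curve.
-/
theorem intervalSum_add_mul_period {M : Type*} [AddCommGroup M] {f : ℤ → M} {m : ℕ}
    (hf : ∀ i, f (i + m) = f i) (z n : ℤ) :
    intervalSum f (z + n * m) = intervalSum f z + n • ∑ i ∈ Finset.range m, f i := by
  induction n using Int.induction_on with
  | zero => simp
  | succ i ih =>
    have : z + ((i : ℤ) + 1) * m = z + i * m + m := by ring
    rw [this, intervalSum_add_period hf, ih, add_zsmul, one_zsmul]; abel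
  | pred i ih =>
    have : z + -(i : ℤ) * m = z + (-(i : ℤ) - 1) * m + m := by ring
    rw [this, intervalSum_add_period hf] at ih
    rw [sub_zsmul, one_zsmul, ← add_assoc, ← ih]; abel

theorem IdealTriangulation.cross_across {T : Type*} (τ : IdealTriangulation T) (s : Side T) :
    τ.cross (τ.across s) = - τ.cross s := by
  rw [cross, cross, τ.across_across, neg_sub]

/-! ## Spiral curves -/

namespace LadderStructure

variable {T : Type*} [Fintype T] {τ : IdealTriangulation T} (L : LadderStructure τ)

/-- The segment through which a curve crosses a ladderpole. -/
def gate (p : L.Ladderpole) : Side T := L.startSeg (L.markedVertex p)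

theorem pole_gate (p : L.Ladderpole) : L.pole (L.gate p) := L.pole_startSeg _
theorem pos_gate (p : L.Ladderpole) : L.pos (L.gate p) := L.pos_startSeg _

theorem ladderpole_gate (p : L.Ladderpole) : L.ladderpole (L.gate p).next = p := by
  rw [← vertexPole_vertex, gate, vertex_startSeg, vertexPole_markedVertex]

def entryTri (l : L.Ladder) : T × Fin 4 := (τ.across (L.gate (L.leftPole l))).tri
def exitTri (l : L.Ladder) : T × Fin 4 := (L.gate (L.rightPole l)).tri

theorem pole_across_gate (p : L.Ladderpole) : L.pole (τ.across (L.gate p)) :=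
  (L.pole_across _).2 (L.pole_gate p)

theorem not_pos_across_gate (p : L.Ladderpole) : ¬ L.pos (τ.across (L.gate p)) := by
  rw [L.pos_across, not_not]; exact L.pos_gate p

theorem not_isRight_entryTri (l : L.Ladder) : ¬ L.isRight (L.entryTri l) :=
  L.not_isRight_of_down (L.pole_across_gate _) (L.not_pos_across_gate _)

theorem isRight_exitTri (l : L.Ladder) : L.isRight (L.exitTri l) :=
  L.isRight_of_up (L.pole_gate _) (L.pos_gate _)

theorem ladder_entryTri (l : L.Ladder) : L.ladder (L.entryTri l) = l := by
  apply L.leftPole.injective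
  rw [entryTri, L.leftPole_ladder_down (L.pole_across_gate _) (L.not_pos_across_gate _),
    τ.vertex_across_prev, vertexPole_vertex, ladderpole_gate]

theorem ladder_exitTri (l : L.Ladder) : L.ladder (L.exitTri l) = l := by
  apply L.rightPole.injective
  rw [exitTri, L.rightPole_ladder_up (L.pole_gate _) (L.pos_gate _), vertexPole_vertex,
    ladderpole_gate]

theorem exists_zpow_entryTri (l : L.Ladder) : ∃ z : ℤ, (L.up ^ z) (L.entryTri l) = L.exitTri l :=
  L.ladder_eq_iff.1 ((L.ladder_entryTri l).trans (L.ladder_exitTri l).symm)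

/-- A ladder contains a triangle with its ladderpole segment on the left and one with it on the
right, hence at least two triangles. -/
theorem up_ne (A : T × Fin 4) : L.up A ≠ A := fun h => by
  have key : ∀ B, L.ladder B = L.ladder A → B = A := fun B hB => by
    obtain ⟨z, rfl⟩ := L.ladder_eq_iff.1 hB.symm
    exact Equiv.Perm.zpow_apply_eq_self_of_apply_eq_self h z
  have h1 := key _ (L.ladder_entryTri (L.ladder A))
  have h2 := key _ (L.ladder_exitTri (L.ladder A))
  have h3 := L.isRight_exitTri (L.ladder A)
  rw [h2, ← h1] at h3
  exact L.not_isRight_entryTri _ h3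

/-- The rungs in front of and behind a triangle, for a curve running up or down a ladder. -/
def fore (b : Bool) (A : T × Fin 4) : Side T := if b then L.topRung A else L.botRung A
def back (b : Bool) (A : T × Fin 4) : Side T := if b then L.botRung A else L.topRung A

def dirSign (b : Bool) : ℤ := if b then 1 else -1

theorem across_fore (b : Bool) (A : T × Fin 4) :
    τ.across (L.fore b A) = L.back b ((L.up ^ dirSign b) A) := by
  cases b
  · simp only [fore, back, dirSign, Bool.false_eq_true, if_false]
    rw [zpow_neg_one]; exact L.across_botRung_eq A
  · simp only [fore, back, dirSign, if_true]
    rw [zpow_one]; exact L.across_topRung_eq A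

theorem fore_tri (b : Bool) (A : T × Fin 4) : (L.fore b A).tri = A := by
  cases b <;> simp [fore, L.botRung_tri, L.topRung_tri]

theorem back_tri (b : Bool) (A : T × Fin 4) : (L.back b A).tri = A := by
  cases b <;> simp [back, L.botRung_tri, L.topRung_tri]

theorem not_pole_fore (b : Bool) (A : T × Fin 4) : ¬ L.pole (L.fore b A) := by
  cases b <;> simp [fore, L.not_pole_botRung, L.not_pole_topRung]

theorem not_pole_back (b : Bool) (A : T × Fin 4) : ¬ L.pole (L.back b A) := by
  cases b <;> simp [back, L.not_pole_botRung, L.not_pole_topRung]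

theorem fore_ne_back (b : Bool) (A : T × Fin 4) : L.fore b A ≠ L.back b A := fun h => by
  have h1 := L.pos_topRung A
  have h2 := L.not_pos_botRung A
  cases b
  · exact h2 (by simp only [fore, back, Bool.false_eq_true, if_false] at h; rwa [h])
  · exact h2 (by simp only [fore, back, if_true] at h; rwa [← h])

/-- The parameter of `sidePoint` on the rung in front at horizontal position `t`: the parameter
increases to the right on a top rung and to the left on a bottom rung. -/
def rungPos (b : Bool) (t : ℝ) : ℝ := if b then t else 1 - t

theorem chartMap_sidePoint_re (s : Side T) (u : ℝ) :
    (L.chartMap s.tri (sidePoint s u)).re = (1 - u) * L.chartX s.prev + u * L.chartX s.next := by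
  have h1 : L.chartMap s.tri s.prev.point = L.chart s.prev := L.chartMap_point s.prev
  have h2 : L.chartMap s.tri s.next.point = L.chart s.next := L.chartMap_point s.next
  rw [sidePoint, map_add, map_smul, map_smul, h1, h2]
  simp [chart]

theorem topRung_re (A : T × Fin 4) (u : ℝ) :
    (L.chartMap A (sidePoint (L.topRung A) u)).re = u := by
  have h := L.chartMap_sidePoint_re (L.topRung A) u
  have h1 : L.chartX (L.topRung A).prev = 0 := L.chartX_leftTop A
  have h2 : L.chartX (L.topRung A).next = 1 := L.chartX_rightTop A
  rw [L.topRung_tri, h1, h2] at h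
  simpa using h

theorem botRung_re (A : T × Fin 4) (u : ℝ) :
    (L.chartMap A (sidePoint (L.botRung A) u)).re = 1 - u := by
  have h := L.chartMap_sidePoint_re (L.botRung A) u
  have h1 : L.chartX (L.botRung A).prev = 1 := L.chartX_rightBot A
  have h2 : L.chartX (L.botRung A).next = 0 := L.chartX_leftBot A
  rw [L.botRung_tri, h1, h2] at h
  simpa using h

theorem fore_re (b : Bool) (A : T × Fin 4) (t : ℝ) :
    (L.chartMap A (sidePoint (L.fore b A) (rungPos b t))).re = t := by
  cases b
  · simp only [fore, rungPos, Bool.false_eq_true, if_false, botRung_re]; ring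
  · simp only [fore, rungPos, if_true, topRung_re]

theorem back_re (b : Bool) (A : T × Fin 4) (t : ℝ) :
    (L.chartMap A (sidePoint (L.back b A) (1 - rungPos b t))).re = t := by
  cases b
  · simp only [back, rungPos, Bool.false_eq_true, if_false, topRung_re]; ring
  · simp only [back, rungPos, if_true, botRung_re]; ring

theorem chartX_of_up {s : Side T} (h1 : L.pole s) (h2 : L.pos s) :
    L.chartX s.next = 1 ∧ L.chartX s.prev = 1 := by
  have hr := L.isRight_of_up h1 h2
  have h3 := L.chartX_rightBot s.tri
  have h4 := L.chartX_rightTop s.tri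
  rw [L.rightBot_right hr, L.eq_poleSide h1] at h3
  rw [L.rightTop_right hr, L.eq_poleSide h1] at h4
  exact ⟨h3, h4⟩

theorem chartX_of_down {s : Side T} (h1 : L.pole s) (h2 : ¬ L.pos s) :
    L.chartX s.next = 0 ∧ L.chartX s.prev = 0 := by
  have hr := L.not_isRight_of_down h1 h2
  have h3 := L.chartX_leftBot s.tri
  have h4 := L.chartX_leftTop s.tri
  rw [L.leftBot_left hr, L.eq_poleSide h1] at h3
  rw [L.leftTop_left hr, L.eq_poleSide h1] at h4
  exact ⟨h4, h3⟩

theorem exitTri_re (l : L.Ladder) (u : ℝ) :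
    (L.chartMap (L.exitTri l) (sidePoint (L.gate (L.rightPole l)) u)).re = 1 := by
  have h := L.chartX_of_up (L.pole_gate (L.rightPole l)) (L.pos_gate _)
  rw [exitTri, chartMap_sidePoint_re, h.1, h.2]
  push_cast; ring

theorem entryTri_re (l : L.Ladder) (u : ℝ) :
    (L.chartMap (L.entryTri l) (sidePoint (τ.across (L.gate (L.leftPole l))) u)).re = 0 := by
  have h := L.chartX_of_down (L.pole_across_gate (L.leftPole l)) (L.not_pos_across_gate _)
  rw [entryTri, chartMap_sidePoint_re, h.1, h.2]
  push_cast; ring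

theorem re_mem_Icc_of_mem_segment {A : T × Fin 4} {P Q b : Fin 4 → ℝ} {x y : ℝ} (hxy : x ≤ y)
    (hP : (L.chartMap A P).re = x) (hQ : (L.chartMap A Q).re = y) (hb : b ∈ segment ℝ P Q) :
    x ≤ (L.chartMap A b).re ∧ (L.chartMap A b).re ≤ y := by
  obtain ⟨p, q, hp, hq, hpq, rfl⟩ := hb
  have h : (L.chartMap A (p • P + q • Q)).re = p * x + q * y := by
    rw [map_add, map_smul, map_smul, ← hP, ← hQ]
    simp
  rw [h]
  have hp' : p = 1 - q := by linarith
  subst hp'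
  constructor <;> nlinarith

variable (z : L.Ladder → ℤ)

/-- The triangles of a spiral curve in a ladder. -/
def spiralTri (l : L.Ladder) (i : ℕ) : T × Fin 4 :=
  (L.up ^ (dirSign (decide (0 < z l)) * i)) (L.entryTri l)

def spiralExit (x : L.Ladder × ℕ) : Side T :=
  if x.2 = (z x.1).natAbs then L.gate (L.rightPole x.1)
  else L.fore (decide (0 < z x.1)) (L.spiralTri z x.1 x.2)

def spiralEntry (x : L.Ladder × ℕ) : Side T :=
  if x.2 = 0 then τ.across (L.gate (L.leftPole x.1))
  else L.back (decide (0 < z x.1)) (L.spiralTri z x.1 x.2)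

/-- The horizontal position after `i` steps is `(i + 1) / (|z| + 1)`, so the curve moves steadily to
the right; the ladder is left through the midpoint of the gate. -/
def spiralExitPos (x : L.Ladder × ℕ) : ℝ :=
  if x.2 = (z x.1).natAbs then 1 / 2
  else rungPos (decide (0 < z x.1)) ((x.2 + 1 : ℕ) / ((z x.1).natAbs + 1 : ℕ))

def spiralEntryPos (x : L.Ladder × ℕ) : ℝ :=
  if x.2 = 0 then 1 / 2
  else 1 - rungPos (decide (0 < z x.1)) ((x.2 : ℕ) / ((z x.1).natAbs + 1 : ℕ))

def spiralNext (x : L.Ladder × ℕ) : L.Ladder × ℕ :=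
  if x.2 = (z x.1).natAbs then (L.ladderSucc x.1, 0) else (x.1, x.2 + 1)

theorem spiralTri_zero (l : L.Ladder) : L.spiralTri z l 0 = L.entryTri l := by
  simp [spiralTri]

theorem spiralTri_succ (l : L.Ladder) (i : ℕ) : L.spiralTri z l (i + 1) =
    (L.up ^ dirSign (decide (0 < z l))) (L.spiralTri z l i) := by
  rw [spiralTri, spiralTri, ← Equiv.Perm.mul_apply, ← zpow_add]
  congr 2
  push_cast; ring

theorem spiralTri_succ_ne (l : L.Ladder) (i : ℕ) : L.spiralTri z l (i + 1) ≠ L.spiralTri z l i := by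
  rw [spiralTri_succ]
  by_cases h : 0 < z l
  · simpa [dirSign, h] using L.up_ne _
  · simp only [dirSign, h, decide_false, Bool.false_eq_true, if_false, zpow_neg_one]
    rw [Ne, Equiv.Perm.inv_eq_iff_eq]
    exact fun h' => L.up_ne _ h'.symm

theorem ladder_spiralTri (l : L.Ladder) (i : ℕ) : L.ladder (L.spiralTri z l i) = l := by
  have h : L.ladder (L.entryTri l) = L.ladder (L.spiralTri z l i) := L.ladder_eq_iff.2 ⟨_, rfl⟩
  rw [← h, ladder_entryTri]

variable {z}

theorem spiralTri_last {l : L.Ladder} (hz : (L.up ^ z l) (L.entryTri l) = L.exitTri l) :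
    L.spiralTri z l (z l).natAbs = L.exitTri l := by
  rw [spiralTri, ← hz]
  congr 2
  by_cases h : 0 < z l
  · simp [dirSign, h]; omega
  · simp [dirSign, h, abs_of_nonpos (not_lt.1 h)]

/-- The entry triangle has its ladderpole segment on the left and the exit triangle on the right, so
they are different and at least one rung is crossed. -/
theorem z_ne_zero {l : L.Ladder} (hz : (L.up ^ z l) (L.entryTri l) = L.exitTri l) : z l ≠ 0 :=
  fun h => by
    rw [h, zpow_zero, Equiv.Perm.one_apply] at hz
    exact L.not_isRight_entryTri l (hz ▸ L.isRight_exitTri l)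

variable (hz : ∀ l, (L.up ^ z l) (L.entryTri l) = L.exitTri l)
include hz

theorem spiralExit_tri (x : L.Ladder × ℕ) : (L.spiralExit z x).tri = L.spiralTri z x.1 x.2 := by
  rw [spiralExit]
  split_ifs with h
  · rw [h, L.spiralTri_last (hz x.1)]; rfl
  · exact L.fore_tri _ _

omit hz in
theorem spiralEntry_tri (x : L.Ladder × ℕ) : (L.spiralEntry z x).tri = L.spiralTri z x.1 x.2 := by
  rw [spiralEntry]
  split_ifs with h
  · rw [h, L.spiralTri_zero]; rfl
  · exact L.back_tri _ _

theorem spiralExit_ne_spiralEntry (x : L.Ladder × ℕ) : L.spiralExit z x ≠ L.spiralEntry z x := by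
  have h0 := L.z_ne_zero (hz x.1)
  rw [spiralExit, spiralEntry]
  split_ifs with h1 h2 h2
  · omega
  · exact fun h => L.not_pole_back _ _ (h ▸ L.pole_gate _)
  · exact fun h => L.not_pole_fore _ _ (h ▸ L.pole_across_gate _)
  · exact L.fore_ne_back _ _

omit hz in
theorem across_spiralExit (x : L.Ladder × ℕ) :
    τ.across (L.spiralExit z x) = L.spiralEntry z (L.spiralNext z x) := by
  rw [spiralExit, spiralNext]
  split_ifs with h1
  · rw [spiralEntry, if_pos rfl, leftPole_ladderSucc]
  · rw [spiralEntry, if_neg (Nat.succ_ne_zero _), across_fore, spiralTri_succ]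

omit hz in
theorem spiralExitPos_mem (x : L.Ladder × ℕ) (hx : x.2 ≤ (z x.1).natAbs) :
    0 < L.spiralExitPos z x ∧ L.spiralExitPos z x < 1 := by
  rw [spiralExitPos]
  split_ifs with h1
  · norm_num
  · have h2 : x.2 + 1 < (z x.1).natAbs + 1 := by omega
    have h3 : (0 : ℝ) < ((x.2 + 1 : ℕ) : ℝ) / ((z x.1).natAbs + 1 : ℕ) := by positivity
    have h4 : ((x.2 + 1 : ℕ) : ℝ) / ((z x.1).natAbs + 1 : ℕ) < 1 := by
      rw [div_lt_one (by positivity)]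
      exact_mod_cast h2
    rw [rungPos]
    split_ifs <;> constructor <;> linarith

omit hz in
theorem spiralEntryPos_next (x : L.Ladder × ℕ) :
    L.spiralEntryPos z (L.spiralNext z x) = 1 - L.spiralExitPos z x := by
  rw [spiralExitPos, spiralNext]
  split_ifs with h1
  · rw [spiralEntryPos, if_pos rfl]; norm_num
  · rw [spiralEntryPos, if_neg (Nat.succ_ne_zero _)]

theorem spiralExit_re (x : L.Ladder × ℕ) :
    (L.chartMap (L.spiralTri z x.1 x.2)
      (sidePoint (L.spiralExit z x) (L.spiralExitPos z x))).re =
        ((x.2 + 1 : ℕ) : ℝ) / ((z x.1).natAbs + 1 : ℕ) := by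
  rw [spiralExit, spiralExitPos]
  split_ifs with h
  · rw [h, L.spiralTri_last (hz x.1), exitTri_re, div_self (by positivity)]
  · exact L.fore_re _ _ _

omit hz in
theorem spiralEntry_re (x : L.Ladder × ℕ) :
    (L.chartMap (L.spiralTri z x.1 x.2)
      (sidePoint (L.spiralEntry z x) (L.spiralEntryPos z x))).re =
        ((x.2 : ℕ) : ℝ) / ((z x.1).natAbs + 1 : ℕ) := by
  rw [spiralEntry, spiralEntryPos]
  split_ifs with h
  · rw [h, L.spiralTri_zero, entryTri_re]; simp
  · exact L.back_re _ _ _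

/-- The arcs of a spiral lie over successive intervals of horizontal positions. Only consecutive
intervals touch, and consecutive arcs lie in different triangles. -/
theorem spiral_disjoint_of_lt {l : L.Ladder} {i j : ℕ} (hij : i < j)
    (ht : L.spiralTri z l i = L.spiralTri z l j) :
    Disjoint
      (segment ℝ (sidePoint (L.spiralEntry z (l, i)) (L.spiralEntryPos z (l, i)))
        (sidePoint (L.spiralExit z (l, i)) (L.spiralExitPos z (l, i))))
      (segment ℝ (sidePoint (L.spiralEntry z (l, j)) (L.spiralEntryPos z (l, j)))
        (sidePoint (L.spiralExit z (l, j)) (L.spiralExitPos z (l, j)))) := by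
  have hj : i + 1 ≠ j := fun h => L.spiralTri_succ_ne z l i (h ▸ ht.symm)
  have hle : ∀ i : ℕ, (i : ℝ) / ((z l).natAbs + 1 : ℕ) ≤
      ((i + 1 : ℕ) : ℝ) / ((z l).natAbs + 1 : ℕ) := fun i => by
    gcongr; exact Nat.le_succ i
  rw [Set.disjoint_left]
  intro b hb hb'
  have h1 := (L.re_mem_Icc_of_mem_segment (hle i) (L.spiralEntry_re (l, i))
    (L.spiralExit_re hz (l, i)) hb).2
  have h2 := (L.re_mem_Icc_of_mem_segment (hle j) (L.spiralEntry_re (l, j))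
    (L.spiralExit_re hz (l, j)) hb').1
  have ht' : L.spiralTri z (l, i).1 (l, i).2 = L.spiralTri z (l, j).1 (l, j).2 := ht
  rw [ht'] at h1
  have h3 : ((i + 1 : ℕ) : ℝ) / ((z l).natAbs + 1 : ℕ) < (j : ℝ) / ((z l).natAbs + 1 : ℕ) := by
    gcongr; omega
  exact absurd (h2.trans h1) (not_le.2 h3)

omit hz in
/-- The chain carried by the part of a spiral curve in a ladder. -/
theorem sum_fore (l : L.Ladder) :
    ∑ i ∈ Finset.range (z l).natAbs, τ.cross (L.fore (decide (0 < z l)) (L.spiralTri z l i)) =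
      intervalSum (fun i => τ.cross (L.topRung ((L.up ^ i) (L.entryTri l)))) (z l) := by
  rw [intervalSum]
  by_cases h : 0 < z l
  · have h1 : (-(z l)).toNat = 0 := by omega
    have h2 : (z l).toNat = (z l).natAbs := by omega
    rw [h1, h2, Finset.range_zero, Finset.sum_empty, sub_zero]
    refine Finset.sum_congr rfl fun i _ => ?_
    simp [fore, spiralTri, dirSign, h]
  · have h1 : (z l).toNat = 0 := by omega
    have h2 : (-(z l)).toNat = (z l).natAbs := by omega
    rw [h1, h2, Finset.range_zero, Finset.sum_empty, zero_sub, ← Finset.sum_neg_distrib]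
    refine Finset.sum_congr rfl fun i _ => ?_
    -- Going down through the bottom rung of a triangle is crossing the top rung of the triangle
    -- below it in reverse; this accounts for the index `-(i + 1)`.
    have h3 : L.up ((L.up ^ (-((i : ℤ) + 1))) (L.entryTri l)) = L.spiralTri z l i := by
      rw [spiralTri, ← Equiv.Perm.mul_apply, ← zpow_one_add]
      congr 2
      simp [dirSign, h]
    rw [← τ.cross_across, across_topRung_eq, h3]
    simp [fore, h]

/-- The arcs are indexed by a ladder of the cusp and a step in it. They are cyclically permuted
because the ladders of a cusp form one cycle of `ladderSucc`. Each ladder contributes its rungs and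
one gate to the chain. -/
theorem exists_spiral (l₀ : L.Ladder) : ∃ γ : SimpleNormalCurve τ, γ.chain =
    ∑ l with L.ladderCusp l = L.ladderCusp l₀,
      (intervalSum (fun i => τ.cross (L.topRung ((L.up ^ i) (L.entryTri l)))) (z l) +
        τ.cross (L.gate (L.rightPole l))) := by
  -- The bound `M` only serves to make the index set a finite set.
  set M := Finset.univ.sup fun l => (z l).natAbs with hM
  let S : Finset (L.Ladder × ℕ) := (Finset.univ ×ˢ Finset.range (M + 1)).filter fun x =>
    L.ladderCusp x.1 = L.ladderCusp l₀ ∧ x.2 ≤ (z x.1).natAbs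
  have hS : ∀ x, x ∈ S ↔ L.ladderCusp x.1 = L.ladderCusp l₀ ∧ x.2 ≤ (z x.1).natAbs := fun x => by
    simp only [S, Finset.mem_filter, Finset.mem_product, Finset.mem_univ, true_and,
      Finset.mem_range, and_iff_right_iff_imp]
    intro h
    have : (z x.1).natAbs ≤ M := Finset.le_sup (f := fun l => (z l).natAbs) (Finset.mem_univ x.1)
    omega
  have hmap : ∀ x ∈ S, L.spiralNext z x ∈ S := fun x hx => by
    rw [hS] at hx ⊢
    rw [spiralNext]
    split_ifs with h
    · exact ⟨(L.ladderCusp_ladderSucc _).trans hx.1, Nat.zero_le _⟩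
    · exact ⟨hx.1, show x.2 + 1 ≤ (z x.1).natAbs by omega⟩
  have hinj : Function.Injective fun x : S => (⟨L.spiralNext z x, hmap x x.2⟩ : S) := by
    rintro ⟨⟨l, i⟩, hx⟩ ⟨⟨l', i'⟩, hx'⟩ h
    rw [Subtype.mk.injEq] at h
    simp only [spiralNext] at h
    rw [Subtype.mk.injEq]
    split_ifs at h with h1 h2 h2
    · simp only [Prod.mk.injEq, EmbeddingLike.apply_eq_iff_eq, and_true] at h
      subst h
      rw [h1, h2]
    · simp at h
    · simp at h
    · simp only [Prod.mk.injEq, Nat.add_right_cancel_iff] at h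
      rw [h.1, h.2]
  let N : Equiv.Perm S := Equiv.ofBijective _ (Finite.injective_iff_bijective.1 hinj)
  have hNv : ∀ x : S, (N x : L.Ladder × ℕ) = L.spiralNext z x := fun x => rfl
  have hmem0 : ∀ l, L.ladderCusp l = L.ladderCusp l₀ → (l, 0) ∈ S := fun l hl =>
    (hS _).2 ⟨hl, Nat.zero_le _⟩
  have hdown : ∀ (i : ℕ) (l : L.Ladder) (h : (l, i) ∈ S),
      N.SameCycle ⟨(l, 0), hmem0 l ((hS _).1 h).1⟩ ⟨(l, i), h⟩ := by
    intro i l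
    induction i with
    | zero => intro h; exact Equiv.Perm.SameCycle.refl _ _
    | succ i ih =>
      intro h
      have h1 := (hS _).1 h
      have h2 : (l, i) ∈ S := (hS _).2 ⟨h1.1, le_trans (Nat.le_succ i) h1.2⟩
      refine (ih h2).trans ⟨1, ?_⟩
      rw [zpow_one]
      apply Subtype.ext
      rw [hNv]
      exact if_neg (Nat.ne_of_lt h1.2)
  have hsucc : ∀ (k : ℕ) (l : L.Ladder) (h : L.ladderCusp l = L.ladderCusp l₀),
      ∃ h' : ((L.ladderSucc ^ k) l, 0) ∈ S, N.SameCycle ⟨(l, 0), hmem0 l h⟩ ⟨_, h'⟩ := by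
    intro k l h
    induction k with
    | zero => exact ⟨hmem0 l h, Equiv.Perm.SameCycle.refl _ _⟩
    | succ k ih =>
      obtain ⟨h', hc⟩ := ih
      set l' := (L.ladderSucc ^ k) l with hl'
      have h1 := (hS _).1 h'
      have e1 : (L.ladderSucc ^ (k + 1)) l = L.ladderSucc l' := by
        rw [pow_succ', Equiv.Perm.mul_apply]
      have h2 : (l', (z l').natAbs) ∈ S := (hS _).2 ⟨h1.1, le_rfl⟩
      have h3 : (L.ladderSucc l', 0) ∈ S := hmem0 _ ((L.ladderCusp_ladderSucc _).trans h1.1)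
      have h4 : N.SameCycle ⟨(l, 0), hmem0 l h⟩ ⟨(L.ladderSucc l', 0), h3⟩ := by
        refine (hc.trans (hdown _ _ h2)).trans ⟨1, ?_⟩
        rw [zpow_one]
        apply Subtype.ext
        rw [hNv]
        exact if_pos rfl
      exact ⟨by rw [e1]; exact h3, by simp only [e1]; exact h4⟩
  have hbase : ∀ x : S, N.SameCycle ⟨(l₀, 0), hmem0 l₀ rfl⟩ x := by
    rintro ⟨⟨l, i⟩, hx⟩
    refine Equiv.Perm.SameCycle.trans ?_ (hdown i l hx)
    have h1 := ((hS _).1 hx).1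
    obtain ⟨A, rfl⟩ : ∃ A, L.ladder A = l := Quot.exists_rep l
    obtain ⟨B, rfl⟩ : ∃ A, L.ladder A = l₀ := Quot.exists_rep l₀
    have h1' : τ.cusp B = τ.cusp A := h1.symm
    obtain ⟨k, hk⟩ := (L.ladderSucc_sameCycle h1').exists_nat_pow_eq
    obtain ⟨h', hc⟩ := hsucc k (L.ladder B) rfl
    simp only [hk] at hc
    exact hc
  obtain ⟨γ, hγ⟩ := exists_curve_of_arcs τ (⟨(l₀, 0), hmem0 l₀ rfl⟩ : S) N
    (fun x y => (hbase x).symm.trans (hbase y)) (fun x => L.spiralEntry z x)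
    (fun x => L.spiralExit z x)
    (fun x => (L.spiralExit_tri hz x).trans (L.spiralEntry_tri x).symm)
    (fun x => L.spiralExit_ne_spiralEntry hz x) (fun x => L.across_spiralExit x)
    (fun x => L.spiralExitPos z x) (fun x => L.spiralEntryPos z x)
    (fun x => L.spiralExitPos_mem x ((hS _).1 x.2).2) (fun x => L.spiralEntryPos_next x)
    (by
      rintro ⟨⟨l, i⟩, hx⟩ ⟨⟨l', i'⟩, hx'⟩ hne ht
      simp only [spiralEntry_tri] at ht
      have hl := congrArg L.ladder ht
      rw [ladder_spiralTri, ladder_spiralTri] at hl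
      subst hl
      rcases lt_trichotomy i i' with h | h | h
      · exact L.spiral_disjoint_of_lt hz h ht
      · exact (hne (by simp [h])).elim
      · exact (L.spiral_disjoint_of_lt hz h ht.symm).symm)
  refine ⟨γ, hγ.trans ?_⟩
  rw [Finset.sum_coe_sort S (fun x => τ.cross (L.spiralExit z x)),
    Finset.sum_finset_product S (Finset.univ.filter fun l => L.ladderCusp l = L.ladderCusp l₀)
      (fun l => Finset.range ((z l).natAbs + 1))
      (fun x => by rw [hS, Finset.mem_filter, Finset.mem_range, Nat.lt_succ_iff]; simp)]
  refine Finset.sum_congr rfl fun l _ => ?_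
  rw [Finset.sum_range_succ, ← sum_fore]
  congr 1
  · refine Finset.sum_congr rfl fun i hi => ?_
    rw [spiralExit, if_neg (Finset.mem_range.1 hi).ne]
  · rw [spiralExit, if_pos rfl]

end LadderStructure
end

noncomputable section
open scoped Classical

/-! ## Representation of homology classes by curves -/

namespace LadderStructure

variable {T : Type*} [Fintype T] {τ : IdealTriangulation T} (L : LadderStructure τ)

/-- The number of times that a chain crosses a ladderpole. -/
def poleCrossing (p : L.Ladderpole) : (Side T → ℤ) →+ ℤ where
  toFun x := ∑ s : Side T with (L.pole s ∧ L.pos s) ∧ L.ladderpole s.next = p, x s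
  map_zero' := by simp
  map_add' x y := Finset.sum_add_distrib

theorem poleCrossing_apply (p : L.Ladderpole) (x : Side T → ℤ) : L.poleCrossing p x =
    ∑ s : Side T with (L.pole s ∧ L.pos s) ∧ L.ladderpole s.next = p, x s := rfl

theorem poleCrossing_cross_rung (p : L.Ladderpole) {s : Side T} (hs : ¬ L.pole s) :
    L.poleCrossing p (τ.cross s) = 0 := by
  rw [poleCrossing_apply]
  simp [IdealTriangulation.cross, Finset.sum_sub_distrib, Pi.single_apply, L.pole_across, hs]

theorem poleCrossing_cross_up (p : L.Ladderpole) {s : Side T} (hs : L.pole s) (hu : L.pos s) :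
    L.poleCrossing p (τ.cross s) = if L.ladderpole s.next = p then 1 else 0 := by
  rw [poleCrossing_apply]
  simp [IdealTriangulation.cross, Finset.sum_sub_distrib, Pi.single_apply, L.pos_across, hs, hu]

/-- The chains supported in a cusp. -/
def cuspChains (c : τ.Cusp) : AddSubgroup (Side T → ℤ) where
  carrier := {x | ∀ s, τ.cusp s.tri ≠ c → x s = 0}
  zero_mem' := fun _ _ => rfl
  add_mem' := fun hx hy s hs => by rw [Pi.add_apply, hx s hs, hy s hs, add_zero]
  neg_mem' := fun hx s hs => by rw [Pi.neg_apply, hx s hs, neg_zero]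

theorem cross_mem_cuspChains {c : τ.Cusp} {s : Side T} (hs : τ.cusp s.tri = c) :
    τ.cross s ∈ cuspChains c := fun s' hs' => by
  have h1 : s' ≠ s := fun h => hs' (h ▸ hs)
  have h2 : s' ≠ τ.across s := fun h => hs' (by rw [h, cusp_across, hs])
  simp [IdealTriangulation.cross, h1, h2]

/-- The chain crossing the rungs upward from the entry triangle of a ladder. -/
def rungChain (l : L.Ladder) (z : ℤ) : Side T → ℤ :=
  intervalSum (fun i => τ.cross (L.topRung ((L.up ^ i) (L.entryTri l)))) z

theorem rungChain_mem (l : L.Ladder) (z : ℤ) : L.rungChain l z ∈ cuspChains (L.ladderCusp l) := by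
  have h : ∀ i : ℤ, τ.cross (L.topRung ((L.up ^ i) (L.entryTri l))) ∈
      cuspChains (L.ladderCusp l) := fun i => by
    refine cross_mem_cuspChains ?_
    rw [L.topRung_tri, ← ladderCusp_ladder,
      ← (L.ladder_eq_iff.2 ⟨i, rfl⟩ : L.ladder (L.entryTri l) = _), ladder_entryTri]
  exact sub_mem (sum_mem fun i _ => h _) (sum_mem fun i _ => h _)

theorem poleCrossing_rungChain (p : L.Ladderpole) (l : L.Ladder) (z : ℤ) :
    L.poleCrossing p (L.rungChain l z) = 0 := by
  have h : ∀ A, L.poleCrossing p (τ.cross (L.topRung A)) = 0 := fun A =>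
    L.poleCrossing_cross_rung p (L.not_pole_topRung A)
  rw [rungChain, intervalSum, map_sub, map_sum, map_sum]
  simp [h]

/-- The number of triangles of a ladder. -/
def ladderSize (l : L.Ladder) : ℕ := Function.minimalPeriod L.up (L.entryTri l)

theorem up_zpow_add_size (l : L.Ladder) (i : ℤ) :
    (L.up ^ (i + L.ladderSize l)) (L.entryTri l) = (L.up ^ i) (L.entryTri l) := by
  rw [zpow_add, Equiv.Perm.mul_apply, zpow_natCast, ← Equiv.Perm.iterate_eq_pow, ladderSize,
    Function.iterate_minimalPeriod]

theorem up_zpow_add_mul_size (l : L.Ladder) (i n : ℤ) :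
    (L.up ^ (i + n * L.ladderSize l)) (L.entryTri l) = (L.up ^ i) (L.entryTri l) := by
  induction n using Int.induction_on with
  | zero => simp
  | succ n ih =>
    have : i + ((n : ℤ) + 1) * L.ladderSize l = i + n * L.ladderSize l + L.ladderSize l := by ring
    rw [this, up_zpow_add_size, ih]
  | pred n ih =>
    rw [← ih, ← L.up_zpow_add_size l (i + (-(n : ℤ) - 1) * L.ladderSize l)]
    congr 2
    ring

theorem rungChain_add_mul_size (l : L.Ladder) (z n : ℤ) :
    L.rungChain l (z + n * L.ladderSize l) = L.rungChain l z + n • L.core l := by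
  rw [rungChain, intervalSum_add_mul_period fun i => by rw [up_zpow_add_size], ← sum_cross_topRung]
  congr 2
  have h := Equiv.Perm.sum_range_minimalPeriod L.up (fun A => τ.cross (L.topRung A))
    (L.entryTri l)
  simp only [zpow_natCast, ← Equiv.Perm.iterate_eq_pow]
  rw [ladderSize, h]
  refine Finset.sum_congr (Finset.filter_congr fun A _ => ?_) fun _ _ => rfl
  rw [← L.ladder_eq_iff, ladder_entryTri, eq_comm]

/-- A class in a cusp crossing every ladderpole once is represented by a simple closed normal
curve. -/
theorem exists_simpleNormalCurve (c : τ.Cusp) {x : Side T → ℤ} (hx : x ∈ τ.cycles)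
    (hc : ∀ s, x s ≠ 0 → τ.cusp s.tri = c)
    (hp : ∀ p : L.Ladderpole, L.poleCusp p = c →
      ∑ s : Side T with (L.pole s ∧ L.pos s) ∧ L.ladderpole s.next = p, x s = 1) :
    ∃ γ : SimpleNormalCurve τ, γ.chain - x ∈ τ.boundaries := by
  obtain ⟨A, rfl⟩ : ∃ A, τ.cusp A = c := Quot.exists_rep c
  set l₀ := L.ladder A with hl₀
  have hl₀c : L.ladderCusp l₀ = τ.cusp A := rfl
  choose z hz using L.exists_zpow_entryTri
  obtain ⟨γ, hγ⟩ := L.exists_spiral hz l₀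
  have hmem : γ.chain ∈ cuspChains (L.ladderCusp l₀) := by
    rw [hγ]
    refine sum_mem fun l hl => ?_
    rw [← (Finset.mem_filter.1 hl).2]
    refine add_mem (L.rungChain_mem l (z l)) (cross_mem_cuspChains ?_)
    rw [← ladderCusp_ladder]
    exact congrArg L.ladderCusp (L.ladder_exitTri l)
  have hcross : ∀ p : L.Ladderpole, L.poleCusp p = L.ladderCusp l₀ →
      L.poleCrossing p γ.chain = 1 := fun p hp => by
    have h : ∀ l, L.poleCrossing p (intervalSum (fun i =>
        τ.cross (L.topRung ((L.up ^ i) (L.entryTri l)))) (z l) +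
          τ.cross (L.gate (L.rightPole l))) = if l = L.rightPole.symm p then 1 else 0 := fun l => by
      rw [map_add, L.poleCrossing_cross_up p (L.pole_gate _) (L.pos_gate _), ladderpole_gate]
      have := L.poleCrossing_rungChain p l (z l)
      rw [rungChain] at this
      rw [this, zero_add]
      simp only [Equiv.eq_symm_apply]
    rw [hγ, map_sum]
    simp only [h]
    rw [Finset.sum_ite_eq', if_pos]
    rw [Finset.mem_filter]
    refine ⟨Finset.mem_univ _, ?_⟩
    rw [← poleCusp_rightPole, Equiv.apply_symm_apply, hp]
  -- The first spiral and `x` cross every ladderpole of the cusp equally often, so they differ by a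
  -- multiple of a core curve.
  obtain ⟨n, hn⟩ := L.exists_sub_core_mem_boundaries l₀ (sub_mem γ.chain_mem hx)
    (fun s hs => by
      by_contra h
      refine hs ?_
      rw [Pi.sub_apply, hmem s h, by_contra fun h' => h (hc s h'), sub_zero])
    (fun p hp' => by
      have h1 := hcross p hp'
      rw [poleCrossing_apply] at h1
      simp only [Pi.sub_apply]
      rw [Finset.sum_sub_distrib, h1, hp p hp', sub_self])
  -- The discrepancy is removed by going around `l₀` an additional `-n` times; the spiral still ends
  -- in the exit triangle.
  set z' := Function.update z l₀ (z l₀ + (-n) * L.ladderSize l₀) with hz'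
  have hz'' : ∀ l, (L.up ^ z' l) (L.entryTri l) = L.exitTri l := fun l => by
    by_cases h : l = l₀
    · subst h
      rw [hz', Function.update_self, up_zpow_add_mul_size, hz]
    · rw [hz', Function.update_of_ne h, hz]
  obtain ⟨γ', hγ'⟩ := L.exists_spiral hz'' l₀
  refine ⟨γ', ?_⟩
  have hdiff : γ'.chain = γ.chain - n • L.core l₀ := by
    have h : ∀ l, L.rungChain l (z' l) =
        L.rungChain l (z l) - if l = l₀ then n • L.core l₀ else 0 := fun l => by
      by_cases h : l = l₀
      · rw [if_pos h, h, hz', Function.update_self, rungChain_add_mul_size, neg_smul,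
          sub_eq_add_neg]
      · rw [if_neg h, hz', Function.update_of_ne h, sub_zero]
    rw [hγ, hγ']
    simp only [rungChain] at h
    simp only [h, Finset.sum_add_distrib, Finset.sum_sub_distrib]
    rw [Finset.sum_ite_eq', if_pos (by simp)]
    abel
  rw [hdiff, sub_right_comm]
  exact hn

end LadderStructure
end

noncomputable section
open scoped Classical

/-! ## Holonomy of the deformed structures -/

namespace IdealTriangulation

variable {T : Type*} [Fintype T] {τ : IdealTriangulation T}

theorem homologyClass_eq_iff (x y : τ.cycles) :
    τ.homologyClass x = τ.homologyClass y ↔ (x : Side T → ℤ) - y ∈ τ.boundaries := by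
  rw [homologyClass, homologyClass, eq_comm, QuotientAddGroup.eq, AddSubgroup.mem_addSubgroupOf,
    neg_add_eq_sub]
  rfl

theorem _root_.SimpleNormalCurve.zsmul_homologyClass_eq_iff (γ : SimpleNormalCurve τ) (m : ℤ)
    (x : τ.cycles) :
    m • γ.homologyClass = τ.homologyClass x ↔ m • γ.chain - (x : Side T → ℤ) ∈ τ.boundaries :=
  homologyClass_eq_iff (m • (⟨γ.chain, γ.chain_mem⟩ : τ.cycles)) x

variable {α : T → Fin 3 → ℝ} {out : T → Fin 4 → Bool}

theorem ladderStructure_up_iff (hα : τ.IsVeering α) (hout : τ.IsTransverseTaut α out)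
    (s : Side T) : ((ladderStructure hα hout).pole s ∧ (ladderStructure hα hout).pos s) ↔
      τ.IsUpward α out s := by
  show (τ.IsPoleSegment α s ∧ (if τ.IsPoleSegment α s then _ else _)) ↔ _
  constructor
  · rintro ⟨h1, h2⟩
    rwa [if_pos h1] at h2
  · intro h
    exact ⟨h.1, by rwa [if_pos h.1]⟩

theorem intersectionNumber_eq (hα : τ.IsVeering α) (hout : τ.IsTransverseTaut α out)
    (x : Side T → ℤ) (p : τ.Ladderpole α) :
    ∑ s : Side T with ((ladderStructure hα hout).pole s ∧ (ladderStructure hα hout).pos s) ∧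
      (ladderStructure hα hout).ladderpole s.next = p, x s = τ.intersectionNumber α out x p := by
  simp only [ladderStructure_up_iff]
  rfl

/-- A class meeting the ladderpoles of a cusp is, up to sign, represented by a curve; its holonomy
is determined by the number of its crossings of the ladderpoles. -/
theorem hasHolonomy_deformation (hα : τ.IsVeering α) (hout : τ.IsTransverseTaut α out)
    {c : τ.Cusp} {k : ℕ} (hk : τ.numLadders α c = 2 * k) {ε : ℤ} (hε : ε = 1 ∨ ε = -1)
    {δ : τ.H1} (hδ : τ.MeetsLadderpoles α out c δ ε) (J : Set τ.Cusp) :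
    τ.HasHolonomy (τ.deformation α out J) δ (if c ∈ J then ε * k * Real.pi else 0) := by
  set L := ladderStructure hα hout with hL
  obtain ⟨x, rfl, hx, hm⟩ := hδ
  have hm' : ∀ p : L.Ladderpole, L.poleCusp p = c →
      ∑ s : Side T with (L.pole s ∧ L.pos s) ∧ L.ladderpole s.next = p, (x : Side T → ℤ) s = ε := by
    rintro ⟨d⟩ hd
    exact (intersectionNumber_eq hα hout x _).trans (hm d hd)
  have hcard : (Finset.univ.filter fun p : L.Ladderpole => L.poleCusp p = c).card = 2 * k :=
    (L.card_ladderpoles c).trans hk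
  have hk0 : (k : ℤ) ≠ 0 := by
    have := L.card_ladderpoles_pos c
    omega
  have hcr : ∀ K : Set τ.Cusp, L.crossing K (x : Side T → ℤ) =
      if c ∈ K then ε * (2 * k : ℕ) else 0 := fun K => by
    rw [L.crossing_of_support K hx ε hm', hcard]
  have hε0 : ε ≠ 0 := by rcases hε with rfl | rfl <;> norm_num
  have hεε : ε * ε = 1 := by rcases hε with rfl | rfl <;> norm_num
  refine ⟨?_, fun γ m _ hγ => ?_⟩
  -- The cycle `ε • x` crosses each ladderpole once positively, and `ε` is its own inverse.
  · obtain ⟨γ, hγ⟩ := L.exists_simpleNormalCurve c (τ.cycles.zsmul_mem x.2 ε)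
      (fun s hs => hx s fun h => hs (by simp [h]))
      (fun p hp => by
        simp only [Pi.smul_apply, smul_eq_mul]
        rw [← Finset.mul_sum, hm' p hp, hεε])
    have h1 : ε • γ.homologyClass = τ.homologyClass x := by
      rw [γ.zsmul_homologyClass_eq_iff]
      have := τ.boundaries.zsmul_mem hγ ε
      rwa [smul_sub, smul_smul, hεε, one_smul] at this
    refine ⟨γ, ε, fun h => ?_, h1⟩
    rw [h, smul_zero] at h1
    have h2 := (homologyClass_eq_iff x 0).1 h1.symm
    have h3 := L.crossing_boundary Set.univ h2
    rw [AddSubgroup.coe_zero, sub_zero, hcr, if_pos (Set.mem_univ c)] at h3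
    have : ε * (2 * k : ℕ) ≠ 0 := mul_ne_zero hε0 (by push_cast; omega)
    exact this h3
  · rw [γ.zsmul_homologyClass_eq_iff] at hγ
    -- Crossing numbers are homological, so every presentation `m • [γ]` has the same ones. The set
    -- of all cusps shows that `γ` crosses the ladderpoles a nonzero number of times; the set `J`
    -- gives the holonomy.
    have hK : ∀ K, m * L.crossing K γ.chain = if c ∈ K then ε * (2 * k : ℕ) else 0 := fun K => by
      have := L.crossing_boundary K hγ
      rw [map_sub, map_zsmul, sub_eq_zero, hcr, smul_eq_mul] at this
      exact this
    have h0 : γ.turningAngle α = 0 := by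
      refine turningAngle_eq_zero hα hout γ fun h => ?_
      have h1 := hK Set.univ
      rw [L.crossing_chain] at h1
      simp only [Set.mem_univ, if_true] at h1
      rw [h, mul_zero] at h1
      have : ε * (2 * k : ℕ) ≠ 0 := mul_ne_zero hε0 (by push_cast; omega)
      exact this h1.symm
    rw [turningAngle_deformation J hα hout, h0, zero_add]
    have h1 := congrArg (Int.cast : ℤ → ℝ) (hK J)
    rw [Int.cast_mul] at h1
    have h2 : (m : ℝ) * (Real.pi / 2 * L.crossing J γ.chain) =
        Real.pi / 2 * (m * L.crossing J γ.chain) := by ring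
    rw [h2, h1]
    split_ifs
    · push_cast; ring
    · simp

end IdealTriangulation
end

theorem proposition5p6 {T : Type*} [Fintype T] (τ : IdealTriangulation T)
    (α : T → Fin 3 → ℝ) (hα : τ.IsVeering α)
    (out : T → Fin 4 → Bool) (hout : τ.IsTransverseTaut α out)
    (k : τ.Cusp → ℕ) (hk : ∀ c, τ.numLadders α c = 2 * k c)
    (ε : ℤ) (hε : ε = 1 ∨ ε = -1)
    (δ : τ.Cusp → τ.H1) (hδ : ∀ c, τ.MeetsLadderpoles α out c (δ c) ε)
    (J : Set τ.Cusp) :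
    ∃ θ : T → Fin 3 → ℝ, τ.IsNonnegAngleStructure θ ∧
      ∀ c, (c ∈ J → τ.HasHolonomy θ (δ c) (ε * k c * Real.pi)) ∧
        (c ∉ J → τ.HasHolonomy θ (δ c) 0) := by
  refine ⟨τ.deformation α out J,
    IdealTriangulation.isNonnegAngleStructure_deformation J hα hout, fun c => ?_⟩
  have h := IdealTriangulation.hasHolonomy_deformation hα hout (hk c) hε (hδ c) J
  exact ⟨fun hc => by rwa [if_pos hc] at h, fun hc => by rwa [if_neg hc] at h⟩
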